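/- Let $\alpha\in(\tfrac12,1)$. On $\mathbb R^2$ use $\hat f(\xi)=\int f(x)e^{-2\pi i x\cdot\xi}\,dx$, let $\Lambda^{s}$ be the Fourier multiplier with symbol $|2\pi\xi|^{s}$, let $\mathcal R_{2\alpha}=\Lambda^{-2\alpha}\partial_1$ (symbol $2\pi i\xi_1|2\pi\xi|^{-2\alpha}$), and let $\|f\|_{\dot H^{s}}=\||2\pi\xi|^{s}\hat f\|_{L^2}$. Let $0<T\le\infty$, and let $(u,p,\theta)$ be a smooth solution on $[0,T)\times\mathbb R^2$ of $$\partial_t u+u\cdot\nabla u+\Lambda^{2\alpha}u=\nabla p+\theta e_2,\qquad \nabla\cdot u=0,\qquad \partial_t\theta+u\cdot\nabla\theta=0,\qquad u|_{t=0}=u_0,\quad \theta|_{t=0}=\theta_0 .$$ Here a smooth solution means that $u,p,\theta$ are $C^\infty$ on $[0,T)\times\mathbb R^2$, that $u(t)$ and $\theta(t)$ belong to $H^k(\mathbb R^2)$ for every $k$, with norms bounded on compact subintervals of $[0,T)$, that $\nabla p(t)\in L^2$ for every $t$, and that the equations hold pointwise. Let $u_0\in H^1$ and $\theta_0\in L^2\cap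 L^\infty$, and let $\omega=\nabla^\perp\cdot u=\partial_1u_2-\partial_2u_1$. Then there are constants $C_0,C_1>0$, depending only on $\alpha$ and on upper bounds for $\|u_0\|_{H^1}$, $\|\theta_0\|_{L^2}$ and $\|\theta_0\|_{L^\infty}$ (in particular not on $T$), such that for every $t\in[0,T)$ $$\|\omega(t)\|_{L^2}^2+\int_0^t\|\omega(s)-\mathcal R_{2\alpha}\theta(s)\|_{\dot H^{\alpha}}^2\,ds\le C_0\exp(C_1t).$$ -/

import Mathlib

open MeasureTheory Set
open scoped ENNReal NNReal FourierTransform SchwartzMap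

noncomputable section

namespace Boussinesq

/-- The plane `ℝ²` with its Euclidean norm. Coordinates are indexed by `0` and `1`. -/
abbrev Plane : Type := EuclideanSpace ℝ (Fin 2)

/-- The `i`-th standard basis vector; the vector `e₂ = (0, 1)` is `basisVec 1`. -/
def basisVec (i : Fin 2) : Plane := EuclideanSpace.single i 1

/-- Divergence of a vector field. -/
def divergence (v : Plane → Plane) (x : Plane) : ℝ :=
  ∑ i, fderiv ℝ v x (basisVec i) i

/-- Scalar vorticity `∇^⊥ · v = ∂₁ v₂ - ∂₂ v₁`. -/
def vorticity (v : Plane → Plane) (x : Plane) : ℝ :=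
  fderiv ℝ v x (basisVec 0) 1 - fderiv ℝ v x (basisVec 1) 0

open Classical in
/-- The (Plancherel) Fourier transform of a square integrable real function, with the convention
`f̂(ξ) = ∫ f(x) exp(-2πi x·ξ) dx`; it is set to `0` if `f` is not square integrable. -/
def planeFourier (f : Plane → ℝ) : Plane → ℂ :=
  if h : MemLp (fun x => (f x : ℂ)) 2 (volume : Measure Plane) then
    ⇑(𝓕 (h.toLp (fun x => (f x : ℂ))) : Lp ℂ 2 (volume : Measure Plane))
  else 0

/-- The Fourier multiplier with symbol `m`, `x ↦ ∫ m(ξ) f̂(ξ) exp(2πi x·ξ) dξ`. It is only applied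
to functions `f` in all the spaces `H^k` and to symbols for which `m f̂` is integrable and
`m(-ξ)` is the conjugate of `m(ξ)`; the integral is then real. -/
def fourierMultiplier (m : Plane → ℂ) (f : Plane → ℝ) (x : Plane) : ℝ :=
  (𝓕⁻ (fun ξ : Plane => m ξ * planeFourier f ξ) x).re

/-- The operator `Λ^s = (-Δ)^{s/2}`, with symbol `|2πξ|^s`. -/
def fracLambda (s : ℝ) (f : Plane → ℝ) : Plane → ℝ :=
  fourierMultiplier (fun ξ => (((2 * Real.pi * ‖ξ‖) ^ s : ℝ) : ℂ)) f

/-- `Λ^s` acting on the components of a vector field. -/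
def fracLambdaVec (s : ℝ) (v : Plane → Plane) (x : Plane) : Plane :=
  WithLp.toLp 2 fun i => fracLambda s (fun y => v y i) x

/-- The operator `R_{2α} = Λ^{1-2α} R₁ = Λ^{-2α} ∂₁` (so that `∂₁ f = Λ^{2α} R_{2α} f`), with symbol
`2πi ξ₁ |2πξ|^{-2α}`. -/
def rieszOp (α : ℝ) (f : Plane → ℝ) : Plane → ℝ :=
  fourierMultiplier
    (fun ξ => Complex.I * ((2 * Real.pi * ξ 0 * (2 * Real.pi * ‖ξ‖) ^ (-(2 * α)) : ℝ) : ℂ)) f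

/-- The locally integrable function `G` is the Fourier transform of `f` in the sense of tempered
distributions. -/
structure IsFourierTransform (f : Plane → ℝ) (G : Plane → ℂ) : Prop where
  locallyIntegrable : LocallyIntegrable G volume
  integrable_left : ∀ φ : 𝓢(Plane, ℂ), Integrable (fun x => (f x : ℂ) * (𝓕 φ) x) volume
  integrable_right : ∀ φ : 𝓢(Plane, ℂ), Integrable (fun ξ => G ξ * φ ξ) volume
  integral_eq : ∀ φ : 𝓢(Plane, ℂ), ∫ x, (f x : ℂ) * (𝓕 φ) x = ∫ ξ, G ξ * φ ξ

/-- The homogeneous Sobolev norm `‖f‖_{Ḣ^s} = ‖ |2πξ|^s f̂ ‖_{L²}`, where `f̂` is the Fourier transform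
of `f` as a tempered distribution, required to be a locally integrable function. Such a function is
unique up to null sets, so that the infimum runs over at most one value; it is `∞` if there is no
such function. -/
def homSobolevNorm (s : ℝ) (f : Plane → ℝ) : ℝ≥0∞ :=
  ⨅ (G : Plane → ℂ) (_ : IsFourierTransform f G),
    eLpNorm (fun ξ => (2 * Real.pi * ‖ξ‖) ^ s • G ξ) 2 volume

/-- The time interval `[0, T)`, where `T = ∞` is allowed. -/
def timeInterval (T : EReal) : Set ℝ := {t | 0 ≤ t ∧ (t : EReal) < T}

/-- The functions `f(t)`, `t ∈ [0, T)`, lie in every Sobolev space `H^k(ℝ²)`, with norms that are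
bounded on compact subintervals of `[0, T)`. -/
def LocallyBoundedInSobolev {F : Type*} [NormedAddCommGroup F] [NormedSpace ℝ F]
    (T : EReal) (f : ℝ → Plane → F) : Prop :=
  ∀ k : ℕ, ∀ τ ∈ timeInterval T, ∃ C : ℝ≥0, ∀ t ∈ Icc 0 τ,
    eLpNorm (iteratedFDeriv ℝ k (f t)) 2 volume ≤ C

/-- `(u, p, θ)` is a smooth solution on `[0, T) × ℝ²`, in the Sobolev scale, of
`∂ₜu + u·∇u + Λ^{2α} u = ∇p + θ e₂`, `∇·u = 0`, `∂ₜθ + u·∇θ = 0`, `u(0) = u₀`, `θ(0) = θ₀`.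
Time derivatives at `t = 0` are one-sided. The condition on `p` fixes the pressure gradient at
spatial infinity. -/
structure IsSmoothSolution (α : ℝ) (T : EReal) (u₀ : Plane → Plane) (θ₀ : Plane → ℝ)
    (u : ℝ → Plane → Plane) (p θ : ℝ → Plane → ℝ) : Prop where
  lifespan_pos : 0 < T
  smooth_u : ContDiffOn ℝ (⊤ : ℕ∞) (fun z : ℝ × Plane => u z.1 z.2) (timeInterval T ×ˢ univ)
  smooth_p : ContDiffOn ℝ (⊤ : ℕ∞) (fun z : ℝ × Plane => p z.1 z.2) (timeInterval T ×ˢ univ)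
  smooth_θ : ContDiffOn ℝ (⊤ : ℕ∞) (fun z : ℝ × Plane => θ z.1 z.2) (timeInterval T ×ˢ univ)
  sobolev_u : LocallyBoundedInSobolev T u
  sobolev_θ : LocallyBoundedInSobolev T θ
  memLp_grad_p : ∀ t ∈ timeInterval T, MemLp (fun x => gradient (p t) x) 2 volume
  momentum : ∀ t ∈ timeInterval T, ∀ x : Plane,
    HasDerivWithinAt (fun s => u s x)
      (-(fderiv ℝ (u t) x (u t x)) - fracLambdaVec (2 * α) (u t) x
        + gradient (p t) x + θ t x • basisVec 1) (timeInterval T) t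
  incompressible : ∀ t ∈ timeInterval T, ∀ x : Plane, divergence (u t) x = 0
  transport : ∀ t ∈ timeInterval T, ∀ x : Plane,
    HasDerivWithinAt (fun s => θ s x) (-(fderiv ℝ (θ t) x (u t x))) (timeInterval T) t
  initial_u : u 0 = u₀
  initial_θ : θ 0 = θ₀

end Boussinesq

end

noncomputable section

namespace Boussinesq

open scoped ContDiff ComplexConjugate Topology

/-! ### Square integrable functions and their Fourier transform -/

/-! Taking the curl removes the pressure: `∂ₜω + u·∇ω + Λ^{2α}ω = ∂₁θ`, and `∂₁θ = Λ^{2α}R_{2α}θ`.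
The loss of a derivative in `∂₁θ` is avoided by passing to `G = ω - R_{2α}θ`, since `R_{2α}` is
transported along with `θ`: then `∂ₜG + u·∇G + Λ^{2α}G = [R_{2α}, u·∇]θ`, so only a commutator must
be controlled, and the dissipation stays on the left.

The symbol of `R_{2α}` is unbounded at low frequencies. It is therefore replaced by `K`, obtained
from `|2πξ|^{-2α} = Γ(α)⁻¹ ∫₀^∞ s^{α-1} exp(-s|2πξ|²) ds` by keeping `s ∈ (0,1]` only
(`truncSymbol`, `highSymbol`). Three symbol bounds justify this: `K` is bounded on `L²`
(`norm_highSymbol_le`); so is `∂₁ - Λ^{2α}K`, the new linear error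
(`norm_derivSymbol_sub_highSymbol_le`); and so is `Λ^α(R_{2α} - K)`, which allows the return to
`R_{2α}` at the end (`norm_rpow_mul_symbol_sub_le`).

The commutator is estimated for each `∂₁e^{sΔ}` and then integrated in `s`. With `η = ∂₁ heat s`, an
integration by parts and `div u = 0` give `[∂₁e^{sΔ}, u·∇]θ(x) = Σⱼ ∫ ∂ⱼη(x-y)(uⱼ(y)-uⱼ(x))θ(y) dy`.
Its `L²` norm is at most a constant times `s^{-1/2} ‖θ‖_∞ ‖∇u‖₂`, because `‖u(·-z)-u‖₂ ≤ |z|‖∇u‖₂`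
and `∫|z||∇η(z)|dz` is of order `s^{-1/2}` (`abs_heatCommutator_le`). The weight `s^{α-1}s^{-1/2}`
is integrable at `0` exactly because `α > 1/2` (`norm_high_commutator_le`).

Since `‖∇u‖₂` is controlled by `‖ω‖₂ ≤ ‖G‖₂ + C‖θ‖₂` (`gradNorm_le_vort`, `norm_vort_le`), and the
`L²` and `L^∞` bounds of `θ` persist (`norm_toL2_θ_le`, `abs_θ_le`), the energy inequality for `G`
is linear in `‖G‖₂² + M²` (`inner_goodVort_le_energyRate`). Grönwall's inequality concludes
(`energy_le`, `vort_estimate`).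

The equations hold only pointwise in `x`. To differentiate `L²` norms in time they are tested
against compactly supported functions, which with uniform Sobolev bounds yields Lipschitz curves in
`L²` with a weak derivative (`HasWeakDeriv`); that is enough to differentiate quadratic functionals.
-/

/-- The complex `L²` space on the plane. -/
abbrev L2C : Type := Lp ℂ 2 (volume : Measure Plane)

open Classical in
/-- The class in `L²` of a real function, `0` if the function is not square integrable. -/
def toL2 (f : Plane → ℝ) : L2C :=
  if h : MemLp (fun x => (f x : ℂ)) 2 (volume : Measure Plane) then h.toLp _ else 0

lemma toL2_coeFn {f : Plane → ℝ} (hf : MemLp f 2) : ⇑(toL2 f) =ᵐ[volume] fun x => (f x : ℂ) := by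
  have h : MemLp (fun x => (f x : ℂ)) 2 (volume : Measure Plane) := hf.ofReal
  rw [toL2, dif_pos h]
  exact h.coeFn_toLp

lemma planeFourier_eq {f : Plane → ℝ} (hf : MemLp f 2) :
    planeFourier f = ⇑(𝓕 (toL2 f) : L2C) := by
  have h : MemLp (fun x => (f x : ℂ)) 2 (volume : Measure Plane) := hf.ofReal
  rw [toL2, dif_pos h, planeFourier, dif_pos h]

lemma memLp_planeFourier {f : Plane → ℝ} (hf : MemLp f 2) : MemLp (planeFourier f) 2 := by
  rw [planeFourier_eq hf]; exact Lp.memLp _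

lemma L2_pairing (F : L2C) (φ : 𝓢(Plane, ℂ)) :
    ∫ x, F x * (𝓕 φ) x = ∫ x, (𝓕 F : L2C) x * φ x := by
  have h := congrArg (fun T => T φ) (Lp.fourier_toTemperedDistribution_eq F)
  simp only [TemperedDistribution.fourier_apply, Lp.toTemperedDistribution_apply,
    smul_eq_mul] at h
  simpa only [mul_comm] using h

lemma planeFourier_pairing {f : Plane → ℝ} (hf : MemLp f 2) (φ : 𝓢(Plane, ℂ)) :
    ∫ x, (f x : ℂ) * (𝓕 φ) x = ∫ x, planeFourier f x * φ x := by
  rw [planeFourier_eq hf, ← L2_pairing]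
  refine integral_congr_ae ?_
  filter_upwards [toL2_coeFn hf] with x hx
  rw [hx]

/-- A smooth compactly supported real function as a complex Schwartz function. -/
def testFunction (g : Plane → ℝ) (hg : ContDiff ℝ ∞ g) (hc : HasCompactSupport g) :
    𝓢(Plane, ℂ) :=
  HasCompactSupport.toSchwartzMap (f := Complex.ofRealCLM ∘ g) (hc.comp_left rfl) (by fun_prop)

@[simp] lemma testFunction_apply {g : Plane → ℝ} (hg : ContDiff ℝ ∞ g)
    (hc : HasCompactSupport g) (x : Plane) : testFunction g hg hc x = (g x : ℂ) := rfl

lemma L2_fourier_ae_eq {F : L2C} {G : Plane → ℂ} (hG : LocallyIntegrable G)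
    (h : ∀ (g : Plane → ℝ) (hg : ContDiff ℝ ∞ g) (hc : HasCompactSupport g),
      ∫ x, F x * (𝓕 (testFunction g hg hc)) x = ∫ x, G x * g x) :
    ⇑(𝓕 F : L2C) =ᵐ[volume] G := by
  refine ae_eq_of_integral_contDiff_smul_eq
    ((Lp.memLp (𝓕 F : L2C)).locallyIntegrable (by norm_num)) hG fun g hg hc => ?_
  have h1 := L2_pairing F (testFunction g hg hc)
  rw [h g hg hc] at h1
  simp only [testFunction_apply] at h1
  simp only [Complex.real_smul]
  simpa only [mul_comm] using h1.symm

/-- The device for identifying transforms: pairing with real test functions on the frequency side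
determines a locally integrable function. The formulas for reflections, derivatives and the heat
kernel all come from it. -/
lemma planeFourier_ae_eq {f : Plane → ℝ} (hf : MemLp f 2) {G : Plane → ℂ}
    (hG : LocallyIntegrable G)
    (h : ∀ (g : Plane → ℝ) (hg : ContDiff ℝ ∞ g) (hc : HasCompactSupport g),
      ∫ x, (f x : ℂ) * (𝓕 (testFunction g hg hc)) x = ∫ x, G x * g x) :
    planeFourier f =ᵐ[volume] G := by
  rw [planeFourier_eq hf]
  refine L2_fourier_ae_eq hG fun g hg hc => ?_
  rw [← h g hg hc]
  refine integral_congr_ae ?_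
  filter_upwards [toL2_coeFn hf] with x hx
  rw [hx]

/-- This is the reality of `f`. For symbols with the same symmetry it makes the real part in
`fourierMultiplier` lossless. -/
lemma planeFourier_neg {f : Plane → ℝ} (hf : MemLp f 2) :
    ∀ᵐ ξ, planeFourier f (-ξ) = conj (planeFourier f ξ) := by
  have hm : MemLp (fun ξ => conj (planeFourier f (-ξ))) 2 (volume : Measure Plane) := by
    have h1 : MemLp (fun ξ => planeFourier f (-ξ)) 2 (volume : Measure Plane) :=
      (memLp_planeFourier hf).comp_measurePreserving (Measure.measurePreserving_neg _)
    exact h1.star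
  have h := planeFourier_ae_eq hf (hm.locallyIntegrable (by norm_num)) (fun g hg hc => by
    have hg' : ContDiff ℝ ∞ (fun x => g (-x)) := hg.comp contDiff_neg
    have hc' : HasCompactSupport (fun x => g (-x)) := hc.comp_homeomorph (Homeomorph.neg Plane)
    have key := planeFourier_pairing hf (testFunction _ hg' hc')
    have e1 : ∀ x, (𝓕 (testFunction g hg hc)) x
        = conj ((𝓕 (testFunction _ hg' hc')) x) := by
      intro x
      rw [SchwartzMap.fourier_coe, SchwartzMap.fourier_coe, Real.fourier_eq', Real.fourier_eq',
        ← integral_conj, ← integral_neg_eq_self]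
      refine integral_congr_ae (.of_forall fun v => ?_)
      simp [← Complex.exp_conj, Complex.conj_ofNat]
    calc ∫ x, (f x : ℂ) * (𝓕 (testFunction g hg hc)) x
        = conj (∫ x, (f x : ℂ) * (𝓕 (testFunction _ hg' hc')) x) := by
          rw [← integral_conj]
          refine integral_congr_ae (.of_forall fun v => ?_)
          simp [e1]
      _ = conj (∫ x, planeFourier f (-x) * g x) := by
          rw [key, ← integral_neg_eq_self]
          simp
      _ = _ := by
          rw [← integral_conj]
          refine integral_congr_ae (.of_forall fun v => ?_)
          simp)
  filter_upwards [h] with ξ hξ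
  rw [hξ]; simp

/-- The partial derivative `∂_j f`. -/
def pd (j : Fin 2) (f : Plane → ℝ) (x : Plane) : ℝ := fderiv ℝ f x (basisVec j)

lemma inner_basisVec (x : Plane) (j : Fin 2) : inner ℝ x (basisVec j) = x j := by
  simp [basisVec, EuclideanSpace.inner_single_right]

/-- The symbol `2πi ξ_j` of the partial derivative `∂_j`. -/
def derivSymbol (j : Fin 2) (ξ : Plane) : ℂ := 2 * Real.pi * Complex.I * (ξ j : ℂ)

lemma continuous_derivSymbol (j : Fin 2) : Continuous (derivSymbol j) := by
  unfold derivSymbol; fun_prop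

lemma norm_derivSymbol_le (j : Fin 2) (ξ : Plane) : ‖derivSymbol j ξ‖ ≤ 2 * Real.pi * ‖ξ‖ := by
  have h := PiLp.norm_apply_le ξ j
  have hp := Real.pi_pos
  simp only [derivSymbol, norm_mul, Complex.norm_real, Complex.norm_I, Complex.norm_ofNat, mul_one,
    Real.norm_eq_abs, abs_of_pos hp] at h ⊢
  gcongr

lemma planeFourier_pd {f : Plane → ℝ} (j : Fin 2) (hd : Differentiable ℝ f) (hf : MemLp f 2)
    (hf' : MemLp (pd j f) 2) :
    planeFourier (pd j f) =ᵐ[volume]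
      fun ξ => derivSymbol j ξ * planeFourier f ξ := by
  refine planeFourier_ae_eq hf' ?_ fun g hg hc => ?_
  · have h1 := (memLp_planeFourier hf).locallyIntegrable (by norm_num)
    have h2 := continuous_derivSymbol j
    rw [← locallyIntegrableOn_univ] at h1 ⊢
    exact h1.continuousOn_mul h2.continuousOn isOpen_univ.isLocallyClosed
  · set φ := testFunction g hg hc
    have hS : ∀ ψ : 𝓢(Plane, ℂ), MemLp ψ 2 (volume : Measure Plane) := fun ψ => ψ.memLp 2
    have hcd : Differentiable ℝ (fun x => (f x : ℂ)) :=
      Complex.ofRealCLM.differentiable.comp hd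
    have hfd : ∀ x, fderiv ℝ (fun x => (f x : ℂ)) x (basisVec j) = (pd j f x : ℂ) := by
      intro x
      have := (Complex.ofRealCLM.hasFDerivAt.comp x (hd x).hasFDerivAt).fderiv
      have h2 : fderiv ℝ (fun x => (f x : ℂ)) x = Complex.ofRealCLM.comp (fderiv ℝ f x) := this
      rw [h2]; rfl
    set Φ : 𝓢(Plane, ℂ) := 𝓕 φ with hΦ
    have hφd : ∀ x, fderiv ℝ Φ x (basisVec j)
        = (𝓕 (-(2 * Real.pi * Complex.I) • SchwartzMap.smulLeftCLM ℂ
            (fun y : Plane => inner ℝ y (basisVec j)) φ)) x := by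
      intro x
      have := congrArg (fun ψ : 𝓢(Plane, ℂ) => ψ x) (SchwartzMap.lineDerivOp_fourier_eq φ (basisVec j))
      simpa [SchwartzMap.lineDerivOp_apply_eq_fderiv, hΦ] using this
    -- The derivative lands on the Schwartz function `𝓕 φ`, where it becomes multiplication of `φ`
    -- by `-2πi x_j` before the transform. Hence only `f` and `∂_j f` in `L²` are needed.
    have ibp := integral_mul_fderiv_eq_neg_fderiv_mul_of_integrable (μ := (volume : Measure Plane))
      (f := fun x => (f x : ℂ)) (g := Φ) (v := basisVec j)
      (by simp only [hfd]; exact hf'.ofReal.integrable_mul (hS _))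
      (by simp only [hφd]; exact hf.ofReal.integrable_mul (hS _))
      (hf.ofReal.integrable_mul (hS _))
      (fun x _ => hcd x) (fun x _ => Φ.differentiable x)
    simp only [hfd, hφd] at ibp
    rw [planeFourier_pairing hf] at ibp
    rw [← neg_eq_iff_eq_neg.2 ibp, ← integral_neg]
    refine integral_congr_ae (.of_forall fun x => ?_)
    have hgr : (fun y : Plane => inner ℝ y (basisVec j)).HasTemperateGrowth := by fun_prop
    beta_reduce
    rw [smul_apply, SchwartzMap.smulLeftCLM_apply_apply hgr, inner_basisVec, derivSymbol]
    simp only [φ, testFunction_apply, Complex.real_smul, smul_eq_mul]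
    ring

/-! ### The inverse Fourier integral -/

lemma integral_fourierInv_mul {g : Plane → ℂ} (hg : Integrable g) (φ : 𝓢(Plane, ℂ)) :
    ∫ x, 𝓕⁻ g x * φ x = ∫ ξ, g ξ * (𝓕⁻ φ) ξ := by
  have h := VectorFourier.integral_fourierIntegral_smul_eq_flip (L := innerₗ Plane)
    (e := Real.fourierChar) (μ := volume) (ν := volume) (f := fun ξ => g (-ξ)) (g := φ)
    Real.continuous_fourierChar continuous_inner hg.comp_neg φ.integrable
  have e1 : ∀ x, VectorFourier.fourierIntegral Real.fourierChar volume (innerₗ Plane)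
      (fun ξ => g (-ξ)) x = 𝓕⁻ g x := fun x => by
    rw [Real.fourierInv_eq_fourier_comp_neg]; rfl
  have e2 : ∀ x, VectorFourier.fourierIntegral Real.fourierChar volume (innerₗ Plane).flip
      φ x = (𝓕⁻ φ) (-x) := fun x => by
    rw [SchwartzMap.fourierInv_coe, Real.fourierInv_eq_fourier_neg, neg_neg, flip_innerₗ]; rfl
  simp only [e1, e2, smul_eq_mul] at h
  rw [h, ← integral_neg_eq_self]
  simp

lemma continuous_fourierInv {g : Plane → ℂ} (hg : Integrable g) :
    Continuous (𝓕⁻ g : Plane → ℂ) := by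
  rw [Real.fourierInv_eq_fourier_comp_neg]
  exact VectorFourier.fourierIntegral_continuous Real.continuous_fourierChar continuous_inner
    hg.comp_neg

lemma norm_fourierInv_le (g : Plane → ℂ) (x : Plane) : ‖𝓕⁻ g x‖ ≤ ∫ ξ, ‖g ξ‖ := by
  rw [Real.fourierInv_eq]
  refine (norm_integral_le_integral_norm _).trans (le_of_eq ?_)
  simp

/-- `fourierMultiplier` is defined by an inverse integral, while norms are computed with the
Plancherel isometry. On `L¹ ∩ L²` the two inverses have the same pairings with test functions. -/
lemma fourierInv_ae_eq {g : Plane → ℂ} (hg : Integrable g) (hg2 : MemLp g 2) :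
    (𝓕⁻ g : Plane → ℂ) =ᵐ[volume] ⇑(𝓕⁻ (hg2.toLp g) : L2C) := by
  refine ae_eq_of_integral_contDiff_smul_eq (continuous_fourierInv hg).locallyIntegrable
    ((Lp.memLp (𝓕⁻ (hg2.toLp g) : L2C)).locallyIntegrable (by norm_num)) fun χ hχ hc => ?_
  have h1 := integral_fourierInv_mul hg (testFunction χ hχ hc)
  have h2 := L2_pairing (𝓕⁻ (hg2.toLp g) : L2C) (𝓕⁻ (testFunction χ hχ hc))
  rw [FourierTransform.fourier_fourierInv_eq, FourierTransform.fourier_fourierInv_eq] at h2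
  have h3 : ∫ ξ, (hg2.toLp g) ξ * (𝓕⁻ (testFunction χ hχ hc)) ξ
      = ∫ ξ, g ξ * (𝓕⁻ (testFunction χ hχ hc)) ξ := by
    refine integral_congr_ae ?_
    filter_upwards [hg2.coeFn_toLp] with x hx
    rw [hx]
  rw [h3, ← h1] at h2
  simp only [Complex.real_smul]
  simpa only [testFunction_apply, mul_comm] using h2.symm

/-- Fourier inversion for continuous square integrable functions. -/
lemma fourierInv_planeFourier {f : Plane → ℝ} (hc : Continuous f) (hf : MemLp f 2)
    (hi : Integrable (planeFourier f)) (x : Plane) : 𝓕⁻ (planeFourier f) x = (f x : ℂ) := by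
  have h2 := memLp_planeFourier hf
  have h1 := fourierInv_ae_eq hi h2
  have h3 : h2.toLp (planeFourier f) = (𝓕 (toL2 f) : L2C) := by
    refine Lp.ext ?_
    filter_upwards [h2.coeFn_toLp] with x hx
    rw [hx, planeFourier_eq hf]
  rw [h3, FourierTransform.fourierInv_fourier_eq] at h1
  have h4 : (𝓕⁻ (planeFourier f) : Plane → ℂ) = fun x => (f x : ℂ) :=
    ((continuous_fourierInv hi).ae_eq_iff_eq volume (Complex.continuous_ofReal.comp hc)).1
      (h1.trans (toL2_coeFn hf))
  exact congrFun h4 x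

lemma fourierInv_conj {g : Plane → ℂ} (hg : ∀ᵐ ξ, g (-ξ) = conj (g ξ)) (x : Plane) :
    conj (𝓕⁻ g x) = 𝓕⁻ g x := by
  rw [Real.fourierInv_eq', ← integral_conj, ← integral_neg_eq_self]
  refine integral_congr_ae ?_
  filter_upwards [hg] with v hv
  simp [← Complex.exp_conj, Complex.conj_ofNat, hv]

lemma fderiv_fourierInv {g : Plane → ℂ} (hg : Integrable g)
    (hg' : Integrable fun ξ => ‖ξ‖ * ‖g ξ‖) (x : Plane) (j : Fin 2) :
    fderiv ℝ (𝓕⁻ g : Plane → ℂ) x (basisVec j) = 𝓕⁻ (fun ξ => derivSymbol j ξ * g ξ) x := by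
  have hi : Integrable fun ξ => g (-ξ) := hg.comp_neg
  have hi' : Integrable fun ξ => ‖ξ‖ * ‖g (-ξ)‖ := by simpa using hg'.comp_neg
  rw [Real.fourierInv_eq_fourier_comp_neg, Real.fourierInv_eq_fourier_comp_neg,
    Real.fderiv_fourier hi hi', Real.fourier_continuousLinearMap_apply]
  · refine congrFun (congrArg _ (funext fun ξ => ?_)) x
    rw [VectorFourier.fourierSMulRight_apply, innerSL_apply_apply, inner_basisVec]
    simp [derivSymbol]
    ring
  · refine (hi'.const_mul (2 * Real.pi * ‖innerSL ℝ (E := Plane)‖)).mono'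
      hi.aestronglyMeasurable.fourierSMulRight (.of_forall fun ξ => ?_)
    exact (VectorFourier.norm_fourierSMulRight_le _ _ _).trans_eq (by ring)

lemma contDiff_fourierInv {g : Plane → ℂ} (hg : Integrable g)
    (hg' : Integrable fun ξ => ‖ξ‖ * ‖g ξ‖) : ContDiff ℝ 1 (𝓕⁻ g : Plane → ℂ) := by
  rw [Real.fourierInv_eq_fourier_comp_neg]
  refine Real.contDiff_fourier (N := 1) fun n hn => ?_
  have hn' : n ≤ 1 := by exact_mod_cast hn
  interval_cases n
  · simpa using hg.comp_neg.norm
  · simpa using hg'.comp_neg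

/-! ### Fourier multipliers -/

lemma ofReal_fourierMultiplier {m : Plane → ℂ} {f : Plane → ℝ} (hf : MemLp f 2)
    (hm : ∀ ξ, m (-ξ) = conj (m ξ)) (x : Plane) :
    (fourierMultiplier m f x : ℂ) = 𝓕⁻ (fun ξ => m ξ * planeFourier f ξ) x := by
  have h : ∀ᵐ ξ, (fun ξ => m ξ * planeFourier f ξ) (-ξ) = conj (m ξ * planeFourier f ξ) := by
    filter_upwards [planeFourier_neg hf] with ξ hξ
    simp [hm, hξ]
  exact Complex.conj_eq_iff_re.1 (fourierInv_conj h x)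

lemma continuous_fourierMultiplier {m : Plane → ℂ} {f : Plane → ℝ}
    (hi : Integrable fun ξ => m ξ * planeFourier f ξ) : Continuous (fourierMultiplier m f) :=
  Complex.continuous_re.comp (continuous_fourierInv hi)

lemma toL2_of_ae {f : Plane → ℝ} (hf : AEStronglyMeasurable f volume) {F : L2C}
    (h : (fun x => (f x : ℂ)) =ᵐ[volume] F) : MemLp f 2 ∧ toL2 f = F := by
  have h1 : MemLp (fun x => (f x : ℂ)) 2 (volume : Measure Plane) :=
    (memLp_congr_ae h).2 (Lp.memLp F)
  have h2 : MemLp f 2 := h1.of_le hf (.of_forall fun x => by simp)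
  exact ⟨h2, Lp.ext ((toL2_coeFn h2).trans h)⟩

lemma fourierMultiplier_L2 {m : Plane → ℂ} {f : Plane → ℝ} (hf : MemLp f 2)
    (hm : ∀ ξ, m (-ξ) = conj (m ξ)) (hi : Integrable fun ξ => m ξ * planeFourier f ξ)
    (h2 : MemLp (fun ξ => m ξ * planeFourier f ξ) 2) :
    MemLp (fourierMultiplier m f) 2 ∧
      planeFourier (fourierMultiplier m f) =ᵐ[volume] fun ξ => m ξ * planeFourier f ξ := by
  have h := toL2_of_ae (continuous_fourierMultiplier hi).aestronglyMeasurable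
    (F := 𝓕⁻ (h2.toLp _))
    (by simp only [ofReal_fourierMultiplier hf hm]; exact fourierInv_ae_eq hi h2)
  refine ⟨h.1, ?_⟩
  rw [planeFourier_eq h.1, h.2, FourierTransform.fourier_fourierInv_eq]
  exact h2.coeFn_toLp

lemma pd_fourierMultiplier {m : Plane → ℂ} {f : Plane → ℝ} (hd : Differentiable ℝ f)
    (hf : MemLp f 2) (hf' : ∀ j, MemLp (pd j f) 2)
    (hi : Integrable fun ξ => m ξ * planeFourier f ξ)
    (hi' : Integrable fun ξ => ‖ξ‖ * ‖m ξ * planeFourier f ξ‖) :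
    ContDiff ℝ 1 (fourierMultiplier m f) ∧
      ∀ j, pd j (fourierMultiplier m f) = fourierMultiplier m (pd j f) := by
  have h1 := contDiff_fourierInv hi hi'
  refine ⟨Complex.reCLM.contDiff.comp h1, fun j => funext fun x => ?_⟩
  have h2 : fderiv ℝ (fourierMultiplier m f) x
      = Complex.reCLM.comp (fderiv ℝ (𝓕⁻ (fun ξ => m ξ * planeFourier f ξ) : Plane → ℂ) x) :=
    (Complex.reCLM.hasFDerivAt.comp x
      (h1.differentiable (by norm_num) x).hasFDerivAt).fderiv
  rw [pd, h2, ContinuousLinearMap.comp_apply, fderiv_fourierInv hi hi', fourierMultiplier]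
  have h3 : 𝓕⁻ (fun ξ => derivSymbol j ξ * (m ξ * planeFourier f ξ)) x
      = 𝓕⁻ (fun ξ => m ξ * planeFourier (pd j f) ξ) x := ?_
  · rw [h3]; rfl
  refine Real.fourierInv_congr_ae ?_ x
  filter_upwards [planeFourier_pd j hd hf (hf' j)] with ξ hξ
  rw [hξ]; ring

/-! ### Linear structure and inner products of `L²` classes -/

lemma toL2_add {f g : Plane → ℝ} (hf : MemLp f 2) (hg : MemLp g 2) :
    toL2 (fun x => f x + g x) = toL2 f + toL2 g := by
  refine (toL2_of_ae (hf.add hg).aestronglyMeasurable ?_).2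
  filter_upwards [Lp.coeFn_add (toL2 f) (toL2 g), toL2_coeFn hf, toL2_coeFn hg] with x h h1 h2
  rw [h]; simp [h1, h2]

lemma toL2_sub {f g : Plane → ℝ} (hf : MemLp f 2) (hg : MemLp g 2) :
    toL2 (fun x => f x - g x) = toL2 f - toL2 g := by
  refine (toL2_of_ae (hf.sub hg).aestronglyMeasurable ?_).2
  filter_upwards [Lp.coeFn_sub (toL2 f) (toL2 g), toL2_coeFn hf, toL2_coeFn hg] with x h h1 h2
  rw [h]; simp [h1, h2]

lemma toL2_neg {f : Plane → ℝ} (hf : MemLp f 2) :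
    toL2 (fun x => - f x) = - toL2 f := by
  refine (toL2_of_ae hf.neg.aestronglyMeasurable ?_).2
  filter_upwards [Lp.coeFn_neg (toL2 f), toL2_coeFn hf] with x h h1
  rw [h]; simp [h1]

lemma norm_toL2 {f : Plane → ℝ} (hf : MemLp f 2) : ‖toL2 f‖ = (eLpNorm f 2).toReal := by
  rw [Lp.norm_def, eLpNorm_congr_ae (toL2_coeFn hf)]
  congr 1
  exact eLpNorm_congr_norm_ae (.of_forall fun x => by simp)

lemma inner_L2C (F G : L2C) : inner ℂ F G = ∫ x, conj (F x) * G x := by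
  rw [L2.inner_def]
  simp only [RCLike.inner_apply, mul_comm]

lemma norm_sq_L2C (F : L2C) : ‖F‖ ^ 2 = ∫ x, ‖F x‖ ^ 2 := by
  have h := inner_self_eq_norm_sq_to_K (𝕜 := ℂ) F
  rw [inner_L2C] at h
  have h2 : ∫ x, conj (F x) * F x = ((∫ x, ‖F x‖ ^ 2 : ℝ) : ℂ) := by
    rw [← integral_complex_ofReal]
    refine integral_congr_ae (.of_forall fun x => ?_)
    simp [Complex.conj_mul']
  rw [h2] at h
  refine Complex.ofReal_injective ?_
  rw [h]
  simp

/-- The Cauchy–Schwarz inequality. -/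
lemma integral_norm_mul_norm_le (F G : L2C) : ∫ x, ‖F x‖ * ‖G x‖ ≤ ‖F‖ * ‖G‖ := by
  have h := integral_mul_norm_le_Lp_mul_Lq (p := 2) (q := 2) (μ := (volume : Measure Plane))
    (f := F) (g := G) ⟨by norm_num, by norm_num, by norm_num⟩
    (by simpa using Lp.memLp F) (by simpa using Lp.memLp G)
  refine h.trans (le_of_eq ?_)
  norm_cast
  rw [← norm_sq_L2C, ← norm_sq_L2C, ← Real.sqrt_eq_rpow, ← Real.sqrt_eq_rpow,
    Real.sqrt_sq (norm_nonneg _), Real.sqrt_sq (norm_nonneg _)]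

lemma norm_sq_toL2 {f : Plane → ℝ} (hf : MemLp f 2) : ‖toL2 f‖ ^ 2 = ∫ x, f x ^ 2 := by
  rw [norm_sq_L2C]
  refine integral_congr_ae ?_
  filter_upwards [toL2_coeFn hf] with x hx
  rw [hx]; simp

lemma inner_toL2 {f g : Plane → ℝ} (hf : MemLp f 2) (hg : MemLp g 2) :
    inner ℂ (toL2 f) (toL2 g) = ((∫ x, f x * g x : ℝ) : ℂ) := by
  rw [inner_L2C, ← integral_complex_ofReal]
  refine integral_congr_ae ?_
  filter_upwards [toL2_coeFn hf, toL2_coeFn hg] with x h1 h2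
  rw [h1, h2]; simp

lemma inner_toL2_eq_fourier {f g : Plane → ℝ} (hf : MemLp f 2) (hg : MemLp g 2) :
    ((∫ x, f x * g x : ℝ) : ℂ) = ∫ ξ, conj (planeFourier f ξ) * planeFourier g ξ := by
  rw [← inner_toL2 hf hg, ← Lp.inner_fourier_eq, inner_L2C, planeFourier_eq hf, planeFourier_eq hg]

lemma planeFourier_add {f g : Plane → ℝ} (hf : MemLp f 2) (hg : MemLp g 2) :
    planeFourier (fun x => f x + g x) =ᵐ[volume] fun ξ => planeFourier f ξ + planeFourier g ξ := by
  have h : MemLp (fun x => f x + g x) 2 := hf.add hg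
  rw [planeFourier_eq h, planeFourier_eq hf, planeFourier_eq hg, toL2_add hf hg,
    FourierTransform.fourier_add]
  exact Lp.coeFn_add _ _

lemma planeFourier_sub {f g : Plane → ℝ} (hf : MemLp f 2) (hg : MemLp g 2) :
    planeFourier (fun x => f x - g x) =ᵐ[volume] fun ξ => planeFourier f ξ - planeFourier g ξ := by
  have h : MemLp (fun x => f x - g x) 2 := hf.sub hg
  have e : (𝓕 (toL2 f - toL2 g) : L2C) = 𝓕 (toL2 f) - 𝓕 (toL2 g) :=
    (Lp.fourierTransformₗᵢ Plane ℂ).map_sub _ _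
  rw [planeFourier_eq h, planeFourier_eq hf, planeFourier_eq hg, toL2_sub hf hg, e]
  exact Lp.coeFn_sub _ _

/-! ### Functions in all Sobolev spaces -/

/-- Smooth real functions with all derivatives square integrable. -/
structure IsSob (f : Plane → ℝ) : Prop where
  contDiff : ContDiff ℝ ∞ f
  memLp_iteratedFDeriv : ∀ k : ℕ, MemLp (iteratedFDeriv ℝ k f) 2

lemma norm_basisVec (j : Fin 2) : ‖basisVec j‖ = 1 := by simp [basisVec]

lemma contDiff_pd {f : Plane → ℝ} (hf : ContDiff ℝ ∞ f) (j : Fin 2) : ContDiff ℝ ∞ (pd j f) :=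
  (hf.fderiv_right (m := ∞) (by simp)).clm_apply contDiff_const

lemma norm_iteratedFDeriv_pd_le {f : Plane → ℝ} (hf : ContDiff ℝ ∞ f) (j : Fin 2) (k : ℕ)
    (x : Plane) : ‖iteratedFDeriv ℝ k (pd j f) x‖ ≤ ‖iteratedFDeriv ℝ (k + 1) f x‖ := by
  have h := norm_iteratedFDeriv_clm_apply_const (f := fderiv ℝ f) (c := basisVec j) (x := x)
    (n := k) (N := ∞) (hf.fderiv_right (m := ∞) (by simp)).contDiffAt (by exact_mod_cast le_top)
  rw [norm_basisVec, one_mul, norm_iteratedFDeriv_fderiv] at h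
  exact h

namespace IsSob

variable {f g : Plane → ℝ}

lemma continuous (hf : IsSob f) : Continuous f := hf.contDiff.continuous

lemma differentiable (hf : IsSob f) : Differentiable ℝ f := hf.contDiff.differentiable (by simp)

lemma memLp (hf : IsSob f) : MemLp f 2 :=
  (hf.memLp_iteratedFDeriv 0).of_le hf.continuous.aestronglyMeasurable
    (.of_forall fun x => by simp)

lemma pd (hf : IsSob f) (j : Fin 2) : IsSob (pd j f) where
  contDiff := contDiff_pd hf.contDiff j
  memLp_iteratedFDeriv k := (hf.memLp_iteratedFDeriv (k + 1)).of_le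
    ((contDiff_pd hf.contDiff j).continuous_iteratedFDeriv
      (by exact_mod_cast le_top)).aestronglyMeasurable
    (.of_forall fun x => norm_iteratedFDeriv_pd_le hf.contDiff j k x)

lemma sub (hf : IsSob f) (hg : IsSob g) : IsSob (fun x => f x - g x) where
  contDiff := hf.contDiff.sub hg.contDiff
  memLp_iteratedFDeriv k := by
    have h : iteratedFDeriv ℝ k (fun x => f x - g x)
        = fun x => iteratedFDeriv ℝ k f x - iteratedFDeriv ℝ k g x := by
      funext x
      exact fun_iteratedFDeriv_sub_apply (hf.contDiff.contDiffAt.of_le (by exact_mod_cast le_top))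
        (hg.contDiff.contDiffAt.of_le (by exact_mod_cast le_top))
    rw [h]
    exact (hf.memLp_iteratedFDeriv k).sub (hg.memLp_iteratedFDeriv k)

end IsSob

/-- The symbol `1 + |2πξ|²` of `1 - Δ`. -/
def bracket (ξ : Plane) : ℝ := 1 + (2 * Real.pi * ‖ξ‖) ^ 2

lemma one_le_bracket (ξ : Plane) : 1 ≤ bracket ξ := by
  unfold bracket; nlinarith [sq_nonneg (2 * Real.pi * ‖ξ‖)]

lemma bracket_pos (ξ : Plane) : 0 < bracket ξ := one_pos.trans_le (one_le_bracket ξ)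

lemma continuous_bracket : Continuous bracket := by unfold bracket; fun_prop

lemma norm_le_bracket (ξ : Plane) : 2 * Real.pi * ‖ξ‖ ≤ bracket ξ := by
  unfold bracket; nlinarith [sq_nonneg (2 * Real.pi * ‖ξ‖ - 1)]

/-- The operator `1 - Δ`. -/
def besselOp (f : Plane → ℝ) (x : Plane) : ℝ := f x - pd 0 (pd 0 f) x - pd 1 (pd 1 f) x

lemma IsSob.besselOp {f : Plane → ℝ} (hf : IsSob f) : IsSob (besselOp f) :=
  (hf.sub ((hf.pd 0).pd 0)).sub ((hf.pd 1).pd 1)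

lemma IsSob.planeFourier_pd {f : Plane → ℝ} (hf : IsSob f) (j : Fin 2) :
    planeFourier (Boussinesq.pd j f) =ᵐ[volume] fun ξ => derivSymbol j ξ * planeFourier f ξ :=
  Boussinesq.planeFourier_pd j hf.differentiable hf.memLp (hf.pd j).memLp

lemma sq_norm_eq (ξ : Plane) : ‖ξ‖ ^ 2 = ξ 0 ^ 2 + ξ 1 ^ 2 := by
  simp [EuclideanSpace.norm_sq_eq, Fin.sum_univ_two]

lemma IsSob.planeFourier_besselOp {f : Plane → ℝ} (hf : IsSob f) :
    planeFourier (Boussinesq.besselOp f) =ᵐ[volume] fun ξ => bracket ξ * planeFourier f ξ := by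
  have h1 := planeFourier_sub (hf.sub ((hf.pd 0).pd 0)).memLp ((hf.pd 1).pd 1).memLp
  filter_upwards [h1, planeFourier_sub hf.memLp ((hf.pd 0).pd 0).memLp, (hf.pd 0).planeFourier_pd 0,
    (hf.pd 1).planeFourier_pd 1, hf.planeFourier_pd 0, hf.planeFourier_pd 1] with ξ e1 e2 e3 e4 e5 e6
  refine e1.trans ?_
  rw [e2, e3, e4, e5, e6, derivSymbol, derivSymbol, bracket]
  have h := congrArg (fun r : ℝ => (r : ℂ)) (sq_norm_eq ξ)
  push_cast at h ⊢
  rw [mul_pow, h]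
  linear_combination (-4 * (Real.pi : ℂ) ^ 2 * ((ξ 0 : ℂ) ^ 2 + (ξ 1 : ℂ) ^ 2) * planeFourier f ξ)
    * Complex.I_sq

/-- Each factor `bracket` is one application of `1 - Δ`, which preserves `IsSob`; so every
polynomial weight on the Fourier side is available. -/
lemma IsSob.memLp_bracket_pow {f : Plane → ℝ} (n : ℕ) :
    IsSob f → MemLp (fun ξ => ((bracket ξ ^ n : ℝ) : ℂ) * planeFourier f ξ) 2 := by
  induction n generalizing f with
  | zero => intro hf; simpa using memLp_planeFourier hf.memLp
  | succ n ih =>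
    intro hf
    refine (memLp_congr_ae ?_).1 (ih hf.besselOp)
    filter_upwards [hf.planeFourier_besselOp] with ξ hξ
    rw [hξ]; push_cast; ring

lemma IsSob.memLp_mul {f : Plane → ℝ} (hf : IsSob f) {m : Plane → ℂ}
    (hm : AEStronglyMeasurable m volume) {C : ℝ} {n : ℕ} (h : ∀ ξ, ‖m ξ‖ ≤ C * bracket ξ ^ n) :
    MemLp (fun ξ => m ξ * planeFourier f ξ) 2 := by
  refine ((hf.memLp_bracket_pow n).const_mul (C : ℂ)).of_le
    (hm.mul (memLp_planeFourier hf.memLp).aestronglyMeasurable) (.of_forall fun ξ => ?_)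
  have hC : 0 ≤ C := by
    have := (norm_nonneg _).trans (h 0)
    exact nonneg_of_mul_nonneg_left this (pow_pos (bracket_pos 0) n)
  rw [norm_mul, norm_mul, norm_mul, Complex.norm_real, Complex.norm_real, Real.norm_eq_abs,
    Real.norm_eq_abs, abs_of_nonneg hC, abs_of_pos (pow_pos (bracket_pos ξ) n), ← mul_assoc]
  gcongr
  exact h ξ

/-- Cauchy–Schwarz with the weight `bracket ^ n` split off. The symbol need not be bounded, so a
singularity at the origin, as for `R_{2α}`, is allowed. -/
lemma IsSob.integrable_mul_of_memLp {f : Plane → ℝ} (hf : IsSob f) {m : Plane → ℂ} (n : ℕ)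
    (h : MemLp (fun ξ => m ξ * ((bracket ξ ^ n : ℝ) : ℂ)⁻¹) 2) :
    Integrable fun ξ => m ξ * planeFourier f ξ := by
  refine (h.integrable_mul (hf.memLp_bracket_pow n)).congr (.of_forall fun ξ => ?_)
  have : ((bracket ξ ^ n : ℝ) : ℂ) ≠ 0 := by exact_mod_cast (pow_pos (bracket_pos ξ) n).ne'
  simp only [Pi.mul_apply]
  field_simp

/-- The square decays like `|ξ|⁻⁴`, which is integrable at infinity in dimension two. This is the
source of the embedding of `H²` into bounded functions. -/
lemma memLp_inv_bracket : MemLp (fun ξ => ((bracket ξ : ℝ) : ℂ)⁻¹) 2 (volume : Measure Plane) := by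
  have hc : Continuous fun ξ => ((bracket ξ : ℝ) : ℂ)⁻¹ :=
    (Complex.continuous_ofReal.comp continuous_bracket).inv₀
      fun ξ => by simpa using (bracket_pos ξ).ne'
  rw [memLp_two_iff_integrable_sq_norm hc.aestronglyMeasurable]
  have h := integrable_rpow_neg_one_add_norm_sq (E := Plane) (μ := volume) (r := 4)
    (by simp; norm_num)
  refine h.mono' (hc.norm.pow 2).aestronglyMeasurable (.of_forall fun ξ => ?_)
  have h1 : 1 + ‖ξ‖ ^ 2 ≤ bracket ξ := by
    unfold bracket
    have : 1 ≤ 2 * Real.pi := by linarith [Real.pi_gt_three]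
    rw [mul_pow]
    nlinarith [sq_nonneg ‖ξ‖, mul_nonneg (sq_nonneg ‖ξ‖) (by nlinarith : 0 ≤ (2 * Real.pi) ^ 2 - 1)]
  have h2 : 0 < 1 + ‖ξ‖ ^ 2 := by positivity
  rw [show (-4 / 2 : ℝ) = ((-2 : ℤ) : ℝ) by norm_num, Real.rpow_intCast, zpow_neg]
  rw [norm_inv, Complex.norm_real, Real.norm_of_nonneg (bracket_pos ξ).le, inv_pow,
    Real.norm_of_nonneg (by positivity)]
  norm_cast
  gcongr

lemma IsSob.integrable_mul {f : Plane → ℝ} (hf : IsSob f) {m : Plane → ℂ}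
    (hm : AEStronglyMeasurable m volume) {C : ℝ} {n : ℕ} (h : ∀ ξ, ‖m ξ‖ ≤ C * bracket ξ ^ n) :
    Integrable fun ξ => m ξ * planeFourier f ξ := by
  refine hf.integrable_mul_of_memLp (n + 1) ?_
  refine (memLp_inv_bracket.const_mul (C : ℂ)).of_le ?_ (.of_forall fun ξ => ?_)
  · refine hm.mul (Continuous.aestronglyMeasurable ?_)
    refine (Complex.continuous_ofReal.comp (continuous_bracket.pow _)).inv₀ fun ξ => ?_
    simpa using (bracket_pos ξ).ne'
  · have hC : 0 ≤ C := by
      have := (norm_nonneg _).trans (h 0)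
      exact nonneg_of_mul_nonneg_left this (pow_pos (bracket_pos 0) n)
    have hb := bracket_pos ξ
    rw [norm_mul, norm_mul, norm_inv, norm_inv, Complex.norm_real, Complex.norm_real,
      Complex.norm_real, Real.norm_eq_abs, Real.norm_eq_abs, Real.norm_eq_abs, abs_of_nonneg hC,
      abs_of_pos hb, abs_of_pos (pow_pos hb _)]
    calc ‖m ξ‖ * (bracket ξ ^ (n + 1))⁻¹ ≤ (C * bracket ξ ^ n) * (bracket ξ ^ (n + 1))⁻¹ := by
          gcongr; exact h ξ
      _ = C * (bracket ξ)⁻¹ := by rw [pow_succ]; field_simp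

lemma IsSob.integrable_planeFourier {f : Plane → ℝ} (hf : IsSob f) :
    Integrable (planeFourier f) := by
  simpa using hf.integrable_mul (m := fun _ => 1) (C := 1) (n := 0)
    aestronglyMeasurable_const (by simp)

/-- The Sobolev embedding of `H²` into bounded functions. -/
lemma exists_sobolev_embedding : ∃ C : ℝ, 0 ≤ C ∧ ∀ f : Plane → ℝ, IsSob f → ∀ x,
    |f x| ≤ C * ‖toL2 (besselOp f)‖ := by
  refine ⟨‖memLp_inv_bracket.toLp‖, norm_nonneg _, fun f hf x => ?_⟩
  have h1 : |f x| ≤ ∫ ξ, ‖planeFourier f ξ‖ := by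
    have h := norm_fourierInv_le (planeFourier f) x
    rw [fourierInv_planeFourier hf.continuous hf.memLp hf.integrable_planeFourier] at h
    simpa using h
  refine h1.trans ?_
  have h2 : ∫ ξ, ‖planeFourier f ξ‖
      = ∫ ξ, ‖((bracket ξ : ℝ) : ℂ)⁻¹‖ * ‖(𝓕 (toL2 (besselOp f)) : L2C) ξ‖ := by
    refine integral_congr_ae ?_
    filter_upwards [hf.planeFourier_besselOp] with ξ hξ
    rw [← planeFourier_eq hf.besselOp.memLp, hξ, ← norm_mul, inv_mul_cancel_left₀]
    exact_mod_cast (bracket_pos ξ).ne'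
  rw [h2]
  have h3 := integral_norm_mul_norm_le memLp_inv_bracket.toLp (𝓕 (toL2 (besselOp f)))
  rw [Lp.norm_fourier_eq] at h3
  refine le_trans (le_of_eq (integral_congr_ae ?_)) h3
  filter_upwards [memLp_inv_bracket.coeFn_toLp] with ξ hξ
  rw [hξ]

/-! ### Lipschitz curves in a Hilbert space with a weak derivative -/

section WeakDerivative

variable {H : Type*} [NormedAddCommGroup H] [InnerProductSpace ℂ H]

/-- The curve `g` is `C`-Lipschitz on `[0, τ]` and has the weak derivative `N` in `(0, τ)`, which is
bounded by `C`. -/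
structure HasWeakDeriv (g N : ℝ → H) (τ C : ℝ) : Prop where
  bound : ∀ t ∈ Ioo 0 τ, ‖N t‖ ≤ C
  lipschitz : ∀ s ∈ Icc 0 τ, ∀ t ∈ Icc 0 τ, ‖g t - g s‖ ≤ C * |t - s|
  hasDerivAt : ∀ ψ : H, ∀ t ∈ Ioo 0 τ,
    HasDerivAt (fun s => (inner ℂ ψ (g s) : ℂ)) (inner ℂ ψ (N t)) t

/-- Equations are differentiated only at interior times. The mean value inequality holds on the open
square of pairs of times and extends to its closure by continuity. -/
lemma norm_sub_le_of_deriv_Ioo {f f' : ℝ → ℂ} {τ B : ℝ} (hτ : 0 < τ)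
    (hc : ContinuousOn f (Icc 0 τ)) (hd : ∀ t ∈ Ioo 0 τ, HasDerivAt f (f' t) t)
    (hB : ∀ t ∈ Ioo 0 τ, ‖f' t‖ ≤ B) {s t : ℝ} (hs : s ∈ Icc 0 τ) (ht : t ∈ Icc 0 τ) :
    ‖f t - f s‖ ≤ B * |t - s| := by
  have hcl : closure (Ioo 0 τ ×ˢ Ioo 0 τ) = Icc 0 τ ×ˢ Icc 0 τ := by
    rw [closure_prod_eq, closure_Ioo hτ.ne]
  have h1 : ContinuousOn (fun p : ℝ × ℝ => ‖f p.2 - f p.1‖) (closure (Ioo 0 τ ×ˢ Ioo 0 τ)) := by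
    rw [hcl]
    exact ((hc.comp continuousOn_snd fun p hp => hp.2).sub
      (hc.comp continuousOn_fst fun p hp => hp.1)).norm
  have h2 : ContinuousOn (fun p : ℝ × ℝ => B * |p.2 - p.1|) (closure (Ioo 0 τ ×ˢ Ioo 0 τ)) := by
    fun_prop
  refine le_on_closure (x := (s, t)) (f := fun p : ℝ × ℝ => ‖f p.2 - f p.1‖)
    (g := fun p : ℝ × ℝ => B * |p.2 - p.1|) ?_ h1 h2 (by rw [hcl]; exact ⟨hs, ht⟩)
  rintro ⟨a, b⟩ ⟨ha, hb⟩
  simpa using (convex_Ioo (0 : ℝ) τ).norm_image_sub_le_of_norm_hasDerivWithin_le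
    (fun x hx => (hd x hx).hasDerivWithinAt) hB ha hb

/-- Scalar mean value bounds hold for test vectors in the span of `D` and pass to all vectors by
density, which gives the Lipschitz bound. That bound in turn makes the difference quotients uniform
in the test vector, so the weak derivative extends from `D` to the whole space. -/
lemma HasWeakDeriv.of_dense {g N : ℝ → H} {τ C : ℝ} (hτ : 0 < τ) (hC : 0 ≤ C) {D : Set H}
    (hD : (Submodule.span ℂ D).topologicalClosure = ⊤)
    (hc : ∀ ψ ∈ D, ContinuousOn (fun s => (inner ℂ ψ (g s) : ℂ)) (Icc 0 τ))
    (hN : ∀ t ∈ Ioo 0 τ, ‖N t‖ ≤ C)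
    (hd : ∀ ψ ∈ D, ∀ t ∈ Ioo 0 τ,
      HasDerivAt (fun s => (inner ℂ ψ (g s) : ℂ)) (inner ℂ ψ (N t)) t) :
    HasWeakDeriv g N τ C := by
  have hspan : ∀ ψ ∈ Submodule.span ℂ D,
      ContinuousOn (fun s => (inner ℂ ψ (g s) : ℂ)) (Icc 0 τ) ∧ ∀ t ∈ Ioo 0 τ,
        HasDerivAt (fun s => (inner ℂ ψ (g s) : ℂ)) (inner ℂ ψ (N t)) t := by
    intro ψ hψ
    induction hψ using Submodule.span_induction with
    | mem ψ h => exact ⟨hc ψ h, hd ψ h⟩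
    | zero => simpa using ⟨continuousOn_const, fun t _ _ => hasDerivAt_const t (0 : ℂ)⟩
    | add x y _ _ hx hy =>
      simp only [inner_add_left]
      exact ⟨hx.1.add hy.1, fun t ht => (hx.2 t ht).add (hy.2 t ht)⟩
    | smul c x _ hx =>
      simp only [inner_smul_left]
      exact ⟨continuousOn_const.mul hx.1, fun t ht => (hx.2 t ht).const_mul _⟩
  have hdense : ∀ ψ : H, ψ ∈ closure (Submodule.span ℂ D : Set H) := fun ψ => by
    rw [← Submodule.topologicalClosure_coe, hD]; trivial
  have hlip : ∀ s ∈ Icc 0 τ, ∀ t ∈ Icc 0 τ, ‖g t - g s‖ ≤ C * |t - s| := by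
    intro s hs t ht
    have key : ∀ ψ : H, ‖(inner ℂ ψ (g t - g s) : ℂ)‖ ≤ (‖ψ‖ * C) * |t - s| := by
      intro ψ
      refine le_on_closure (f := fun ψ : H => ‖(inner ℂ ψ (g t - g s) : ℂ)‖)
        (g := fun ψ : H => (‖ψ‖ * C) * |t - s|) (fun ψ hψ => ?_) (by fun_prop) (by fun_prop)
        (hdense ψ)
      simp only [inner_sub_right]
      exact norm_sub_le_of_deriv_Ioo hτ (hspan ψ hψ).1 (hspan ψ hψ).2
        (fun r hr => (norm_inner_le_norm _ _).trans (by gcongr; exact hN r hr)) hs ht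
    have h := key (g t - g s)
    rw [inner_self_eq_norm_sq_to_K] at h
    rcases (norm_nonneg (g t - g s)).eq_or_lt with h0 | h0
    · rw [← h0]; positivity
    · simp only [norm_pow, RCLike.norm_ofReal, abs_norm] at h
      rw [sq, mul_assoc] at h
      exact le_of_mul_le_mul_left h h0
  refine ⟨hN, hlip, fun ψ t ht => ?_⟩
  rw [hasDerivAt_iff_isLittleO, Asymptotics.isLittleO_iff]
  intro c hcpos
  -- The remainder `v` satisfies `‖v‖ ≤ 2C|s-t|`, so this closeness of `ψ'` to `ψ` costs at most
  -- `c/2 · |s-t|`. The `+ 1` covers `C = 0`.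
  obtain ⟨ψ', hψ', hdist⟩ := Metric.mem_closure_iff.1 (hdense ψ) (c / 2 / (2 * C + 1))
    (by positivity)
  have h1 := (hasDerivAt_iff_isLittleO.1 ((hspan ψ' hψ').2 t ht))
  have h2 := Asymptotics.isLittleO_iff.1 h1 (half_pos hcpos)
  filter_upwards [h2, Ioo_mem_nhds ht.1 ht.2] with s hs hsI
  have e : ∀ φ : H, (inner ℂ φ (g s) : ℂ) - inner ℂ φ (g t) - (s - t) • (inner ℂ φ (N t) : ℂ)
      = inner ℂ φ (g s - g t - ((s - t : ℝ) : ℂ) • N t) := by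
    intro φ
    rw [inner_sub_right, inner_sub_right, inner_smul_right, Complex.real_smul, Complex.ofReal_sub]
  rw [e] at hs ⊢
  set v := g s - g t - ((s - t : ℝ) : ℂ) • N t
  have hv : ‖v‖ ≤ (2 * C) * |s - t| := by
    calc ‖v‖ ≤ ‖g s - g t‖ + ‖((s - t : ℝ) : ℂ) • N t‖ := norm_sub_le _ _
      _ ≤ C * |s - t| + |s - t| * C := by
        rw [norm_smul, Complex.norm_real, Real.norm_eq_abs]
        gcongr
        · exact hlip t (Ioo_subset_Icc_self ht) s (Ioo_subset_Icc_self hsI)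
        · exact hN t ht
      _ = _ := by ring
  have h3 : ‖(inner ℂ (ψ - ψ') v : ℂ)‖ ≤ c / 2 * |s - t| := by
    calc ‖(inner ℂ (ψ - ψ') v : ℂ)‖ ≤ ‖ψ - ψ'‖ * ‖v‖ := norm_inner_le_norm _ _
      _ ≤ (c / 2 / (2 * C + 1)) * ((2 * C) * |s - t|) := by
        gcongr
        rw [← dist_eq_norm]; exact hdist.le
      _ = c / 2 * |s - t| * ((2 * C) / (2 * C + 1)) := by ring
      _ ≤ c / 2 * |s - t| * 1 := by
        gcongr
        rw [div_le_one (by positivity)]; linarith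
      _ = _ := by ring
  calc ‖(inner ℂ ψ v : ℂ)‖ = ‖(inner ℂ ψ' v : ℂ) + inner ℂ (ψ - ψ') v‖ := by
        rw [← inner_add_left]; simp
    _ ≤ c / 2 * ‖s - t‖ + c / 2 * |s - t| := (norm_add_le _ _).trans (add_le_add hs h3)
    _ = c * ‖s - t‖ := by rw [Real.norm_eq_abs]; ring

namespace HasWeakDeriv

variable {g N g₂ N₂ : ℝ → H} {τ C C₂ : ℝ}

lemma continuousOn (h : HasWeakDeriv g N τ C) : ContinuousOn g (Icc 0 τ) := by
  have : LipschitzOnWith (Real.toNNReal C) g (Icc 0 τ) := by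
    refine LipschitzOnWith.of_dist_le_mul fun s hs t ht => ?_
    rw [dist_eq_norm, Real.dist_eq]
    refine (h.lipschitz t ht s hs).trans ?_
    gcongr
    exact Real.le_coe_toNNReal C
  exact this.continuousOn

lemma sub (h : HasWeakDeriv g N τ C) (h₂ : HasWeakDeriv g₂ N₂ τ C₂) :
    HasWeakDeriv (fun t => g t - g₂ t) (fun t => N t - N₂ t) τ (C + C₂) where
  bound t ht := (norm_sub_le _ _).trans (add_le_add (h.bound t ht) (h₂.bound t ht))
  lipschitz s hs t ht := by
    rw [sub_sub_sub_comm, add_mul]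
    exact (norm_sub_le _ _).trans (add_le_add (h.lipschitz s hs t ht) (h₂.lipschitz s hs t ht))
  hasDerivAt ψ t ht := by
    simp only [inner_sub_right]
    exact (h.hasDerivAt ψ t ht).sub (h₂.hasDerivAt ψ t ht)

lemma map [CompleteSpace H] (h : HasWeakDeriv g N τ C) (K : H →L[ℂ] H) :
    HasWeakDeriv (fun t => K (g t)) (fun t => K (N t)) τ (‖K‖ * C) where
  bound t ht := (K.le_opNorm _).trans (by gcongr; exact h.bound t ht)
  lipschitz s hs t ht := by
    rw [← map_sub, mul_assoc]
    exact (K.le_opNorm _).trans (by gcongr; exact h.lipschitz s hs t ht)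
  hasDerivAt ψ t ht := by
    simp only [← ContinuousLinearMap.adjoint_inner_left]
    exact h.hasDerivAt _ t ht

/-- A quadratic remainder is `O(|s-t|²)` by the Lipschitz bound, so a functional with first-order
part `2 Re⟨ψ, ·⟩` is differentiable although `g` has only a weak derivative. It serves both `‖g‖²`
and the truncated energy in the maximum principle. -/
lemma hasDerivAt_of_quadratic (h : HasWeakDeriv g N τ C) {t : ℝ} (ht : t ∈ Ioo 0 τ)
    {q : ℝ → ℝ} (ψ : H)
    (hq : ∀ s ∈ Ioo 0 τ, |q s - q t - 2 * (inner ℂ ψ (g s - g t) : ℂ).re| ≤ ‖g s - g t‖ ^ 2) :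
    HasDerivAt q (2 * (inner ℂ ψ (N t) : ℂ).re) t := by
  have h1 : HasDerivAt (fun s => 2 * (inner ℂ ψ (g s) : ℂ).re) (2 * (inner ℂ ψ (N t) : ℂ).re) t :=
    (Complex.reCLM.hasFDerivAt.comp_hasDerivAt t (h.hasDerivAt ψ t ht)).const_mul 2
  have h2 : HasDerivAt (fun s => q s - 2 * (inner ℂ ψ (g s) : ℂ).re) 0 t := by
    rw [hasDerivAt_iff_isLittleO]
    have : (fun s => (s - t) ^ 2) =o[𝓝 t] fun s => s - t := by
      have := (Asymptotics.isLittleO_pow_id (𝕜 := ℝ) (n := 2) (by norm_num)).comp_tendsto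
        (tendsto_sub_nhds_zero_iff.2 (Filter.tendsto_id (α := ℝ) (x := 𝓝 t)))
      exact this
    refine (Asymptotics.IsBigO.of_bound (C ^ 2) ?_).trans_isLittleO this
    filter_upwards [Ioo_mem_nhds ht.1 ht.2] with s hs
    have e : q s - 2 * (inner ℂ ψ (g s) : ℂ).re - (q t - 2 * (inner ℂ ψ (g t) : ℂ).re)
        - (s - t) • (0 : ℝ) = q s - q t - 2 * (inner ℂ ψ (g s - g t) : ℂ).re := by
      rw [inner_sub_right, Complex.sub_re]; simp; ring
    rw [e, Real.norm_eq_abs, Real.norm_eq_abs, abs_pow, ← mul_pow]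
    refine (hq s hs).trans ?_
    gcongr
    exact h.lipschitz t (Ioo_subset_Icc_self ht) s (Ioo_subset_Icc_self hs)
  have h3 := h2.add h1
  rw [zero_add] at h3
  exact h3.congr_of_eventuallyEq (.of_forall fun s => by simp)

lemma hasDerivAt_norm_sq (h : HasWeakDeriv g N τ C) {t : ℝ} (ht : t ∈ Ioo 0 τ) :
    HasDerivAt (fun s => ‖g s‖ ^ 2) (2 * (inner ℂ (g t) (N t) : ℂ).re) t := by
  refine h.hasDerivAt_of_quadratic ht (g t) fun s _ => le_of_eq ?_
  have e := norm_add_sq (𝕜 := ℂ) (g t) (g s - g t)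
  rw [add_sub_cancel] at e
  have e' : ‖g s‖ ^ 2 - ‖g t‖ ^ 2 - 2 * (inner ℂ (g t) (g s - g t) : ℂ).re = ‖g s - g t‖ ^ 2 := by
    rw [e, RCLike.re_eq_complex_re]; ring
  rw [e', abs_of_nonneg (sq_nonneg _)]

end HasWeakDeriv

end WeakDerivative

/-! ### Weak derivatives tested against smooth compactly supported functions -/

lemma memLp_test {χ : Plane → ℝ} (hχ : ContDiff ℝ ∞ χ) (hc : HasCompactSupport χ) :
    MemLp χ 2 (volume : Measure Plane) :=
  hχ.continuous.memLp_of_hasCompactSupport hc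

/-- The classes of real smooth compactly supported functions. -/
def testClasses : Set L2C :=
  {F | ∃ χ : Plane → ℝ, ContDiff ℝ ∞ χ ∧ HasCompactSupport χ ∧ F = toL2 χ}

/-- Real test functions suffice because the span is complex: a vector orthogonal to all of them has
vanishing integral against every test function. -/
lemma span_testClasses : (Submodule.span ℂ testClasses).topologicalClosure = ⊤ := by
  rw [Submodule.topologicalClosure_eq_top_iff, Submodule.eq_bot_iff]
  intro F hF
  rw [Submodule.mem_orthogonal] at hF
  refine (Lp.eq_zero_iff_ae_eq_zero).2 ?_
  refine ae_eq_zero_of_integral_contDiff_smul_eq_zero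
    ((Lp.memLp F).locallyIntegrable (by norm_num)) fun χ hχ hc => ?_
  have h := hF (toL2 χ) (Submodule.subset_span ⟨χ, hχ, hc, rfl⟩)
  rw [inner_L2C] at h
  rw [← h]
  refine integral_congr_ae ?_
  filter_upwards [toL2_coeFn (memLp_test hχ hc)] with x hx
  rw [hx]; simp

/-- The bridge from equations tested against compactly supported functions to curves in `L²`. The
only quantitative input is a uniform `L²` bound on the candidate derivative. -/
lemma hasWeakDeriv_toL2 {f n : ℝ → Plane → ℝ} {τ C : ℝ} (hτ : 0 < τ) (hC : 0 ≤ C)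
    (hf : ∀ t ∈ Icc 0 τ, MemLp (f t) 2) (hn : ∀ t ∈ Ioo 0 τ, MemLp (n t) 2)
    (hb : ∀ t ∈ Ioo 0 τ, ‖toL2 (n t)‖ ≤ C)
    (hc : ∀ χ : Plane → ℝ, ContDiff ℝ ∞ χ → HasCompactSupport χ →
      ContinuousOn (fun t => ∫ x, χ x * f t x) (Icc 0 τ))
    (hd : ∀ χ : Plane → ℝ, ContDiff ℝ ∞ χ → HasCompactSupport χ → ∀ t ∈ Ioo 0 τ,
      HasDerivAt (fun t => ∫ x, χ x * f t x) (∫ x, χ x * n t x) t) :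
    HasWeakDeriv (fun t => toL2 (f t)) (fun t => toL2 (n t)) τ C := by
  refine HasWeakDeriv.of_dense hτ hC span_testClasses ?_ hb ?_
  · rintro _ ⟨χ, hχ, hs, rfl⟩
    refine (Complex.continuous_ofReal.comp_continuousOn (hc χ hχ hs)).congr fun t ht => ?_
    exact inner_toL2 (memLp_test hχ hs) (hf t ht)
  · rintro _ ⟨χ, hχ, hs, rfl⟩ t ht
    rw [inner_toL2 (memLp_test hχ hs) (hn t ht)]
    refine (hd χ hχ hs t ht).ofReal_comp.congr_of_eventuallyEq ?_
    filter_upwards [Ioo_mem_nhds ht.1 ht.2] with s hsI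
    exact inner_toL2 (memLp_test hχ hs) (hf s (Ioo_subset_Icc_self hsI))

/-! ### Differentiation in time under a compactly supported integral -/

lemma timeInterval_mem_nhds {T : EReal} {t : ℝ} (h0 : 0 < t) (ht : (t : EReal) < T) :
    timeInterval T ∈ 𝓝 t := by
  have h : {s : ℝ | (s : EReal) < T} ∈ 𝓝 t :=
    (isOpen_Iio.preimage continuous_coe_real_ereal).mem_nhds ht
  filter_upwards [h, Ioi_mem_nhds h0] with s h1 h2 using ⟨le_of_lt h2, h1⟩

lemma Icc_subset_timeInterval {T : EReal} {τ : ℝ} (hτ : τ ∈ timeInterval T) :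
    Icc 0 τ ⊆ timeInterval T := fun _ ht =>
  ⟨ht.1, (EReal.coe_le_coe_iff.2 ht.2).trans_lt hτ.2⟩

lemma continuousOn_integral_test {w : ℝ → Plane → ℝ} {T : EReal}
    (hw : ContDiffOn ℝ ∞ (fun z : ℝ × Plane => w z.1 z.2) (timeInterval T ×ˢ univ))
    {χ : Plane → ℝ} (hχ : Continuous χ) (hc : HasCompactSupport χ) :
    ContinuousOn (fun t => ∫ x, χ x * w t x) (timeInterval T) := by
  refine continuousOn_integral_of_compact_support hc ?_ fun _ x _ hx => ?_
  · exact (hχ.comp_continuousOn continuousOn_snd).mul hw.continuousOn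
  · rw [image_eq_zero_of_notMem_tsupport hx, zero_mul]

lemma hasDerivAt_integral_test {w w' : ℝ → Plane → ℝ} {T : EReal}
    (hw : ContDiffOn ℝ ∞ (fun z : ℝ × Plane => w z.1 z.2) (timeInterval T ×ˢ univ))
    (hw' : ∀ t ∈ timeInterval T, ∀ x,
      HasDerivWithinAt (fun s => w s x) (w' t x) (timeInterval T) t)
    {χ : Plane → ℝ} (hχ : Continuous χ) (hc : HasCompactSupport χ) {t : ℝ} (h0 : 0 < t)
    (hT : (t : EReal) < T) :
    HasDerivAt (fun t => ∫ x, χ x * w t x) (∫ x, χ x * w' t x) t := by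
  set W : ℝ × Plane → ℝ := fun z => w z.1 z.2
  have hnhds : ∀ s : ℝ, 0 < s → (s : EReal) < T → ∀ x : Plane,
      timeInterval T ×ˢ univ ∈ 𝓝 (s, x) := fun s h1 h2 x =>
    prod_mem_nhds (timeInterval_mem_nhds h1 h2) Filter.univ_mem
  have hpart : ∀ s : ℝ, 0 < s → (s : EReal) < T → ∀ x,
      w' s x = fderiv ℝ W (s, x) (1, 0) := by
    intro s h1 h2 x
    have hd := (hw' s ⟨h1.le, h2⟩ x).hasDerivAt (timeInterval_mem_nhds h1 h2)
    have hW : HasFDerivAt W (fderiv ℝ W (s, x)) (s, x) :=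
      ((hw.contDiffAt (hnhds s h1 h2 x)).differentiableAt (by simp)).hasFDerivAt
    have hp : HasDerivAt (fun r : ℝ => (r, x)) (1, 0) s :=
      (hasDerivAt_id s).prodMk (hasDerivAt_const s x)
    have hWp : HasDerivAt (W ∘ fun r : ℝ => (r, x)) (fderiv ℝ W (s, x) (1, 0)) s :=
      hW.comp_hasDerivAt s hp
    exact hd.unique hWp
  have hcont : ∀ s : ℝ, 0 < s → (s : EReal) < T → ∀ x, ContinuousAt (fderiv ℝ W) (s, x) :=
    fun s h1 h2 x => ((hw.contDiffAt (hnhds s h1 h2 x)).fderiv_right (m := 0)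
      (by simp)).continuousAt
  obtain ⟨ε, hε, hball⟩ := Metric.mem_nhds_iff.1
    (Filter.inter_mem (timeInterval_mem_nhds h0 hT) (Ioi_mem_nhds h0))
  have hsub : ∀ s ∈ Metric.closedBall t (ε / 2), 0 < s ∧ (s : EReal) < T := fun s hs => by
    have := hball (Metric.closedBall_subset_ball (half_lt_self hε) hs)
    exact ⟨this.2, this.1.2⟩
  have hcpt : IsCompact (Metric.closedBall t (ε / 2) ×ˢ tsupport χ) :=
    (isCompact_closedBall t (ε / 2)).prod hc
  -- Joint smoothness bounds the time derivative on a compact set of times in `(0,T)` and points in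
  -- the support of `χ`; this is the domination needed to differentiate under the integral.
  obtain ⟨B, hB⟩ := hcpt.exists_bound_of_continuousOn (f := fun z => fderiv ℝ W z (1, 0))
    fun z hz => by
      obtain ⟨h1, h2⟩ := hsub z.1 hz.1
      exact ((hcont z.1 h1 h2 z.2).clm_apply continuousAt_const).continuousWithinAt
  have hslice : ∀ s ∈ timeInterval T, Continuous (w s) := fun s hs =>
    hw.continuousOn.comp_continuous (f := fun x => (s, x)) (by fun_prop) fun x => ⟨hs, trivial⟩
  have hinteg : ∀ s ∈ timeInterval T, Integrable fun x => χ x * w s x := fun s hs =>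
    (hχ.mul (hslice s hs)).integrable_of_hasCompactSupport hc.mul_right
  refine (hasDerivAt_integral_of_dominated_loc_of_deriv_le
    (F := fun s x => χ x * w s x) (F' := fun s x => χ x * w' s x)
    (s := Metric.ball t (ε / 2)) (bound := fun x => |χ x| * B)
    (Metric.ball_mem_nhds t (half_pos hε)) ?_ (hinteg t ⟨h0.le, hT⟩) ?_ ?_ ?_ ?_).2
  · filter_upwards [timeInterval_mem_nhds h0 hT] with s hs using (hinteg s hs).aestronglyMeasurable
  · have : Continuous fun x => χ x * w' t x := by
      simp only [hpart t h0 hT]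
      refine hχ.mul (continuous_iff_continuousAt.2 fun x => ?_)
      exact ((hcont t h0 hT x).comp (f := fun x : Plane => (t, x)) (by fun_prop)).clm_apply
        continuousAt_const
    exact this.aestronglyMeasurable
  · refine .of_forall fun x s hs => ?_
    by_cases hx : x ∈ tsupport χ
    · have hs' := Metric.ball_subset_closedBall hs
      obtain ⟨h1, h2⟩ := hsub s hs'
      rw [norm_mul, hpart s h1 h2, Real.norm_eq_abs]
      gcongr
      exact hB (s, x) ⟨hs', hx⟩
    · simp [image_eq_zero_of_notMem_tsupport hx]
  · exact ((hχ.abs.integrable_of_hasCompactSupport hc.abs).mul_const B)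
  · refine .of_forall fun x s hs => ?_
    obtain ⟨h1, h2⟩ := hsub s (Metric.ball_subset_closedBall hs)
    exact ((hw' s ⟨h1.le, h2⟩ x).hasDerivAt (timeInterval_mem_nhds h1 h2)).const_mul _

/-! ### The heat kernel -/

/-- The heat kernel `(4πs)⁻¹ exp(-|y|²/(4s))`. -/
def heat (s : ℝ) (y : Plane) : ℝ := (4 * Real.pi * s)⁻¹ * Real.exp (-(4 * s)⁻¹ * ‖y‖ ^ 2)

/-- The symbol `exp(-s|2πξ|²)` of the heat kernel. -/
def heatSymbol (s : ℝ) (ξ : Plane) : ℝ := Real.exp (-s * (2 * Real.pi * ‖ξ‖) ^ 2)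

lemma planeFourier_of_integrable {g : Plane → ℝ} (hg : Integrable g) (hg2 : MemLp g 2) :
    planeFourier g =ᵐ[volume] 𝓕 (fun x => (g x : ℂ)) := by
  have hi : Integrable fun x => (g x : ℂ) := hg.ofReal
  have hcont : Continuous (𝓕 (fun x => (g x : ℂ)) : Plane → ℂ) :=
    VectorFourier.fourierIntegral_continuous Real.continuous_fourierChar continuous_inner hi
  refine planeFourier_ae_eq hg2 hcont.locallyIntegrable fun χ hχ hc => ?_
  have h := VectorFourier.integral_fourierIntegral_smul_eq_flip (L := innerₗ Plane)
    (e := Real.fourierChar) (μ := volume) (ν := volume) (f := fun x => (g x : ℂ))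
    (g := testFunction χ hχ hc)
    Real.continuous_fourierChar continuous_inner hi (testFunction χ hχ hc).integrable
  rw [flip_innerₗ] at h
  exact h.symm

lemma integrable_gaussian {b : ℝ} (hb : 0 < b) :
    Integrable fun y : Plane => Real.exp (-b * ‖y‖ ^ 2) := by
  have h := GaussianFourier.integrable_cexp_neg_mul_sq_norm_add (V := Plane) (b := (b : ℂ))
    (by simpa using hb) 0 0
  refine h.norm.congr (.of_forall fun y => ?_)
  simp only [Complex.norm_exp]
  congr 1
  simp [← Complex.ofReal_pow]

lemma memLp_of_gaussian_bound {g : Plane → ℝ} (hg : Continuous g) {b C : ℝ} (hb : 0 < b)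
    (h : ∀ y, |g y| ≤ C * Real.exp (-b * ‖y‖ ^ 2)) : Integrable g ∧ MemLp g 2 := by
  refine ⟨((integrable_gaussian hb).const_mul C).mono' hg.aestronglyMeasurable (.of_forall h), ?_⟩
  have hm : MemLp (fun y : Plane => Real.exp (-b * ‖y‖ ^ 2)) 2 := by
    rw [memLp_two_iff_integrable_sq (by fun_prop)]
    refine (integrable_gaussian (b := 2 * b) (by positivity)).congr (.of_forall fun y => ?_)
    simp only [← Real.exp_nat_mul]
    congr 1; push_cast; ring
  refine (hm.const_mul C).of_le hg.aestronglyMeasurable (.of_forall fun y => ?_)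
  exact (h y).trans (le_abs_self _)

variable {s : ℝ}

lemma heat_pos (hs : 0 < s) (y : Plane) : 0 < heat s y := by
  unfold heat; have := Real.pi_pos; positivity

lemma heat_neg (y : Plane) : heat s (-y) = heat s y := by simp [heat]

lemma contDiff_heat : ContDiff ℝ ∞ (heat s) := by
  unfold heat
  exact contDiff_const.mul ((contDiff_const.mul (contDiff_norm_sq ℝ)).exp)

lemma pd_heat (j : Fin 2) (y : Plane) : pd j (heat s) y = -(2 * s)⁻¹ * y j * heat s y := by
  have h := (((hasStrictFDerivAt_norm_sq y).hasFDerivAt.const_mul (-(4 * s)⁻¹)).exp).const_mul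
    ((4 * Real.pi * s)⁻¹)
  have h' : HasFDerivAt (heat s) _ y := h
  rw [pd, h'.fderiv, heat]
  simp [inner_basisVec]
  by_cases hs : s = 0
  · simp [hs]
  · field_simp; ring

lemma pd_pd_heat (j : Fin 2) (y : Plane) : pd j (pd 0 (heat s)) y
    = (-(2 * s)⁻¹ * (basisVec j 0) + (2 * s)⁻¹ ^ 2 * y 0 * y j) * heat s y := by
  have e : pd 0 (heat s) = (fun y : Plane => -(2 * s)⁻¹ * y 0) * heat s := funext (pd_heat 0)
  have h1 : HasFDerivAt (fun y : Plane => y 0)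
      (EuclideanSpace.proj 0 : Plane →L[ℝ] ℝ) y := 
    (EuclideanSpace.proj (𝕜 := ℝ) (0 : Fin 2) : Plane →L[ℝ] ℝ).hasFDerivAt
  have h2 := (h1.const_mul (-(2 * s)⁻¹)).mul
    (contDiff_heat.differentiable (by simp) y : DifferentiableAt ℝ (heat s) y).hasFDerivAt
  have h3 : fderiv ℝ (heat s) y (basisVec j) = -(2 * s)⁻¹ * y j * heat s y := pd_heat j y
  rw [pd, e, h2.fderiv]
  simp [h3]
  ring

/-- One polynomial dominates all the prefactors that occur: `1`, `ρ`, `1 + 2ρ²` and `ρ + 2ρ³`. The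
factor `8` clears the term `ρ⁴/8` of `1 + x + x²/2` at `x = ρ²/2`. -/
lemma exp_quadratic_bound (ρ : ℝ) :
    1 + 2 * ρ ^ 2 + ρ ^ 4 ≤ 8 * Real.exp (ρ ^ 2 / 2) := by
  have h := Real.quadratic_le_exp_of_nonneg (x := ρ ^ 2 / 2) (by positivity)
  nlinarith [sq_nonneg ρ]

/-- The polynomial prefactors of the derivatives of the heat kernel are absorbed by the Gaussian. -/
lemma heat_absorb (hs : 0 < s) (y : Plane) :
    (1 + 2 * (‖y‖ / (2 * √s)) ^ 2 + (‖y‖ / (2 * √s)) ^ 4) * heat s y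
      ≤ 8 * (4 * Real.pi * s)⁻¹ * Real.exp (-(8 * s)⁻¹ * ‖y‖ ^ 2) := by
  have h := exp_quadratic_bound (‖y‖ / (2 * √s))
  have hp : 0 < (4 * Real.pi * s)⁻¹ := by have := Real.pi_pos; positivity
  have e : (‖y‖ / (2 * √s)) ^ 2 = (4 * s)⁻¹ * ‖y‖ ^ 2 := by
    rw [div_pow, mul_pow, Real.sq_sqrt hs.le]; field_simp; norm_num
  calc (1 + 2 * (‖y‖ / (2 * √s)) ^ 2 + (‖y‖ / (2 * √s)) ^ 4) * heat s y
      ≤ (8 * Real.exp ((‖y‖ / (2 * √s)) ^ 2 / 2)) * heat s y := by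
        gcongr; exact (heat_pos hs y).le
    _ = 8 * (4 * Real.pi * s)⁻¹
        * (Real.exp ((‖y‖ / (2 * √s)) ^ 2 / 2) * Real.exp (-(4 * s)⁻¹ * ‖y‖ ^ 2)) := by
        rw [heat]; ring
    _ = _ := by
        rw [← Real.exp_add, e]
        congr 2
        field_simp; ring

lemma abs_heat_le (hs : 0 < s) (y : Plane) :
    |heat s y| ≤ (8 * (4 * Real.pi * s)⁻¹) * Real.exp (-(8 * s)⁻¹ * ‖y‖ ^ 2) := by
  refine le_trans ?_ (heat_absorb hs y)
  rw [abs_of_pos (heat_pos hs y)]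
  refine le_mul_of_one_le_left (heat_pos hs y).le ?_
  have : 0 ≤ 2 * (‖y‖ / (2 * √s)) ^ 2 + (‖y‖ / (2 * √s)) ^ 4 := by positivity
  linarith

lemma abs_pd_heat_le (hs : 0 < s) (j : Fin 2) (y : Plane) : |pd j (heat s) y|
    ≤ ((√s)⁻¹ * (8 * (4 * Real.pi * s)⁻¹)) * Real.exp (-(8 * s)⁻¹ * ‖y‖ ^ 2) := by
  have hr := Real.sqrt_pos.2 hs
  have hy : |y j| ≤ ‖y‖ := PiLp.norm_apply_le y j
  have h := heat_absorb hs y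
  set ρ := ‖y‖ / (2 * √s) with hρ
  have e : ‖y‖ = 2 * √s * ρ := by rw [hρ]; field_simp
  have e2 : (2 * s)⁻¹ * (2 * √s * ρ) = (√s)⁻¹ * ρ := by
    have := Real.mul_self_sqrt hs.le
    field_simp; rw [sq, this]
  rw [pd_heat, abs_mul, abs_mul, abs_neg, abs_of_pos (heat_pos hs y),
    abs_of_pos (by positivity : 0 < (2 * s)⁻¹), mul_assoc (√s)⁻¹]
  calc (2 * s)⁻¹ * |y j| * heat s y ≤ (2 * s)⁻¹ * ‖y‖ * heat s y := by
        have := heat_pos hs y; gcongr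
    _ = (√s)⁻¹ * (ρ * heat s y) := by
        conv_lhs => rw [e]
        rw [e2]; ring
    _ ≤ (√s)⁻¹ * ((1 + 2 * ρ ^ 2 + ρ ^ 4) * heat s y) := by
        have := heat_pos hs y
        gcongr
        nlinarith [sq_nonneg (ρ - 1), sq_nonneg ρ, sq_nonneg (ρ ^ 2)]
    _ ≤ _ := by gcongr

lemma abs_pd_pd_heat_le' (hs : 0 < s) (j : Fin 2) (y : Plane) : |pd j (pd 0 (heat s)) y|
    ≤ s⁻¹ * ((1 + 2 * (‖y‖ / (2 * √s)) ^ 2) * heat s y) / 2 := by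
  have hr := Real.sqrt_pos.2 hs
  have hy : |y j| ≤ ‖y‖ := PiLp.norm_apply_le y j
  have hy0 : |y 0| ≤ ‖y‖ := PiLp.norm_apply_le y 0
  have hb : |basisVec j 0| ≤ 1 := by
    have := PiLp.norm_apply_le (basisVec j) 0
    rwa [norm_basisVec] at this
  have hh := heat_pos hs y
  rw [pd_pd_heat, abs_mul, abs_of_pos hh]
  have h1 : |(-(2 * s)⁻¹ * (basisVec j 0) + (2 * s)⁻¹ ^ 2 * y 0 * y j)|
      ≤ (2 * s)⁻¹ + (2 * s)⁻¹ ^ 2 * ‖y‖ * ‖y‖ := by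
    refine (abs_add_le _ _).trans ?_
    rw [abs_mul, abs_mul, abs_mul, abs_neg, abs_of_pos (by positivity : 0 < (2 * s)⁻¹),
      abs_of_pos (by positivity : 0 < (2 * s)⁻¹ ^ 2)]
    gcongr
    exact mul_le_of_le_one_right (by positivity) hb
  refine (mul_le_mul_of_nonneg_right h1 hh.le).trans (le_of_eq ?_)
  rw [div_pow, mul_pow, Real.sq_sqrt hs.le]
  field_simp

lemma abs_pd_pd_heat_le (hs : 0 < s) (j : Fin 2) (y : Plane) : |pd j (pd 0 (heat s)) y|
    ≤ (s⁻¹ * (8 * (4 * Real.pi * s)⁻¹)) * Real.exp (-(8 * s)⁻¹ * ‖y‖ ^ 2) := by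
  have hh := heat_pos hs y
  refine (abs_pd_pd_heat_le' hs j y).trans ?_
  rw [mul_assoc s⁻¹, mul_div_assoc]
  gcongr
  refine le_trans ?_ (heat_absorb hs y)
  have : 0 ≤ (1 + 2 * (‖y‖ / (2 * √s)) ^ 2) * heat s y := by positivity
  have h2 : 0 ≤ (‖y‖ / (2 * √s)) ^ 4 * heat s y := by positivity
  linarith

/-- The weight `‖y‖` is of size `√s` on the scale of the kernel and improves `s⁻¹` to `s^{-1/2}`.
This gain is what makes the commutator integrable in `s` after superposition. -/
lemma norm_mul_abs_pd_pd_heat_le (hs : 0 < s) (j : Fin 2) (y : Plane) :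
    ‖y‖ * |pd j (pd 0 (heat s)) y|
      ≤ ((√s)⁻¹ * (8 * (4 * Real.pi * s)⁻¹)) * Real.exp (-(8 * s)⁻¹ * ‖y‖ ^ 2) := by
  have hr := Real.sqrt_pos.2 hs
  have hh := heat_pos hs y
  have h := heat_absorb hs y
  have h2 := abs_pd_pd_heat_le' hs j y
  set ρ := ‖y‖ / (2 * √s) with hρ
  have hρ0 : 0 ≤ ρ := by positivity
  have e : ‖y‖ = 2 * √s * ρ := by rw [hρ]; field_simp
  have e2 : √s * s⁻¹ = (√s)⁻¹ := by
    have := Real.mul_self_sqrt hs.le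
    field_simp; rw [sq, this]
  calc ‖y‖ * |pd j (pd 0 (heat s)) y|
      ≤ ‖y‖ * (s⁻¹ * ((1 + 2 * ρ ^ 2) * heat s y) / 2) := by gcongr
    _ = (√s * s⁻¹) * ((ρ + 2 * ρ ^ 3) * heat s y) := by
        conv_lhs => rw [e]
        ring
    _ ≤ (√s)⁻¹ * ((1 + 2 * ρ ^ 2 + ρ ^ 4) * heat s y) := by
        rw [e2]
        refine mul_le_mul_of_nonneg_left (mul_le_mul_of_nonneg_right ?_ hh.le) (by positivity)
        nlinarith [sq_nonneg (ρ - 1), sq_nonneg (ρ * (ρ - 1)), sq_nonneg ρ]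
    _ ≤ (√s)⁻¹ * (8 * (4 * Real.pi * s)⁻¹ * Real.exp (-(8 * s)⁻¹ * ‖y‖ ^ 2)) := by gcongr
    _ = _ := by ring

lemma integral_gaussian_eight (hs : 0 < s) :
    ∫ y : Plane, Real.exp (-(8 * s)⁻¹ * ‖y‖ ^ 2) = 8 * Real.pi * s := by
  rw [GaussianFourier.integral_rexp_neg_mul_sq_norm (by positivity)]
  simp only [finrank_euclideanSpace, Fintype.card_fin, Nat.cast_ofNat, div_self_eq_one₀.2
    (two_ne_zero (α := ℝ)), Real.rpow_one, div_inv_eq_mul]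
  ring

/-- The constant is `8 (4πs)⁻¹ · 8πs = 16`, the last factor being the mass of the Gaussian
`exp(-|y|²/(8s))`. -/
lemma lintegral_norm_mul_pd_pd_heat_le (hs : 0 < s) (j : Fin 2) :
    ∫⁻ y : Plane, ‖y‖ₑ * ‖pd j (pd 0 (heat s)) y‖ₑ ≤ ENNReal.ofReal (16 * (√s)⁻¹) := by
  calc ∫⁻ y : Plane, ‖y‖ₑ * ‖pd j (pd 0 (heat s)) y‖ₑ
      ≤ ∫⁻ y : Plane, ENNReal.ofReal (((√s)⁻¹ * (8 * (4 * Real.pi * s)⁻¹))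
          * Real.exp (-(8 * s)⁻¹ * ‖y‖ ^ 2)) := by
        refine lintegral_mono fun y => ?_
        rw [← enorm_norm y, ← enorm_mul, Real.enorm_eq_ofReal_abs, abs_mul, abs_norm]
        exact ENNReal.ofReal_le_ofReal (norm_mul_abs_pd_pd_heat_le hs j y)
    _ = ENNReal.ofReal (16 * (√s)⁻¹) := by
        rw [← ofReal_integral_eq_lintegral_ofReal
          ((integrable_gaussian (by positivity)).const_mul _)
          (.of_forall fun y => by have := Real.pi_pos; positivity),
          integral_const_mul, integral_gaussian_eight hs]
        congr 1
        have := Real.pi_pos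
        field_simp
        norm_num

lemma memLp_heat (hs : 0 < s) : Integrable (heat s) ∧ MemLp (heat s) 2 :=
  memLp_of_gaussian_bound contDiff_heat.continuous (by positivity : 0 < (8 * s)⁻¹) (abs_heat_le hs)

lemma memLp_pd_heat (hs : 0 < s) (j : Fin 2) :
    Integrable (pd j (heat s)) ∧ MemLp (pd j (heat s)) 2 :=
  memLp_of_gaussian_bound (contDiff_pd contDiff_heat j).continuous
    (by positivity : 0 < (8 * s)⁻¹) (abs_pd_heat_le hs j)

lemma memLp_pd_pd_heat (hs : 0 < s) (j : Fin 2) :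
    Integrable (pd j (pd 0 (heat s))) ∧ MemLp (pd j (pd 0 (heat s))) 2 :=
  memLp_of_gaussian_bound (contDiff_pd (contDiff_pd contDiff_heat 0) j).continuous
    (by positivity : 0 < (8 * s)⁻¹) (abs_pd_pd_heat_le hs j)

lemma fourier_heat (hs : 0 < s) (ξ : Plane) :
    𝓕 (fun y => (heat s y : ℂ)) ξ = (heatSymbol s ξ : ℂ) := by
  have hp := Real.pi_pos
  have hb : 0 < (((4 * s)⁻¹ : ℝ) : ℂ).re := by simpa using hs
  have h := fourier_gaussian_innerProductSpace (V := Plane) hb ξ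
  have e : (fun y => (heat s y : ℂ)) = fun y : Plane => ((4 * Real.pi * s : ℝ) : ℂ)⁻¹ •
      Complex.exp (-(((4 * s)⁻¹ : ℝ) : ℂ) * (‖y‖ : ℂ) ^ 2) := by
    funext y; simp [heat]
  have e2 : 𝓕 (fun y => (heat s y : ℂ)) ξ = ((4 * Real.pi * s : ℝ) : ℂ)⁻¹ •
      𝓕 (fun y : Plane => Complex.exp (-(((4 * s)⁻¹ : ℝ) : ℂ) * (‖y‖ : ℂ) ^ 2)) ξ := by
    rw [e]
    exact congrFun (VectorFourier.fourierIntegral_const_smul _ _ _ _ _) ξ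
  rw [e2, h, heatSymbol]
  have hs' : (s : ℂ) ≠ 0 := by exact_mod_cast hs.ne'
  have hp' : (Real.pi : ℂ) ≠ 0 := by exact_mod_cast hp.ne'
  have e3 : ((Module.finrank ℝ Plane : ℂ) / 2) = 1 := by simp
  rw [e3, Complex.cpow_one]
  push_cast
  rw [smul_eq_mul, ← mul_assoc]
  have e4 : (4 * (Real.pi : ℂ) * s)⁻¹ * (Real.pi / (4 * (s : ℂ))⁻¹) = 1 := by field_simp
  rw [e4, one_mul]
  congr 1
  field_simp
  ring

lemma fourier_heat_sub (hs : 0 < s) (x ξ : Plane) :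
    𝓕 (fun y => (heat s (x - y) : ℂ)) ξ
      = Complex.exp (↑(-2 * Real.pi * inner ℝ x ξ) * Complex.I) * (heatSymbol s ξ : ℂ) := by
  rw [← fourier_heat hs, Real.fourier_eq', Real.fourier_eq', ← integral_const_mul,
    ← integral_add_right_eq_self (μ := (volume : Measure Plane)) _ x]
  refine integral_congr_ae (.of_forall fun y => ?_)
  simp only [smul_eq_mul]
  rw [show x - (y + x) = -y by abel, heat_neg, inner_add_left, ← mul_assoc, ← Complex.exp_add]
  congr 2
  push_cast; ring

/-! ### The operator `∂₁ e^{sΔ}` -/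

variable {s : ℝ}

/-- The symbol of `∂₁ e^{sΔ}`. -/
def heatDerivSymbol (s : ℝ) (ξ : Plane) : ℂ := derivSymbol 0 ξ * heatSymbol s ξ

/-- The operator `∂₁ e^{sΔ}` as a convolution. -/
def heatDeriv (s : ℝ) (f : Plane → ℝ) (x : Plane) : ℝ := ∫ y, pd 0 (heat s) (x - y) * f y

lemma conj_derivSymbol (j : Fin 2) (ξ : Plane) : conj (derivSymbol j ξ) = -derivSymbol j ξ := by
  simp [derivSymbol, Complex.conj_ofNat]

lemma derivSymbol_neg (j : Fin 2) (ξ : Plane) : derivSymbol j (-ξ) = conj (derivSymbol j ξ) := by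
  rw [conj_derivSymbol]; simp [derivSymbol]

lemma heatDerivSymbol_neg (ξ : Plane) :
    heatDerivSymbol s (-ξ) = conj (heatDerivSymbol s ξ) := by
  rw [heatDerivSymbol, heatDerivSymbol, map_mul, derivSymbol_neg, Complex.conj_ofReal]
  simp [heatSymbol]

lemma continuous_heatDerivSymbol : Continuous (heatDerivSymbol s) := by
  have h : Continuous (heatSymbol s) := by unfold heatSymbol; fun_prop
  exact (continuous_derivSymbol 0).mul (Complex.continuous_ofReal.comp h)

/-- With `r = √s |2πξ|` this is `r ≤ exp(r²)`. -/
lemma norm_heatDerivSymbol_le (hs : 0 < s) (ξ : Plane) : ‖heatDerivSymbol s ξ‖ ≤ (√s)⁻¹ := by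
  have hr := Real.sqrt_pos.2 hs
  set R := 2 * Real.pi * ‖ξ‖ with hR
  have h1 : √s * R ≤ Real.exp (s * R ^ 2) := by
    have h2 := Real.add_one_le_exp (s * R ^ 2)
    have h3 : s * R ^ 2 = (√s * R) ^ 2 := by rw [mul_pow (√s), Real.sq_sqrt hs.le]
    nlinarith [sq_nonneg (√s * R - 1), sq_nonneg (√s * R)]
  rw [heatDerivSymbol, norm_mul, Complex.norm_real, heatSymbol, Real.norm_of_nonneg
    (Real.exp_pos _).le]
  refine (mul_le_mul_of_nonneg_right (norm_derivSymbol_le 0 ξ) (Real.exp_pos _).le).trans ?_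
  rw [← hR, neg_mul, Real.exp_neg, ← div_eq_mul_inv, div_le_iff₀ (Real.exp_pos _)]
  rw [← div_eq_inv_mul, le_div_iff₀ hr, mul_comm]
  exact h1

lemma planeFourier_pd_heat (hs : 0 < s) :
    planeFourier (pd 0 (heat s)) =ᵐ[volume] heatDerivSymbol s := by
  filter_upwards [planeFourier_pd 0 (contDiff_heat.differentiable (by simp)) (memLp_heat hs).2
    (memLp_pd_heat hs 0).2, planeFourier_of_integrable (memLp_heat hs).1 (memLp_heat hs).2]
    with ξ h1 h2
  rw [h1, h2, fourier_heat hs, heatDerivSymbol]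

lemma memLp_heatDerivSymbol (hs : 0 < s) : MemLp (heatDerivSymbol s) 2 :=
  (memLp_congr_ae (planeFourier_pd_heat hs)).1 (memLp_planeFourier (memLp_pd_heat hs 0).2)

lemma memLp_comp_sub {f : Plane → ℝ} (hf : MemLp f 2) (x : Plane) :
    MemLp (fun y => f (x - y)) 2 :=
  hf.comp_measurePreserving (Measure.measurePreserving_sub_left volume x)

lemma pd_comp_sub {f : Plane → ℝ} (hf : Differentiable ℝ f) (j : Fin 2) (x y : Plane) :
    pd j (fun y => f (x - y)) y = - pd j f (x - y) := by
  have h1 : HasFDerivAt (fun y : Plane => x - y) (-ContinuousLinearMap.id ℝ Plane) y :=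
    (hasFDerivAt_id y).const_sub x
  have h2 : HasFDerivAt (fun y => f (x - y)) _ y := (hf (x - y)).hasFDerivAt.comp y h1
  rw [pd, h2.fderiv]
  simp [pd]

/-- Parseval's identity applied to `f` and the reflected translate `y ↦ heat s (x - y)`, whose
transform carries the phase that reproduces the inverse Fourier integral. The convolution form is
used for the pointwise commutator, the multiplier form for the superposition in `s`. -/
lemma heatDeriv_eq (hs : 0 < s) {f : Plane → ℝ} (hf : MemLp f 2) :
    heatDeriv s f = fourierMultiplier (heatDerivSymbol s) f := by
  funext x
  apply Complex.ofReal_injective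
  rw [ofReal_fourierMultiplier hf heatDerivSymbol_neg]
  have hd : Differentiable ℝ (heat s) := contDiff_heat.differentiable (by simp)
  have e1 : pd 0 (fun y => heat s (x - y)) = fun y => - pd 0 (heat s) (x - y) :=
    funext (pd_comp_sub hd 0 x)
  have m1 : MemLp (fun y => heat s (x - y)) 2 := memLp_comp_sub (memLp_heat hs).2 x
  have i1 : Integrable (fun y => heat s (x - y)) := (memLp_heat hs).1.comp_sub_left x
  have m2 : MemLp (pd 0 (fun y => heat s (x - y))) 2 := by
    rw [e1]; exact (memLp_comp_sub (memLp_pd_heat hs 0).2 x).neg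
  have h1 := inner_toL2_eq_fourier m2 hf
  have h2 : heatDeriv s f x = - ∫ y, pd 0 (fun y => heat s (x - y)) y * f y := by
    rw [e1, ← integral_neg, heatDeriv]; simp
  rw [h2, Complex.ofReal_neg, h1, ← integral_neg, Real.fourierInv_eq']
  refine integral_congr_ae ?_
  filter_upwards [planeFourier_pd 0 (hd.comp (by fun_prop)) m1 m2,
    planeFourier_of_integrable i1 m1] with ξ h3 h4
  have h3' : planeFourier (pd 0 fun y => heat s (x - y)) ξ
      = derivSymbol 0 ξ * planeFourier (fun y => heat s (x - y)) ξ := h3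
  rw [h3', h4, fourier_heat_sub hs, heatDerivSymbol, map_mul, map_mul, conj_derivSymbol,
    ← Complex.exp_conj, Complex.conj_ofReal, smul_eq_mul, real_inner_comm]
  simp only [map_mul, Complex.conj_ofReal, Complex.conj_I]
  rw [show ((-2 * Real.pi * inner ℝ ξ x : ℝ) : ℂ) * -Complex.I
    = ((2 * Real.pi * inner ℝ ξ x : ℝ) : ℂ) * Complex.I by push_cast; ring]
  ring

lemma memLp_heatDeriv (hs : 0 < s) {f : Plane → ℝ} (hf : MemLp f 2) :
    MemLp (heatDeriv s f) 2 ∧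
      planeFourier (heatDeriv s f) =ᵐ[volume] fun ξ => heatDerivSymbol s ξ * planeFourier f ξ := by
  rw [heatDeriv_eq hs hf]
  refine fourierMultiplier_L2 hf heatDerivSymbol_neg
    ((memLp_heatDerivSymbol hs).integrable_mul (memLp_planeFourier hf)) ?_
  refine ((memLp_planeFourier hf).const_mul (((√s)⁻¹ : ℝ) : ℂ)).of_le
    (continuous_heatDerivSymbol.aestronglyMeasurable.mul
      (memLp_planeFourier hf).aestronglyMeasurable) (.of_forall fun ξ => ?_)
  rw [norm_mul, norm_mul, Complex.norm_real, Real.norm_of_nonneg (by positivity)]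
  gcongr
  exact norm_heatDerivSymbol_le hs ξ

lemma integral_mul_heatDeriv (hs : 0 < s) {f F : Plane → ℝ} (hf : MemLp f 2) (hF : MemLp F 2) :
    ((∫ x, F x * heatDeriv s f x : ℝ) : ℂ)
      = ∫ ξ, conj (planeFourier F ξ) * (heatDerivSymbol s ξ * planeFourier f ξ) := by
  rw [inner_toL2_eq_fourier hF (memLp_heatDeriv hs hf).1]
  refine integral_congr_ae ?_
  filter_upwards [(memLp_heatDeriv hs hf).2] with ξ h
  rw [h]

/-! ### Differences of functions in `H¹` -/

lemma lintegral_mul_le_eLpNorm_two {E F : Type*} [NormedAddCommGroup E] [NormedAddCommGroup F]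
    {f : Plane → E} {g : Plane → F} (hf : AEStronglyMeasurable f volume)
    (hg : AEStronglyMeasurable g volume) :
    ∫⁻ x, ‖f x‖ₑ * ‖g x‖ₑ ≤ eLpNorm f 2 volume * eLpNorm g 2 volume := by
  have h := ENNReal.lintegral_mul_le_Lp_mul_Lq (volume : Measure Plane) (p := 2) (q := 2)
    ⟨by norm_num, by norm_num, by norm_num⟩ hf.enorm hg.enorm
  simpa [eLpNorm_eq_lintegral_rpow_enorm_toReal (two_ne_zero) (ENNReal.ofNat_ne_top)] using h

lemma enorm_sub_le_lintegral {w : Plane → ℝ} (hw : ContDiff ℝ ∞ w) (x z : Plane) :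
    ‖w (x - z) - w x‖ₑ ≤ ∫⁻ r in Ioc (0 : ℝ) 1, ‖z‖ₑ * ‖fderiv ℝ w (x - r • z)‖ₑ := by
  have hd : ∀ r ∈ uIcc (0 : ℝ) 1, HasDerivAt (fun r : ℝ => w (x - r • z))
      (fderiv ℝ w (x - r • z) (-z)) r := by
    intro r _
    have h1 : HasDerivAt (fun r : ℝ => x - r • z) (-z) r := by
      simpa using ((hasDerivAt_id r).smul_const z).const_sub x
    exact ((hw.differentiable (by simp)) (x - r • z)).hasFDerivAt.comp_hasDerivAt r h1
  have hc : Continuous fun r : ℝ => fderiv ℝ w (x - r • z) (-z) :=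
    ((hw.continuous_fderiv (by simp)).comp (by fun_prop)).clm_apply continuous_const
  have h := intervalIntegral.integral_eq_sub_of_hasDerivAt hd (hc.intervalIntegrable 0 1)
  simp only [one_smul, zero_smul, sub_zero] at h
  rw [← h, intervalIntegral.integral_of_le zero_le_one]
  refine (enorm_integral_le_lintegral_enorm _).trans (lintegral_mono fun r => ?_)
  refine (ContinuousLinearMap.le_opENorm _ _).trans ?_
  rw [enorm_neg, mul_comm]

/-- The dual form of `‖w(·-z) - w‖₂ ≤ |z| ‖∇w‖₂`: the difference is an integral of `∇w` along the
segment, and each translate of `∇w` has the same `L²` norm. -/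
lemma lintegral_mul_difference_le {G w : Plane → ℝ} (hG : AEStronglyMeasurable G volume)
    (hw : ContDiff ℝ ∞ w) (z : Plane) :
    ∫⁻ x, ‖G x‖ₑ * ‖w (x - z) - w x‖ₑ
      ≤ ‖z‖ₑ * (eLpNorm G 2 volume * eLpNorm (fderiv ℝ w) 2 volume) := by
  have hcf : Continuous (fderiv ℝ w) := hw.continuous_fderiv (by simp)
  calc ∫⁻ x, ‖G x‖ₑ * ‖w (x - z) - w x‖ₑ
      ≤ ∫⁻ x, ∫⁻ r in Ioc (0 : ℝ) 1, ‖z‖ₑ * (‖G x‖ₑ * ‖fderiv ℝ w (x - r • z)‖ₑ) := by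
        refine lintegral_mono fun x => ?_
        refine (mul_le_mul_right (enorm_sub_le_lintegral hw x z) _).trans (le_of_eq ?_)
        rw [← lintegral_const_mul' _ _ enorm_ne_top]
        refine lintegral_congr fun r => ?_
        ring
    _ = ∫⁻ r in Ioc (0 : ℝ) 1, ∫⁻ x, ‖z‖ₑ * (‖G x‖ₑ * ‖fderiv ℝ w (x - r • z)‖ₑ) := by
        refine lintegral_lintegral_swap ?_
        refine AEMeasurable.const_mul (M := ℝ≥0∞) (AEMeasurable.mul ?_ ?_) _
        · exact hG.enorm.comp_quasiMeasurePreserving Measure.quasiMeasurePreserving_fst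
        · have : Continuous fun p : Plane × ℝ => fderiv ℝ w (p.1 - p.2 • z) :=
            hcf.comp (by fun_prop)
          exact this.enorm.aemeasurable
    _ ≤ ∫⁻ r in Ioc (0 : ℝ) 1, ‖z‖ₑ * (eLpNorm G 2 volume * eLpNorm (fderiv ℝ w) 2 volume) := by
        refine lintegral_mono fun r => ?_
        rw [lintegral_const_mul' _ _ enorm_ne_top]
        gcongr
        refine (lintegral_mul_le_eLpNorm_two hG
          (hcf.comp (by fun_prop : Continuous fun x : Plane => x - r • z)).aestronglyMeasurable).trans
          (le_of_eq ?_)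
        congr 1
        exact eLpNorm_comp_measurePreserving hcf.aestronglyMeasurable
          (measurePreserving_sub_right volume (r • z))
    _ = _ := by simp

/-! ### Integration by parts -/

lemma integrable_mul_of_memLp {f g : Plane → ℝ} (hf : MemLp f 2) (hg : MemLp g 2) :
    Integrable fun x => f x * g x :=
  hf.integrable_mul hg

lemma memLp_bdd_mul {f g : Plane → ℝ} (hf : MemLp f 2) (hg : Continuous g) {B : ℝ}
    (hB : ∀ x, |g x| ≤ B) : MemLp (fun x => g x * f x) 2 := by
  refine (hf.const_mul B).of_le (hg.aestronglyMeasurable.mul hf.aestronglyMeasurable)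
    (.of_forall fun x => ?_)
  rw [norm_mul, norm_mul]
  gcongr
  exact (hB x).trans (le_abs_self B)

lemma integral_mul_pd {f g : Plane → ℝ} (j : Fin 2) (hf : Differentiable ℝ f)
    (hg : Differentiable ℝ g) (mf : MemLp f 2) (mf' : MemLp (pd j f) 2) (mg : MemLp g 2)
    (mg' : MemLp (pd j g) 2) : ∫ x, f x * pd j g x = - ∫ x, pd j f x * g x :=
  integral_mul_fderiv_eq_neg_fderiv_mul_of_integrable (mf'.integrable_mul mg)
    (mf.integrable_mul mg') (mf.integrable_mul mg) (fun x _ => hf x) (fun x _ => hg x)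

lemma pd_mul {f g : Plane → ℝ} (hf : Differentiable ℝ f) (hg : Differentiable ℝ g) (j : Fin 2)
    (x : Plane) : pd j (fun y => f y * g y) x = pd j f x * g x + f x * pd j g x := by
  have h : HasFDerivAt (fun y => f y * g y) _ x := (hf x).hasFDerivAt.mul (hg x).hasFDerivAt
  rw [pd, h.fderiv]
  simp [pd]
  ring

lemma IsSob.bounded {f : Plane → ℝ} (hf : IsSob f) : ∃ B, ∀ x, |f x| ≤ B := by
  obtain ⟨C, -, hC⟩ := exists_sobolev_embedding
  exact ⟨_, hC f hf⟩

/-- The derivative `u · ∇f` along a vector field with the components `u 0`, `u 1`. -/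
def advect (u : Fin 2 → Plane → ℝ) (f : Plane → ℝ) (x : Plane) : ℝ :=
  u 0 x * pd 0 f x + u 1 x * pd 1 f x

lemma memLp_advect {u : Fin 2 → Plane → ℝ} (hu : ∀ j, IsSob (u j)) {f : Plane → ℝ}
    (hf : ∀ j, MemLp (pd j f) 2) : MemLp (advect u f) 2 := by
  obtain ⟨B₀, hB₀⟩ := (hu 0).bounded
  obtain ⟨B₁, hB₁⟩ := (hu 1).bounded
  exact (memLp_bdd_mul (hf 0) (hu 0).continuous hB₀).add
    (memLp_bdd_mul (hf 1) (hu 1).continuous hB₁)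

/-! ### The commutator of `∂₁ e^{sΔ}` with the transport by a divergence free field -/

/-- The coefficient `w x` is constant in `y`, so the left side is an integral of `∂₁heat(x-y)(w y -
w x)∂_jθ y`. Integrating by parts moves the derivative off `θ`; the factor `w y - w x` then
compensates for the second derivative on the kernel. -/
lemma heat_commutator_component (hs : 0 < s) {w θ : Plane → ℝ} (hw : IsSob w) (hθ : IsSob θ)
    (j : Fin 2) (x : Plane) :
    Integrable (fun y => pd j (pd 0 (heat s)) (x - y) * (w y - w x) * θ y) ∧
    Integrable (fun y => pd 0 (heat s) (x - y) * pd j w y * θ y) ∧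
    Integrable (fun y => pd 0 (heat s) (x - y) * (w y * pd j θ y)) ∧
    (∫ y, pd 0 (heat s) (x - y) * (w y * pd j θ y)) - w x * heatDeriv s (pd j θ) x
      = (∫ y, pd j (pd 0 (heat s)) (x - y) * (w y - w x) * θ y)
        - ∫ y, pd 0 (heat s) (x - y) * pd j w y * θ y := by
  obtain ⟨B, hB⟩ := hw.bounded
  obtain ⟨B', hB'⟩ := (hw.pd j).bounded
  have hdη : Differentiable ℝ (pd 0 (heat s)) :=
    (contDiff_pd contDiff_heat 0).differentiable (by simp)
  have mη : MemLp (fun y => pd 0 (heat s) (x - y)) 2 := memLp_comp_sub (memLp_pd_heat hs 0).2 x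
  have mη' : MemLp (fun y => pd j (pd 0 (heat s)) (x - y)) 2 :=
    memLp_comp_sub (memLp_pd_pd_heat hs j).2 x
  have hd1 : Differentiable ℝ (fun y => pd 0 (heat s) (x - y)) := hdη.comp (by fun_prop)
  have hd2 : Differentiable ℝ (fun y => w y - w x) := hw.differentiable.sub_const _
  have hcw : Continuous fun y => w y - w x := hw.continuous.sub continuous_const
  have hbw : ∀ y, |w y - w x| ≤ B + B := fun y => (abs_sub _ _).trans (add_le_add (hB y) (hB x))
  have epd : pd j (fun y => w y - w x) = pd j w := by
    funext y
    have : fderiv ℝ (fun y => w y - w x) y = fderiv ℝ w y := fderiv_sub_const _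
    rw [pd, this, pd]
  have eprod : pd j (fun y => pd 0 (heat s) (x - y) * (w y - w x))
      = fun y => pd 0 (heat s) (x - y) * pd j w y
        - pd j (pd 0 (heat s)) (x - y) * (w y - w x) := by
    funext y
    rw [pd_mul hd1 hd2, pd_comp_sub hdη, epd]; ring
  have m1 : MemLp (fun y => pd 0 (heat s) (x - y) * (w y - w x)) 2 := by
    simpa only [mul_comm] using memLp_bdd_mul mη hcw hbw
  have m2 : MemLp (fun y => pd j (pd 0 (heat s)) (x - y) * (w y - w x)) 2 := by
    simpa only [mul_comm] using memLp_bdd_mul mη' hcw hbw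
  have m3 : MemLp (fun y => pd 0 (heat s) (x - y) * pd j w y) 2 := by
    simpa only [mul_comm] using memLp_bdd_mul mη (hw.pd j).continuous hB'
  have m4 : MemLp (fun y => w y * pd j θ y) 2 := memLp_bdd_mul (hθ.pd j).memLp hw.continuous hB
  have i1 := integrable_mul_of_memLp m2 hθ.memLp
  have i2 := integrable_mul_of_memLp m3 hθ.memLp
  have i3 := integrable_mul_of_memLp mη m4
  refine ⟨i1, i2, i3, ?_⟩
  have ibp := integral_mul_pd j (hd1.mul hd2) hθ.differentiable m1
    (by rw [show (fun y => pd 0 (heat s) (x - y)) * (fun y => w y - w x)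
      = fun y => pd 0 (heat s) (x - y) * (w y - w x) from rfl, eprod]; exact m3.sub m2)
    hθ.memLp (hθ.pd j).memLp
  rw [show (fun y => pd 0 (heat s) (x - y)) * (fun y => w y - w x)
      = fun y => pd 0 (heat s) (x - y) * (w y - w x) from rfl, eprod] at ibp
  have e1 : ∫ y, (pd 0 (heat s) (x - y) * (w y - w x)) * pd j θ y
      = (∫ y, pd 0 (heat s) (x - y) * (w y * pd j θ y)) - w x * heatDeriv s (pd j θ) x := by
    rw [heatDeriv, ← integral_const_mul, ← integral_sub i3
      ((integrable_mul_of_memLp mη (hθ.pd j).memLp).const_mul _)]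
    refine integral_congr_ae (.of_forall fun y => ?_)
    ring
  have e2 : ∫ y, (pd 0 (heat s) (x - y) * pd j w y
        - pd j (pd 0 (heat s)) (x - y) * (w y - w x)) * θ y
      = (∫ y, pd 0 (heat s) (x - y) * pd j w y * θ y)
        - ∫ y, pd j (pd 0 (heat s)) (x - y) * (w y - w x) * θ y := by
    rw [← integral_sub i2 i1]
    refine integral_congr_ae (.of_forall fun y => ?_)
    ring
  rw [← e1, ibp, e2]; ring

variable {u : Fin 2 → Plane → ℝ} {θ G : Plane → ℝ}

/-- The terms of `heat_commutator_component` containing `∂_j u_j` add up to `div u`, hence cancel.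
-/
lemma heat_commutator_apply (hs : 0 < s) (hu : ∀ j, IsSob (u j)) (hθ : IsSob θ)
    (hdiv : ∀ x, pd 0 (u 0) x + pd 1 (u 1) x = 0) (x : Plane) :
    heatDeriv s (advect u θ) x
        - (u 0 x * heatDeriv s (pd 0 θ) x + u 1 x * heatDeriv s (pd 1 θ) x)
      = (∫ y, pd 0 (pd 0 (heat s)) (x - y) * (u 0 y - u 0 x) * θ y)
        + ∫ y, pd 1 (pd 0 (heat s)) (x - y) * (u 1 y - u 1 x) * θ y := by
  obtain ⟨-, b0, c0, e0⟩ := heat_commutator_component hs (hu 0) hθ 0 x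
  obtain ⟨-, b1, c1, e1⟩ := heat_commutator_component hs (hu 1) hθ 1 x
  have h1 : heatDeriv s (advect u θ) x = (∫ y, pd 0 (heat s) (x - y) * (u 0 y * pd 0 θ y))
      + ∫ y, pd 0 (heat s) (x - y) * (u 1 y * pd 1 θ y) := by
    rw [heatDeriv, ← integral_add c0 c1]
    simp only [advect, mul_add]
  have h2 : (∫ y, pd 0 (heat s) (x - y) * pd 0 (u 0) y * θ y)
      + ∫ y, pd 0 (heat s) (x - y) * pd 1 (u 1) y * θ y = 0 := by
    rw [← integral_add b0 b1]
    simp only [← add_mul, ← mul_add, hdiv, mul_zero, zero_mul, integral_zero]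
  linarith

/-- With `|θ| ≤ M` and `z = x - y`, Tonelli's theorem reduces the double integral to the `L²`
difference estimate at fixed `z`. This leaves the first moment of the kernel. -/
lemma lintegral_heat_kernel_le (hs : 0 < s) {w : Plane → ℝ} (hw : IsSob w) {M : ℝ}
    (hM : ∀ x, |θ x| ≤ M) (hG : MemLp G 2) (j : Fin 2) :
    ∫⁻ x, ‖G x‖ₑ * ‖∫ y, pd j (pd 0 (heat s)) (x - y) * (w y - w x) * θ y‖ₑ
      ≤ ENNReal.ofReal M * (ENNReal.ofReal (16 * (√s)⁻¹)
        * (eLpNorm G 2 volume * eLpNorm (fderiv ℝ w) 2 volume)) := by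
  set κ : Plane → ℝ := pd j (pd 0 (heat s)) with hκ
  have hκc : Continuous κ := (contDiff_pd (contDiff_pd contDiff_heat 0) j).continuous
  calc ∫⁻ x, ‖G x‖ₑ * ‖∫ y, κ (x - y) * (w y - w x) * θ y‖ₑ
      ≤ ∫⁻ x, ∫⁻ z, ENNReal.ofReal M * (‖κ z‖ₑ * (‖G x‖ₑ * ‖w (x - z) - w x‖ₑ)) := by
        refine lintegral_mono fun x => ?_
        have h1 : ‖∫ y, κ (x - y) * (w y - w x) * θ y‖ₑ
            ≤ ∫⁻ z, ENNReal.ofReal M * (‖κ z‖ₑ * ‖w (x - z) - w x‖ₑ) := by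
          refine (enorm_integral_le_lintegral_enorm _).trans ?_
          rw [← lintegral_sub_left_eq_self (μ := (volume : Measure Plane)) _ x]
          refine lintegral_mono fun z => ?_
          rw [sub_sub_cancel, enorm_mul, enorm_mul, mul_comm]
          gcongr
          rw [Real.enorm_eq_ofReal_abs]
          exact ENNReal.ofReal_le_ofReal (hM _)
        refine (mul_le_mul_right h1 _).trans (le_of_eq ?_)
        rw [← lintegral_const_mul' _ _ enorm_ne_top]
        refine lintegral_congr fun z => ?_
        ring
    _ = ∫⁻ z, ∫⁻ x, ENNReal.ofReal M * (‖κ z‖ₑ * (‖G x‖ₑ * ‖w (x - z) - w x‖ₑ)) := by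
        refine lintegral_lintegral_swap ?_
        refine AEMeasurable.const_mul (M := ℝ≥0∞) (AEMeasurable.mul ?_ (AEMeasurable.mul ?_ ?_)) _
        · exact (hκc.comp continuous_snd).enorm.aemeasurable
        · exact hG.aestronglyMeasurable.enorm.comp_quasiMeasurePreserving
            Measure.quasiMeasurePreserving_fst
        · have : Continuous fun p : Plane × Plane => w (p.1 - p.2) - w p.1 :=
            (hw.continuous.comp (by fun_prop)).sub (hw.continuous.comp continuous_fst)
          exact this.enorm.aemeasurable
    _ ≤ ∫⁻ z, ENNReal.ofReal M * ((‖z‖ₑ * ‖κ z‖ₑ)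
          * (eLpNorm G 2 volume * eLpNorm (fderiv ℝ w) 2 volume)) := by
        refine lintegral_mono fun z => ?_
        rw [lintegral_const_mul' _ _ ENNReal.ofReal_ne_top, lintegral_const_mul' _ _ enorm_ne_top]
        refine mul_le_mul_right (le_trans (mul_le_mul_right
          (lintegral_mul_difference_le hG.aestronglyMeasurable hw.contDiff z) _)
          (le_of_eq ?_)) _
        ring
    _ ≤ _ := by
        have hm : Measurable fun z => ‖z‖ₑ * ‖κ z‖ₑ := measurable_enorm.mul hκc.enorm.measurable
        rw [lintegral_const_mul' _ _ ENNReal.ofReal_ne_top, lintegral_mul_const _ hm]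
        gcongr
        exact lintegral_norm_mul_pd_pd_heat_le hs j

lemma eLpNorm_eq_ofReal_toL2 {f : Plane → ℝ} (hf : MemLp f 2) :
    eLpNorm f 2 = ENNReal.ofReal ‖toL2 f‖ := by
  rw [norm_toL2 hf, ENNReal.ofReal_toReal hf.eLpNorm_ne_top]

lemma norm_le_abs_add_abs (L : Plane →L[ℝ] ℝ) : ‖L‖ ≤ |L (basisVec 0)| + |L (basisVec 1)| := by
  refine L.opNorm_le_bound (by positivity) fun v => ?_
  have hv : v = v 0 • basisVec 0 + v 1 • basisVec 1 := by
    ext i; fin_cases i <;> simp [basisVec]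
  have h0 : |v 0| ≤ ‖v‖ := PiLp.norm_apply_le v 0
  have h1 : |v 1| ≤ ‖v‖ := PiLp.norm_apply_le v 1
  calc ‖L v‖ = |v 0 * L (basisVec 0) + v 1 * L (basisVec 1)| := by
        conv_lhs => rw [hv]
        simp
    _ ≤ |v 0| * |L (basisVec 0)| + |v 1| * |L (basisVec 1)| := by
        refine (abs_add_le _ _).trans_eq ?_
        rw [abs_mul, abs_mul]
    _ ≤ ‖v‖ * |L (basisVec 0)| + ‖v‖ * |L (basisVec 1)| := by gcongr
    _ = _ := by ring

lemma eLpNorm_fderiv_le {w : Plane → ℝ} (hw : IsSob w) :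
    eLpNorm (fderiv ℝ w) 2 ≤ ENNReal.ofReal (‖toL2 (pd 0 w)‖ + ‖toL2 (pd 1 w)‖) := by
  have h0 := (hw.pd 0).memLp
  have h1 := (hw.pd 1).memLp
  set a : Plane → ℝ := fun x => ‖pd 0 w x‖ with ha
  set b : Plane → ℝ := fun x => ‖pd 1 w x‖ with hb
  have h2 : eLpNorm (fderiv ℝ w) 2 volume ≤ eLpNorm (a + b) 2 volume :=
    eLpNorm_mono_real fun x => norm_le_abs_add_abs (fderiv ℝ w x)
  have h3 : eLpNorm (a + b) 2 volume ≤ eLpNorm a 2 volume + eLpNorm b 2 volume :=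
    eLpNorm_add_le h0.norm.aestronglyMeasurable h1.norm.aestronglyMeasurable (by norm_num)
  rw [ha, hb, eLpNorm_norm, eLpNorm_norm, eLpNorm_eq_ofReal_toL2 h0, eLpNorm_eq_ofReal_toL2 h1,
    ← ENNReal.ofReal_add (norm_nonneg _) (norm_nonneg _)] at h3
  exact h2.trans h3

/-- The sum of the `L²` norms of all first derivatives of a vector field. -/
def gradNorm (u : Fin 2 → Plane → ℝ) : ℝ :=
  (‖toL2 (pd 0 (u 0))‖ + ‖toL2 (pd 1 (u 0))‖) + (‖toL2 (pd 0 (u 1))‖ + ‖toL2 (pd 1 (u 1))‖)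

lemma gradNorm_nonneg (u : Fin 2 → Plane → ℝ) : 0 ≤ gradNorm u := by
  unfold gradNorm; positivity

/-- The commutator of `∂₁ e^{sΔ}` with `u · ∇`, applied to `θ` and tested against `G`. -/
def heatCommutator (s : ℝ) (u : Fin 2 → Plane → ℝ) (θ G : Plane → ℝ) : ℝ :=
  (∫ x, G x * heatDeriv s (advect u θ) x)
    - ((∫ x, (u 0 x * G x) * heatDeriv s (pd 0 θ) x)
      + ∫ x, (u 1 x * G x) * heatDeriv s (pd 1 θ) x)

/-- No derivative falls on `θ`, and on `u` only one, measured in `L²`. In `heatCommutator` the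
factor `u j` is attached to `G`, so that every term is an `L²` pairing with a Fourier multiplier. -/
lemma abs_heatCommutator_le (hs : 0 < s) (hu : ∀ j, IsSob (u j)) (hθ : IsSob θ)
    (hdiv : ∀ x, pd 0 (u 0) x + pd 1 (u 1) x = 0) {M : ℝ} (hM : ∀ x, |θ x| ≤ M)
    (hG : MemLp G 2) :
    |heatCommutator s u θ G| ≤ (√s)⁻¹ * (16 * M * ‖toL2 G‖ * gradNorm u) := by
  have hM0 : 0 ≤ M := (abs_nonneg _).trans (hM 0)
  have hmul : ∀ j, MemLp (fun x => u j x * G x) 2 := fun j => by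
    obtain ⟨B, hB⟩ := (hu j).bounded
    exact memLp_bdd_mul hG (hu j).continuous hB
  have mA := (memLp_heatDeriv hs (memLp_advect hu fun j => (hθ.pd j).memLp)).1
  have m0 := (memLp_heatDeriv hs (hθ.pd 0).memLp).1
  have m1 := (memLp_heatDeriv hs (hθ.pd 1).memLp).1
  set Q : Fin 2 → Plane → ℝ := fun j x =>
    ∫ y, pd j (pd 0 (heat s)) (x - y) * (u j y - u j x) * θ y with hQ
  have e : heatCommutator s u θ G = ∫ x, G x * (Q 0 x + Q 1 x) := by
    rw [heatCommutator, ← sub_sub, ← integral_sub (integrable_mul_of_memLp hG mA)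
      (integrable_mul_of_memLp (hmul 0) m0), ← integral_sub _ (integrable_mul_of_memLp (hmul 1) m1)]
    swap
    · exact (integrable_mul_of_memLp hG mA).sub (integrable_mul_of_memLp (hmul 0) m0)
    refine integral_congr_ae (.of_forall fun x => ?_)
    have := heat_commutator_apply hs hu hθ hdiv x
    simp only [hQ]
    rw [← this]; ring
  have hgn : ∀ j, ENNReal.ofReal M * (ENNReal.ofReal (16 * (√s)⁻¹)
        * (eLpNorm G 2 volume * eLpNorm (fderiv ℝ (u j)) 2 volume))
      ≤ ENNReal.ofReal (M * ((16 * (√s)⁻¹)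
        * (‖toL2 G‖ * (‖toL2 (pd 0 (u j))‖ + ‖toL2 (pd 1 (u j))‖)))) := fun j => by
    rw [ENNReal.ofReal_mul hM0,
      ENNReal.ofReal_mul (p := 16 * (√s)⁻¹) (by positivity),
      ENNReal.ofReal_mul (norm_nonneg _), eLpNorm_eq_ofReal_toL2 hG]
    gcongr
    exact eLpNorm_fderiv_le (hu j)
  -- The estimate is carried out in `ℝ≥0∞`, so that splitting and swapping integrals requires only
  -- measurability.
  have hfin : ‖heatCommutator s u θ G‖ₑ
      ≤ ENNReal.ofReal ((√s)⁻¹ * (16 * M * ‖toL2 G‖ * gradNorm u)) := by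
    rw [e]
    calc ‖∫ x, G x * (Q 0 x + Q 1 x)‖ₑ ≤ ∫⁻ x, (‖G x‖ₑ * ‖Q 0 x‖ₑ + ‖G x‖ₑ * ‖Q 1 x‖ₑ) := by
          refine (enorm_integral_le_lintegral_enorm _).trans (lintegral_mono fun x => ?_)
          rw [enorm_mul, ← mul_add]
          gcongr
          exact enorm_add_le _ _
      _ ≤ _ := ?_
    have hQm : StronglyMeasurable (Q 0) := by
      have hκ := (contDiff_pd (contDiff_pd (contDiff_heat (s := s)) 0) 0).continuous
      have hu0 := (hu 0).continuous
      have hθc := hθ.continuous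
      have hc : Continuous fun p : Plane × Plane =>
          pd 0 (pd 0 (heat s)) (p.1 - p.2) * (u 0 p.2 - u 0 p.1) * θ p.2 :=
        ((hκ.comp (continuous_fst.sub continuous_snd)).mul
          ((hu0.comp continuous_snd).sub (hu0.comp continuous_fst))).mul (hθc.comp continuous_snd)
      exact hc.stronglyMeasurable.integral_prod_right
    have hmeas : AEMeasurable (fun x => ‖G x‖ₑ * ‖Q 0 x‖ₑ) volume :=
      hG.aestronglyMeasurable.enorm.mul hQm.aestronglyMeasurable.enorm
    rw [lintegral_add_left' hmeas]
    refine (add_le_add ((lintegral_heat_kernel_le hs (hu 0) hM hG 0).trans (hgn 0))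
      ((lintegral_heat_kernel_le hs (hu 1) hM hG 1).trans (hgn 1))).trans (le_of_eq ?_)
    rw [← ENNReal.ofReal_add (by positivity) (by positivity)]
    congr 1
    rw [gradNorm]; ring
  rw [Real.enorm_eq_ofReal_abs] at hfin
  exact (ENNReal.ofReal_le_ofReal_iff (by have := gradNorm_nonneg u; positivity)).1 hfin

/-! ### The truncated symbol -/

/-- The number `|2πξ|`. -/
def freq (ξ : Plane) : ℝ := 2 * Real.pi * ‖ξ‖

lemma freq_nonneg (ξ : Plane) : 0 ≤ freq ξ := by unfold freq; have := Real.pi_pos; positivity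

lemma continuous_freq : Continuous freq := by unfold freq; fun_prop

/-- The part `Γ(α)⁻¹ ∫₀¹ s^{α-1} exp(-s|2πξ|²) ds` of `|2πξ|^{-2α}`. -/
def truncSymbol (α : ℝ) (ξ : Plane) : ℝ :=
  (Real.Gamma α)⁻¹ * ∫ s in Ioc (0 : ℝ) 1, s ^ (α - 1) * heatSymbol s ξ

/-- The symbol of the truncation of `R_{2α}` to high frequencies. -/
def highSymbol (α : ℝ) (ξ : Plane) : ℂ := derivSymbol 0 ξ * truncSymbol α ξ

variable {α : ℝ}

lemma integrableOn_rpow_Ioc {a : ℝ} (ha : -1 < a) :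
    IntegrableOn (fun s : ℝ => s ^ a) (Ioc 0 1) :=
  (intervalIntegrable_iff_integrableOn_Ioc_of_le zero_le_one).1
    (intervalIntegral.intervalIntegrable_rpow' ha)

lemma integral_rpow_Ioc {a : ℝ} (ha : -1 < a) :
    ∫ s in Ioc (0 : ℝ) 1, s ^ a = (a + 1)⁻¹ := by
  rw [← intervalIntegral.integral_of_le zero_le_one, integral_rpow (Or.inl ha)]
  rw [Real.zero_rpow (by linarith)]
  simp

lemma heatSymbol_pos (s : ℝ) (ξ : Plane) : 0 < heatSymbol s ξ := Real.exp_pos _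

lemma heatSymbol_le_one {s : ℝ} (hs : 0 ≤ s) (ξ : Plane) : heatSymbol s ξ ≤ 1 := by
  rw [heatSymbol, Real.exp_le_one_iff]
  nlinarith [mul_nonneg hs (sq_nonneg (2 * Real.pi * ‖ξ‖))]

lemma measurable_rpow_mul_heatSymbol (α : ℝ) :
    Measurable fun p : Plane × ℝ => p.2 ^ (α - 1) * heatSymbol p.2 p.1 := by
  unfold heatSymbol; fun_prop

lemma truncSymbol_nonneg (hα : 0 < α) (ξ : Plane) : 0 ≤ truncSymbol α ξ := by
  refine mul_nonneg (inv_nonneg.2 (Real.Gamma_pos_of_pos hα).le) ?_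
  refine setIntegral_nonneg measurableSet_Ioc fun s hs => ?_
  exact mul_nonneg (Real.rpow_nonneg hs.1.le _) (heatSymbol_pos s ξ).le

lemma truncSymbol_le (hα : 0 < α) (ξ : Plane) :
    truncSymbol α ξ ≤ (Real.Gamma α)⁻¹ * α⁻¹ := by
  have hG := Real.Gamma_pos_of_pos hα
  rw [truncSymbol]
  gcongr
  have h := integral_rpow_Ioc (a := α - 1) (by linarith)
  rw [sub_add_cancel] at h
  rw [← h]
  refine integral_mono_of_nonneg ?_ (integrableOn_rpow_Ioc (by linarith)) ?_
  · filter_upwards [ae_restrict_mem measurableSet_Ioc] with s hs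
    exact mul_nonneg (Real.rpow_nonneg hs.1.le _) (heatSymbol_pos s ξ).le
  · filter_upwards [ae_restrict_mem measurableSet_Ioc] with s hs
    exact mul_le_of_le_one_right (Real.rpow_nonneg hs.1.le _) (heatSymbol_le_one hs.1.le ξ)

/-- The Gamma integral represents `R^{-2α}` as `Γ(α)⁻¹ ∫₀^∞ s^{α-1} exp(-R²s) ds`; removing `(0,1]`
leaves the tail, which is positive and Gaussian small in `R`. -/
lemma freq_rpow_sub_truncSymbol (hα : 0 < α) {ξ : Plane} (hξ : 0 < freq ξ) :
    freq ξ ^ (-(2 * α)) - truncSymbol α ξ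
      = (Real.Gamma α)⁻¹ * ∫ s in Ioi (1 : ℝ), s ^ (α - 1) * Real.exp (-(freq ξ ^ 2 * s)) := by
  have hG := Real.Gamma_pos_of_pos hα
  have h1 := Real.integral_rpow_mul_exp_neg_mul_Ioi hα (pow_pos hξ 2)
  have hi : IntegrableOn (fun s : ℝ => s ^ (α - 1) * Real.exp (-(freq ξ ^ 2 * s))) (Ioi 0) := by
    -- A non-integrable function has Bochner integral `0`, so the nonzero value of the Gamma
    -- integral already proves integrability.
    have hne : ∫ s in Ioi (0 : ℝ), s ^ (α - 1) * Real.exp (-(freq ξ ^ 2 * s)) ≠ 0 := by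
      rw [h1]; positivity
    exact not_imp_comm.1 integral_undef hne
  have h2 : ∫ s in Ioi (0 : ℝ), s ^ (α - 1) * Real.exp (-(freq ξ ^ 2 * s))
      = (∫ s in Ioc (0 : ℝ) 1, s ^ (α - 1) * Real.exp (-(freq ξ ^ 2 * s)))
        + ∫ s in Ioi (1 : ℝ), s ^ (α - 1) * Real.exp (-(freq ξ ^ 2 * s)) := by
    rw [← Ioc_union_Ioi_eq_Ioi (zero_le_one (α := ℝ)), setIntegral_union (Ioc_disjoint_Ioi le_rfl)
      measurableSet_Ioi (hi.mono_set Ioc_subset_Ioi_self) (hi.mono_set (Ioi_subset_Ioi zero_le_one))]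
  have h3 : truncSymbol α ξ
      = (Real.Gamma α)⁻¹ * ∫ s in Ioc (0 : ℝ) 1, s ^ (α - 1) * Real.exp (-(freq ξ ^ 2 * s)) := by
    rw [truncSymbol]
    congr 2
    funext s
    rw [heatSymbol, freq]
    ring_nf
  have h4 : freq ξ ^ (-(2 * α)) = (1 / freq ξ ^ 2) ^ α := by
    rw [one_div, Real.inv_rpow (by positivity), ← Real.rpow_natCast, ← Real.rpow_mul hξ.le,
      Real.rpow_neg hξ.le]
    norm_num
  rw [h3, h4, ← mul_right_cancel_iff_of_pos hG]
  rw [h1] at h2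
  rw [sub_mul, h2]
  field_simp
  ring

lemma truncSymbol_le_rpow (hα : 0 < α) {ξ : Plane} (hξ : 0 < freq ξ) :
    truncSymbol α ξ ≤ freq ξ ^ (-(2 * α)) := by
  rw [← sub_nonneg, freq_rpow_sub_truncSymbol hα hξ]
  refine mul_nonneg (inv_nonneg.2 (Real.Gamma_pos_of_pos hα).le) ?_
  refine setIntegral_nonneg measurableSet_Ioi fun s hs => ?_
  exact mul_nonneg (Real.rpow_nonneg (zero_le_one.trans (le_of_lt hs)) _) (Real.exp_pos _).le

/-- For `s ≥ 1` and `α < 1` the weight `s^{α-1}` is at most `1`, which leaves an explicit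
exponential integral. -/
lemma freq_rpow_sub_truncSymbol_le (hα : α ∈ Ioo (1 / 2 : ℝ) 1) {ξ : Plane} (hξ : 0 < freq ξ) :
    freq ξ ^ (-(2 * α)) - truncSymbol α ξ
      ≤ (Real.Gamma α)⁻¹ * (Real.exp (-freq ξ ^ 2) / freq ξ ^ 2) := by
  have hα0 : 0 < α := by linarith [hα.1]
  have hG := Real.Gamma_pos_of_pos hα0
  have hR : 0 < freq ξ ^ 2 := by positivity
  rw [freq_rpow_sub_truncSymbol hα0 hξ]
  gcongr
  have hi : IntegrableOn (fun s : ℝ => Real.exp (-(freq ξ ^ 2) * s)) (Ioi 1) :=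
    integrableOn_exp_mul_Ioi (by linarith) 1
  have h := integral_exp_mul_Ioi (a := -(freq ξ ^ 2)) (by linarith) 1
  rw [mul_one, neg_div_neg_eq] at h
  rw [← h]
  refine integral_mono_of_nonneg ?_ hi ?_
  · filter_upwards [ae_restrict_mem measurableSet_Ioi] with s hs
    exact mul_nonneg (Real.rpow_nonneg (zero_le_one.trans (le_of_lt hs)) _) (Real.exp_pos _).le
  · filter_upwards [ae_restrict_mem measurableSet_Ioi] with s hs
    rw [neg_mul]
    exact mul_le_of_le_one_left (Real.exp_pos _).le
      (Real.rpow_le_one_of_one_le_of_nonpos (le_of_lt hs) (by linarith [hα.2]))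

lemma norm_derivSymbol_le_freq (j : Fin 2) (ξ : Plane) : ‖derivSymbol j ξ‖ ≤ freq ξ :=
  norm_derivSymbol_le j ξ

/-- Below frequency one the truncated symbol is bounded and `ξ₁` is harmless. Above it the
comparison with `|2πξ|^{1-2α}` applies, a negative power since `α > 1/2`. -/
lemma norm_highSymbol_le (hα : α ∈ Ioo (1 / 2 : ℝ) 1) (ξ : Plane) :
    ‖highSymbol α ξ‖ ≤ (Real.Gamma α)⁻¹ * α⁻¹ + 1 := by
  have hα0 : 0 < α := by linarith [hα.1]
  have hG := Real.Gamma_pos_of_pos hα0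
  have hR := freq_nonneg ξ
  have ht := truncSymbol_nonneg hα0 ξ
  rw [highSymbol, norm_mul, Complex.norm_real, Real.norm_of_nonneg ht]
  refine (mul_le_mul_of_nonneg_right (norm_derivSymbol_le_freq 0 ξ) ht).trans ?_
  rcases le_total (freq ξ) 1 with h | h
  · have h1 : freq ξ * truncSymbol α ξ ≤ truncSymbol α ξ := mul_le_of_le_one_left ht h
    linarith [truncSymbol_le hα0 ξ]
  · have hpos : 0 < freq ξ := one_pos.trans_le h
    have h1 : freq ξ * truncSymbol α ξ ≤ freq ξ * freq ξ ^ (-(2 * α)) := by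
      gcongr; exact truncSymbol_le_rpow hα0 hpos
    have h2 : freq ξ * freq ξ ^ (-(2 * α)) = freq ξ ^ (1 + -(2 * α)) := by
      rw [Real.rpow_add hpos, Real.rpow_one]
    have h3 : freq ξ ^ (1 + -(2 * α)) ≤ 1 :=
      Real.rpow_le_one_of_one_le_of_nonpos h (by linarith [hα.1])
    have : 0 ≤ (Real.Gamma α)⁻¹ * α⁻¹ := by positivity
    linarith

/-- The symbol `2πiξ₁ - |2πξ|^{2α} k(ξ)` is bounded, `k` being the truncated symbol. -/
lemma norm_derivSymbol_sub_highSymbol_le (hα : α ∈ Ioo (1 / 2 : ℝ) 1) (ξ : Plane) :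
    ‖derivSymbol 0 ξ - ((freq ξ ^ (2 * α) : ℝ) : ℂ) * highSymbol α ξ‖
      ≤ 1 + (Real.Gamma α)⁻¹ := by
  have hα0 : 0 < α := by linarith [hα.1]
  have hG := Real.Gamma_pos_of_pos hα0
  rcases (freq_nonneg ξ).eq_or_lt with h0 | hpos
  · have : derivSymbol 0 ξ = 0 := norm_le_zero_iff.1 (h0 ▸ norm_derivSymbol_le_freq 0 ξ)
    rw [highSymbol, this]; simp; positivity
  have e : derivSymbol 0 ξ - ((freq ξ ^ (2 * α) : ℝ) : ℂ) * highSymbol α ξ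
      = derivSymbol 0 ξ * ((freq ξ ^ (2 * α) * (freq ξ ^ (-(2 * α)) - truncSymbol α ξ) : ℝ) : ℂ) := by
    rw [highSymbol, mul_sub, Real.rpow_neg hpos.le, mul_inv_cancel₀ (by positivity)]
    push_cast; ring
  have hd0 : 0 ≤ freq ξ ^ (-(2 * α)) - truncSymbol α ξ :=
    sub_nonneg.2 (truncSymbol_le_rpow hα0 hpos)
  have hw : 0 < freq ξ ^ (2 * α) := by positivity
  rw [e, norm_mul, Complex.norm_real, Real.norm_of_nonneg (by positivity)]
  refine (mul_le_mul_of_nonneg_right (norm_derivSymbol_le_freq 0 ξ) (by positivity)).trans ?_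
  -- At low frequencies the weight `freq ^ (2α)` is cancelled by the full power `freq ^ (-2α)`; at
  -- high frequencies it is absorbed by the Gaussian tail of the remainder.
  rcases le_total (freq ξ) 1 with h | h
  · have h1 : freq ξ ^ (2 * α) * (freq ξ ^ (-(2 * α)) - truncSymbol α ξ) ≤ 1 := by
      calc _ ≤ freq ξ ^ (2 * α) * freq ξ ^ (-(2 * α)) := by
            gcongr; linarith [truncSymbol_nonneg hα0 ξ]
        _ = 1 := by rw [Real.rpow_neg hpos.le, mul_inv_cancel₀ hw.ne']
    have h2 : freq ξ * (freq ξ ^ (2 * α) * (freq ξ ^ (-(2 * α)) - truncSymbol α ξ)) ≤ 1 * 1 := by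
      gcongr
    have : 0 < (Real.Gamma α)⁻¹ := by positivity
    linarith
  · have h1 : freq ξ ^ (2 * α) ≤ freq ξ ^ 2 := by
      rw [← Real.rpow_natCast]
      exact Real.rpow_le_rpow_of_exponent_le h (by push_cast; linarith [hα.2])
    have h2 : freq ξ * Real.exp (-freq ξ ^ 2) ≤ 1 := by
      rw [Real.exp_neg, ← div_eq_mul_inv, div_le_one (Real.exp_pos _)]
      nlinarith [Real.add_one_le_exp (freq ξ ^ 2)]
    calc freq ξ * (freq ξ ^ (2 * α) * (freq ξ ^ (-(2 * α)) - truncSymbol α ξ))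
        ≤ freq ξ * (freq ξ ^ 2 * ((Real.Gamma α)⁻¹ * (Real.exp (-freq ξ ^ 2) / freq ξ ^ 2))) := by
          gcongr
          exact freq_rpow_sub_truncSymbol_le hα hpos
      _ = (Real.Gamma α)⁻¹ * (freq ξ * Real.exp (-freq ξ ^ 2)) := by field_simp
      _ ≤ (Real.Gamma α)⁻¹ * 1 := by gcongr
      _ ≤ _ := by linarith

/-- The truncated symbol differs from the one of `R_{2α}` by a symbol that is bounded after
multiplication by `|2πξ|^α`. -/
lemma norm_rpow_mul_symbol_sub_le (hα : α ∈ Ioo (1 / 2 : ℝ) 1) (ξ : Plane) :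
    ‖((freq ξ ^ α : ℝ) : ℂ) * (derivSymbol 0 ξ * ((freq ξ ^ (-(2 * α)) : ℝ) : ℂ) - highSymbol α ξ)‖
      ≤ 1 + (Real.Gamma α)⁻¹ := by
  have hα0 : 0 < α := by linarith [hα.1]
  have hG := Real.Gamma_pos_of_pos hα0
  rcases (freq_nonneg ξ).eq_or_lt with h0 | hpos
  · have : derivSymbol 0 ξ = 0 := norm_le_zero_iff.1 (h0 ▸ norm_derivSymbol_le_freq 0 ξ)
    rw [highSymbol, this]; simp; positivity
  have e : ((freq ξ ^ α : ℝ) : ℂ)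
        * (derivSymbol 0 ξ * ((freq ξ ^ (-(2 * α)) : ℝ) : ℂ) - highSymbol α ξ)
      = derivSymbol 0 ξ * ((freq ξ ^ α * (freq ξ ^ (-(2 * α)) - truncSymbol α ξ) : ℝ) : ℂ) := by
    rw [highSymbol]; push_cast; ring
  have hd0 : 0 ≤ freq ξ ^ (-(2 * α)) - truncSymbol α ξ :=
    sub_nonneg.2 (truncSymbol_le_rpow hα0 hpos)
  have hw : 0 < freq ξ ^ α := by positivity
  rw [e, norm_mul, Complex.norm_real, Real.norm_of_nonneg (by positivity)]
  refine (mul_le_mul_of_nonneg_right (norm_derivSymbol_le_freq 0 ξ) (by positivity)).trans ?_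
  have hGi : 0 < (Real.Gamma α)⁻¹ := by positivity
  rcases le_total (freq ξ) 1 with h | h
  · calc freq ξ * (freq ξ ^ α * (freq ξ ^ (-(2 * α)) - truncSymbol α ξ))
        ≤ freq ξ * (freq ξ ^ α * freq ξ ^ (-(2 * α))) := by
          gcongr; linarith [truncSymbol_nonneg hα0 ξ]
      _ = freq ξ ^ (1 - α) := by
          conv_lhs => rw [← Real.rpow_one (freq ξ), ← Real.rpow_mul hpos.le, ← Real.rpow_mul hpos.le]
          rw [← Real.rpow_add hpos, ← Real.rpow_add hpos]
          congr 1; ring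
      _ ≤ 1 := Real.rpow_le_one hpos.le h (by linarith [hα.2])
      _ ≤ _ := by linarith
  · have h1 : freq ξ ^ α ≤ freq ξ := by
      conv_rhs => rw [← Real.rpow_one (freq ξ)]
      exact Real.rpow_le_rpow_of_exponent_le h hα.2.le
    calc freq ξ * (freq ξ ^ α * (freq ξ ^ (-(2 * α)) - truncSymbol α ξ))
        ≤ freq ξ * (freq ξ * ((Real.Gamma α)⁻¹ * (Real.exp (-freq ξ ^ 2) / freq ξ ^ 2))) := by
          gcongr
          exact freq_rpow_sub_truncSymbol_le hα hpos
      _ = (Real.Gamma α)⁻¹ * Real.exp (-freq ξ ^ 2) := by field_simp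
      _ ≤ (Real.Gamma α)⁻¹ * 1 := by
          gcongr
          rw [Real.exp_le_one_iff]; nlinarith
      _ ≤ _ := by linarith

lemma stronglyMeasurable_truncSymbol : StronglyMeasurable (truncSymbol α) := by
  have := (measurable_rpow_mul_heatSymbol α).stronglyMeasurable.integral_prod_right'
    (ν := volume.restrict (Ioc (0 : ℝ) 1))
  exact this.const_mul _

lemma aestronglyMeasurable_highSymbol : AEStronglyMeasurable (highSymbol α) volume :=
  (continuous_derivSymbol 0).aestronglyMeasurable.mul
    (Complex.continuous_ofReal.comp_aestronglyMeasurable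
      stronglyMeasurable_truncSymbol.aestronglyMeasurable)

lemma highSymbol_neg (ξ : Plane) : highSymbol α (-ξ) = conj (highSymbol α ξ) := by
  rw [highSymbol, highSymbol, map_mul, derivSymbol_neg, Complex.conj_ofReal]
  simp [truncSymbol, heatSymbol]

/-! ### The truncated symbol as a superposition of heat symbols -/

/-- Fubini's theorem: the pairing with `K` is the `s`-average of the pairings with `∂₁e^{sΔ}`, so
commutator bounds for the latter can be integrated. -/
lemma highSymbol_superposition (hα : α ∈ Ioo (1 / 2 : ℝ) 1) {F H : Plane → ℂ} (hF : MemLp F 2)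
    (hH : MemLp H 2) :
    IntegrableOn (fun s : ℝ => ((s ^ (α - 1) : ℝ) : ℂ)
        * ∫ ξ, conj (F ξ) * (heatDerivSymbol s ξ * H ξ)) (Ioc 0 1) ∧
    ∫ ξ, conj (F ξ) * (highSymbol α ξ * H ξ) = ((Real.Gamma α)⁻¹ : ℝ) *
      ∫ s in Ioc (0 : ℝ) 1, ((s ^ (α - 1) : ℝ) : ℂ)
        * ∫ ξ, conj (F ξ) * (heatDerivSymbol s ξ * H ξ) := by
  have hFH : Integrable fun ξ => ‖F ξ‖ * ‖H ξ‖ := hF.norm.integrable_mul hH.norm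
  set Φ : ℝ × Plane → ℂ := fun p =>
    ((p.1 ^ (α - 1) : ℝ) : ℂ) * (conj (F p.2) * (heatDerivSymbol p.1 p.2 * H p.2)) with hΦ
  -- The dominating weight is `s^{α-1}` times the bound `s^{-1/2}` of `heatDerivSymbol`. Its
  -- exponent `α - 3/2` exceeds `-1` precisely for `α > 1/2`.
  have hdom : Integrable (fun p : ℝ × Plane => p.1 ^ (α - 3 / 2) * (‖F p.2‖ * ‖H p.2‖))
      ((volume.restrict (Ioc (0 : ℝ) 1)).prod volume) :=
    (integrableOn_rpow_Ioc (a := α - 3 / 2) (by linarith [hα.1])).mul_prod hFH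
  have hmeas : AEStronglyMeasurable Φ ((volume.restrict (Ioc (0 : ℝ) 1)).prod volume) := by
    have m1 : Measurable fun p : ℝ × Plane => ((p.1 ^ (α - 1) : ℝ) : ℂ) := by fun_prop
    have m2 : Measurable fun p : ℝ × Plane => heatDerivSymbol p.1 p.2 := by
      unfold heatDerivSymbol heatSymbol derivSymbol
      fun_prop
    exact m1.aestronglyMeasurable.mul ((Complex.continuous_conj.comp_aestronglyMeasurable
      hF.aestronglyMeasurable.comp_snd).mul
      (m2.aestronglyMeasurable.mul hH.aestronglyMeasurable.comp_snd))
  have hmem : ∀ᵐ p : ℝ × Plane ∂((volume.restrict (Ioc (0 : ℝ) 1)).prod volume),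
      p.1 ∈ Ioc (0 : ℝ) 1 :=
    Measure.quasiMeasurePreserving_fst.ae (ae_restrict_mem measurableSet_Ioc)
  have hinteg : Integrable Φ ((volume.restrict (Ioc (0 : ℝ) 1)).prod volume) := by
    refine hdom.mono' hmeas ?_
    filter_upwards [hmem] with p hp
    have h1 : p.1 ^ (α - 3 / 2) = p.1 ^ (α - 1) * (√p.1)⁻¹ := by
      rw [Real.sqrt_eq_rpow, ← Real.rpow_neg hp.1.le, ← Real.rpow_add hp.1]
      congr 1; ring
    have h0 : 0 ≤ p.1 ^ (α - 1) := Real.rpow_nonneg hp.1.le _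
    simp only [hΦ, norm_mul, Complex.norm_real, RCLike.norm_conj, Real.norm_of_nonneg h0]
    rw [h1]
    calc p.1 ^ (α - 1) * (‖F p.2‖ * (‖heatDerivSymbol p.1 p.2‖ * ‖H p.2‖))
        ≤ p.1 ^ (α - 1) * (‖F p.2‖ * ((√p.1)⁻¹ * ‖H p.2‖)) := by
          gcongr
          exact norm_heatDerivSymbol_le hp.1 p.2
      _ = _ := by ring
  have hinner : ∀ s : ℝ, ∫ ξ, Φ (s, ξ) = ((s ^ (α - 1) : ℝ) : ℂ)
      * ∫ ξ, conj (F ξ) * (heatDerivSymbol s ξ * H ξ) := fun s => by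
    rw [← integral_const_mul]
  have h1 := hinteg.integral_prod_left
  simp only [hinner] at h1
  refine ⟨h1, ?_⟩
  have hswap := integral_integral_swap (f := fun s ξ => Φ (s, ξ)) hinteg
  simp only [hinner] at hswap
  rw [hswap, ← integral_const_mul]
  refine integral_congr_ae (.of_forall fun ξ => ?_)
  have e : ∀ s : ℝ, Φ (s, ξ) = ((s ^ (α - 1) * heatSymbol s ξ : ℝ) : ℂ)
      * (conj (F ξ) * (derivSymbol 0 ξ * H ξ)) := fun s => by
    simp only [hΦ, heatDerivSymbol]; push_cast; ring
  simp only [e]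
  rw [integral_mul_const, integral_complex_ofReal, highSymbol, truncSymbol]
  push_cast; ring

variable {α : ℝ}

/-! ### The commutator of the truncated operator with the transport -/

/-- The pairing of `F` with the truncated operator applied to `f`. -/
def highPairing (α : ℝ) (F f : Plane → ℝ) : ℂ :=
  ∫ ξ, conj (planeFourier F ξ) * (highSymbol α ξ * planeFourier f ξ)

/-- The constant in the commutator estimate. -/
def commutatorConst (α : ℝ) : ℝ := (Real.Gamma α)⁻¹ * (α - 1 / 2)⁻¹ * 16

lemma commutatorConst_pos (hα : α ∈ Ioo (1 / 2 : ℝ) 1) : 0 < commutatorConst α := by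
  have h1 : 0 < α - 1 / 2 := by linarith [hα.1]
  have h2 := Real.Gamma_pos_of_pos (by linarith : 0 < α)
  unfold commutatorConst; positivity

lemma integral_sub_add {X : Type*} [MeasurableSpace X] {μ : Measure X} {f g h : X → ℂ}
    (hf : Integrable f μ) (hg : Integrable g μ) (hh : Integrable h μ) :
    ∫ x, (f x - (g x + h x)) ∂μ = (∫ x, f x ∂μ) - ((∫ x, g x ∂μ) + ∫ x, h x ∂μ) := by
  rw [← integral_add hg hh]
  exact integral_sub hf (hg.add hh)

/-- The three pairings are superposed together before taking norms, because only their combination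
has the `s^{-1/2}` bound without derivatives on `θ`. The factor `(α - 1/2)⁻¹` is `∫₀¹ s^{α-3/2} ds`.
-/
lemma norm_high_commutator_le (hα : α ∈ Ioo (1 / 2 : ℝ) 1) {u : Fin 2 → Plane → ℝ}
    {θ G : Plane → ℝ} (hu : ∀ j, IsSob (u j)) (hθ : IsSob θ)
    (hdiv : ∀ x, pd 0 (u 0) x + pd 1 (u 1) x = 0) {M : ℝ} (hM : ∀ x, |θ x| ≤ M)
    (hG : MemLp G 2) :
    ‖highPairing α G (advect u θ) - (highPairing α (fun x => u 0 x * G x) (pd 0 θ)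
        + highPairing α (fun x => u 1 x * G x) (pd 1 θ))‖
      ≤ commutatorConst α * M * ‖toL2 G‖ * gradNorm u := by
  have hΓ := Real.Gamma_pos_of_pos (by linarith [hα.1] : 0 < α)
  have hmul : ∀ j, MemLp (fun x => u j x * G x) 2 := fun j => by
    obtain ⟨B, hB⟩ := (hu j).bounded
    exact memLp_bdd_mul hG (hu j).continuous hB
  have hadv : MemLp (advect u θ) 2 := memLp_advect hu fun j => (hθ.pd j).memLp
  obtain ⟨iA, eA⟩ := highSymbol_superposition hα (memLp_planeFourier hG) (memLp_planeFourier hadv)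
  obtain ⟨i0, e0⟩ := highSymbol_superposition hα (memLp_planeFourier (hmul 0))
    (memLp_planeFourier (hθ.pd 0).memLp)
  obtain ⟨i1, e1⟩ := highSymbol_superposition hα (memLp_planeFourier (hmul 1))
    (memLp_planeFourier (hθ.pd 1).memLp)
  rw [highPairing, highPairing, highPairing, eA, e0, e1, ← mul_add, ← mul_sub, 
    ← integral_sub_add iA i0 i1, norm_mul, Complex.norm_real,
    Real.norm_of_nonneg (by positivity)]
  have hb := integrableOn_rpow_Ioc (a := α - 3 / 2) (by linarith [hα.1])
  have hle := norm_integral_le_of_norm_le (μ := volume.restrict (Ioc (0 : ℝ) 1))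
    (f := fun s : ℝ => ((s ^ (α - 1) : ℝ) : ℂ)
        * (∫ ξ, conj (planeFourier G ξ) * (heatDerivSymbol s ξ * planeFourier (advect u θ) ξ))
      - (((s ^ (α - 1) : ℝ) : ℂ) * (∫ ξ, conj (planeFourier (fun x => u 0 x * G x) ξ)
          * (heatDerivSymbol s ξ * planeFourier (pd 0 θ) ξ))
        + ((s ^ (α - 1) : ℝ) : ℂ) * ∫ ξ, conj (planeFourier (fun x => u 1 x * G x) ξ)
          * (heatDerivSymbol s ξ * planeFourier (pd 1 θ) ξ)))
    (hb.mul_const (16 * M * ‖toL2 G‖ * gradNorm u)) (by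
      filter_upwards [ae_restrict_mem measurableSet_Ioc] with s hs
      rw [← mul_add, ← mul_sub, ← integral_mul_heatDeriv hs.1 hadv hG,
        ← integral_mul_heatDeriv hs.1 (hθ.pd 0).memLp (hmul 0),
        ← integral_mul_heatDeriv hs.1 (hθ.pd 1).memLp (hmul 1), ← Complex.ofReal_add,
        ← Complex.ofReal_sub, ← Complex.ofReal_mul, Complex.norm_real, norm_mul,
        Real.norm_of_nonneg (Real.rpow_nonneg hs.1.le _)]
      have h1 : s ^ (α - 3 / 2) = s ^ (α - 1) * (√s)⁻¹ := by
        rw [Real.sqrt_eq_rpow, ← Real.rpow_neg hs.1.le, ← Real.rpow_add hs.1]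
        congr 1; ring
      rw [h1, mul_assoc]
      exact mul_le_mul_of_nonneg_left (abs_heatCommutator_le hs.1 hu hθ hdiv hM hG)
        (Real.rpow_nonneg hs.1.le _))
  rw [integral_mul_const, integral_rpow_Ioc (by linarith [hα.1])] at hle
  refine (mul_le_mul_of_nonneg_left hle (by positivity)).trans (le_of_eq ?_)
  rw [commutatorConst, show α - 3 / 2 + 1 = α - 1 / 2 by ring]
  ring

/-! ### Bounded Fourier multipliers on `L²` -/

lemma memLp_mul_of_bound {m : Plane → ℂ} (hm : AEStronglyMeasurable m volume) {C : ℝ}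
    (hC : ∀ ξ, ‖m ξ‖ ≤ C) {F : Plane → ℂ} (hF : MemLp F 2) : MemLp (fun ξ => m ξ * F ξ) 2 := by
  refine (hF.const_mul (C : ℂ)).of_le (hm.mul hF.aestronglyMeasurable) (.of_forall fun ξ => ?_)
  have hC0 : 0 ≤ C := (norm_nonneg _).trans (hC ξ)
  rw [norm_mul, norm_mul, Complex.norm_real, Real.norm_of_nonneg hC0]
  gcongr
  exact hC ξ

/-- Multiplication by a bounded function on `L²`. -/
def mulL2 (m : Plane → ℂ) (hm : AEStronglyMeasurable m volume) (C : ℝ) (hC : ∀ ξ, ‖m ξ‖ ≤ C) :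
    L2C →L[ℂ] L2C :=
  LinearMap.mkContinuous
    { toFun := fun F => (memLp_mul_of_bound hm hC (Lp.memLp F)).toLp _
      map_add' := fun F G => by
        refine Lp.ext ?_
        filter_upwards [MemLp.coeFn_toLp (memLp_mul_of_bound hm hC (Lp.memLp (F + G))),
          MemLp.coeFn_toLp (memLp_mul_of_bound hm hC (Lp.memLp F)),
          MemLp.coeFn_toLp (memLp_mul_of_bound hm hC (Lp.memLp G)), Lp.coeFn_add F G,
          Lp.coeFn_add ((memLp_mul_of_bound hm hC (Lp.memLp F)).toLp _)
            ((memLp_mul_of_bound hm hC (Lp.memLp G)).toLp _)] with ξ h1 h2 h3 h4 h5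
        rw [h1, h5, Pi.add_apply, h2, h3, h4, Pi.add_apply, mul_add]
      map_smul' := fun c F => by
        refine Lp.ext ?_
        filter_upwards [MemLp.coeFn_toLp (memLp_mul_of_bound hm hC (Lp.memLp (c • F))),
          MemLp.coeFn_toLp (memLp_mul_of_bound hm hC (Lp.memLp F)), Lp.coeFn_smul c F,
          Lp.coeFn_smul c ((memLp_mul_of_bound hm hC (Lp.memLp F)).toLp _)] with ξ h1 h2 h3 h4
        rw [RingHom.id_apply, h1, h4, Pi.smul_apply, h2, h3, Pi.smul_apply, smul_eq_mul,
          smul_eq_mul]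
        ring } C fun F => by
    have hC0 : 0 ≤ C := (norm_nonneg _).trans (hC 0)
    refine Lp.norm_le_mul_norm_of_ae_le_mul ?_
    filter_upwards [MemLp.coeFn_toLp (memLp_mul_of_bound hm hC (Lp.memLp F))] with ξ h1
    simp only [LinearMap.coe_mk, AddHom.coe_mk]
    rw [h1, norm_mul]
    gcongr
    exact hC ξ

lemma mulL2_coeFn {m : Plane → ℂ} (hm : AEStronglyMeasurable m volume) {C : ℝ}
    (hC : ∀ ξ, ‖m ξ‖ ≤ C) (F : L2C) : ⇑(mulL2 m hm C hC F) =ᵐ[volume] fun ξ => m ξ * F ξ :=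
  MemLp.coeFn_toLp (memLp_mul_of_bound hm hC (Lp.memLp F))

/-- The truncated operator on `L²`. -/
def highOp (hα : α ∈ Ioo (1 / 2 : ℝ) 1) : L2C →L[ℂ] L2C :=
  ((Lp.fourierTransformₗᵢ Plane ℂ).symm.toContinuousLinearEquiv : L2C →L[ℂ] L2C) ∘L
    mulL2 (highSymbol α) aestronglyMeasurable_highSymbol _ (norm_highSymbol_le hα) ∘L
    ((Lp.fourierTransformₗᵢ Plane ℂ).toContinuousLinearEquiv : L2C →L[ℂ] L2C)

lemma fourier_highOp (hα : α ∈ Ioo (1 / 2 : ℝ) 1) (F : L2C) :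
    ⇑(𝓕 (highOp hα F) : L2C) =ᵐ[volume] fun ξ => highSymbol α ξ * (𝓕 F : L2C) ξ := by
  have e : (𝓕 (highOp hα F) : L2C)
      = mulL2 (highSymbol α) aestronglyMeasurable_highSymbol _ (norm_highSymbol_le hα) (𝓕 F) :=
    (Lp.fourierTransformₗᵢ Plane ℂ).apply_symm_apply _
  rw [e]
  exact mulL2_coeFn _ _ _

lemma norm_highOp_apply_le (hα : α ∈ Ioo (1 / 2 : ℝ) 1) (F : L2C) :
    ‖highOp hα F‖ ≤ ((Real.Gamma α)⁻¹ * α⁻¹ + 1) * ‖F‖ := by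
  rw [← Lp.norm_fourier_eq (highOp hα F), ← Lp.norm_fourier_eq F]
  refine Lp.norm_le_mul_norm_of_ae_le_mul ?_
  filter_upwards [fourier_highOp hα F] with ξ h
  rw [h, norm_mul]
  gcongr
  exact norm_highSymbol_le hα ξ

lemma inner_highOp (hα : α ∈ Ioo (1 / 2 : ℝ) 1) {F f : Plane → ℝ} (hF : MemLp F 2)
    (hf : MemLp f 2) : inner ℂ (toL2 F) (highOp hα (toL2 f)) = highPairing α F f := by
  rw [← Lp.inner_fourier_eq, inner_L2C, highPairing, planeFourier_eq hF, planeFourier_eq hf]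
  refine integral_congr_ae ?_
  filter_upwards [fourier_highOp hα (toL2 f)] with ξ h
  rw [h]

/-- The truncated operator acting on functions. -/
def highFun (α : ℝ) (f : Plane → ℝ) : Plane → ℝ := fourierMultiplier (highSymbol α) f

lemma fourierMultiplier_sob {m : Plane → ℂ} (hm : AEStronglyMeasurable m volume)
    (hneg : ∀ ξ, m (-ξ) = conj (m ξ)) {C : ℝ} {n : ℕ} (h : ∀ ξ, ‖m ξ‖ ≤ C * bracket ξ ^ n)
    {f : Plane → ℝ} (hf : IsSob f) :
    ContDiff ℝ 1 (fourierMultiplier m f) ∧ MemLp (fourierMultiplier m f) 2 ∧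
      planeFourier (fourierMultiplier m f) =ᵐ[volume] (fun ξ => m ξ * planeFourier f ξ) ∧
      ∀ j, pd j (fourierMultiplier m f) = fourierMultiplier m (pd j f) := by
  have hi := hf.integrable_mul hm h
  have h2 := hf.memLp_mul hm h
  have hL := fourierMultiplier_L2 hf.memLp hneg hi h2
  have hi' : Integrable fun ξ => ‖ξ‖ * ‖m ξ * planeFourier f ξ‖ := by
    have := hf.integrable_mul (m := fun ξ => (‖ξ‖ : ℂ) * m ξ) (C := C) (n := n + 1)
      ((by fun_prop : Continuous fun ξ : Plane => (‖ξ‖ : ℂ)).aestronglyMeasurable.mul hm)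
      (fun ξ => by
        have h1 : ‖ξ‖ ≤ bracket ξ := by
          refine le_trans ?_ (norm_le_bracket ξ)
          nlinarith [norm_nonneg ξ, Real.pi_gt_three]
        rw [norm_mul, Complex.norm_real, norm_norm, pow_succ, mul_comm, ← mul_assoc]
        exact mul_le_mul (h ξ) h1 (norm_nonneg _) ((norm_nonneg _).trans (h ξ)))
    refine this.norm.congr (.of_forall fun ξ => ?_)
    simp [mul_assoc]
  have hP := pd_fourierMultiplier hf.differentiable hf.memLp (fun j => (hf.pd j).memLp) hi hi'
  exact ⟨hP.1, hL.1, hL.2, hP.2⟩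

lemma highFun_sob (hα : α ∈ Ioo (1 / 2 : ℝ) 1) {f : Plane → ℝ} (hf : IsSob f) :
    ContDiff ℝ 1 (highFun α f) ∧ MemLp (highFun α f) 2 ∧
      planeFourier (highFun α f) =ᵐ[volume] (fun ξ => highSymbol α ξ * planeFourier f ξ) ∧
      ∀ j, pd j (highFun α f) = highFun α (pd j f) :=
  fourierMultiplier_sob aestronglyMeasurable_highSymbol highSymbol_neg
    (C := (Real.Gamma α)⁻¹ * α⁻¹ + 1) (n := 0) (by simpa using norm_highSymbol_le hα) hf

/-- Both realisations of `K` are used: `highFun` for functions in all Sobolev spaces, where it can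
be differentiated pointwise, and `highOp` for general `L²` classes such as that of `u·∇θ`. -/
lemma toL2_highFun (hα : α ∈ Ioo (1 / 2 : ℝ) 1) {f : Plane → ℝ} (hf : IsSob f) :
    toL2 (highFun α f) = highOp hα (toL2 f) := by
  have h := highFun_sob hα hf
  apply (Lp.fourierTransformₗᵢ Plane ℂ).injective
  change (𝓕 (toL2 (highFun α f)) : L2C) = 𝓕 (highOp hα (toL2 f))
  refine Lp.ext ?_
  rw [← planeFourier_eq h.2.1]
  filter_upwards [h.2.2.1, fourier_highOp hα (toL2 f)] with ξ h1 h2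
  rw [h1, h2, planeFourier_eq hf.memLp]

lemma freq_rpow_le_bracket {a : ℝ} (ha0 : 0 ≤ a) (ha : a ≤ 2) (ξ : Plane) :
    freq ξ ^ a ≤ bracket ξ := by
  have hR := freq_nonneg ξ
  have hb : bracket ξ = 1 + freq ξ ^ 2 := rfl
  rcases le_total (freq ξ) 1 with h | h
  · have := Real.rpow_le_one hR h ha0
    rw [hb]; nlinarith
  · have : freq ξ ^ a ≤ freq ξ ^ (2 : ℝ) := Real.rpow_le_rpow_of_exponent_le h ha
    rw [Real.rpow_two] at this
    rw [hb]; linarith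

lemma fracLambda_sob {a : ℝ} (ha0 : 0 ≤ a) (ha : a ≤ 2) {f : Plane → ℝ} (hf : IsSob f) :
    ContDiff ℝ 1 (fracLambda a f) ∧ MemLp (fracLambda a f) 2 ∧
      planeFourier (fracLambda a f) =ᵐ[volume]
        (fun ξ => ((freq ξ ^ a : ℝ) : ℂ) * planeFourier f ξ) ∧
      ∀ j, pd j (fracLambda a f) = fracLambda a (pd j f) := by
  refine fourierMultiplier_sob (m := fun ξ => ((freq ξ ^ a : ℝ) : ℂ)) (C := 1) (n := 1) ?_ ?_ ?_ hf
  · exact (Complex.continuous_ofReal.comp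
      (continuous_freq.rpow_const fun _ => Or.inr ha0)).aestronglyMeasurable
  · intro ξ; simp [freq]
  · intro ξ
    rw [Complex.norm_real, Real.norm_of_nonneg (Real.rpow_nonneg (freq_nonneg ξ) _)]
    simpa using freq_rpow_le_bracket ha0 ha ξ

variable {α : ℝ}

/-! ### Vorticity -/

/-- The vorticity `∂₁u₂ - ∂₂u₁` of a vector field with the components `u 0`, `u 1`. -/
def vort (u : Fin 2 → Plane → ℝ) (x : Plane) : ℝ := pd 0 (u 1) x - pd 1 (u 0) x

lemma IsSob.vort {u : Fin 2 → Plane → ℝ} (hu : ∀ j, IsSob (u j)) : IsSob (vort u) :=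
  ((hu 1).pd 0).sub ((hu 0).pd 1)

lemma planeFourier_div {u : Fin 2 → Plane → ℝ} (hu : ∀ j, IsSob (u j))
    (hdiv : ∀ x, pd 0 (u 0) x + pd 1 (u 1) x = 0) :
    ∀ᵐ ξ, derivSymbol 0 ξ * planeFourier (u 0) ξ + derivSymbol 1 ξ * planeFourier (u 1) ξ = 0 := by
  have h := planeFourier_add ((hu 0).pd 0).memLp ((hu 1).pd 1).memLp
  have e : (fun x => pd 0 (u 0) x + pd 1 (u 1) x) = fun _ => (0 : ℝ) := funext hdiv
  have hz : planeFourier (fun _ => (0 : ℝ)) =ᵐ[volume] fun _ => 0 :=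
    planeFourier_ae_eq (MemLp.zero' (p := 2)) (locallyIntegrable_const 0) (by simp)
  rw [e] at h
  filter_upwards [h, hz, (hu 0).planeFourier_pd 0, (hu 1).planeFourier_pd 1] with ξ h1 h2 h3 h4
  rw [← h3, ← h4, ← h1, h2]

/-- The Biot–Savart law at one frequency: for a divergence free field `D₀W = -(a²+b²)U₁` and `D₁W =
(a²+b²)U₀`, so `(a²+b²)|U| ≤ √(a²+b²)|W|`, while `|D| ≤ √(a²+b²)`. -/
lemma norm_symbol_mul_le {a b : ℝ} {D₀ D₁ U₀ U₁ W D U : ℂ} (h₀ : D₀ = Complex.I * a)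
    (h₁ : D₁ = Complex.I * b) (hdiv : D₀ * U₀ + D₁ * U₁ = 0) (hW : W = D₀ * U₁ - D₁ * U₀)
    (hD : D = D₀ ∨ D = D₁) (hU : U = U₀ ∨ U = U₁) : ‖D * U‖ ≤ ‖W‖ := by
  have na : ‖D₀‖ = |a| := by rw [h₀]; simp
  have nb : ‖D₁‖ = |b| := by rw [h₁]; simp
  have hD' : ‖D‖ ≤ √(a ^ 2 + b ^ 2) := by
    rcases hD with rfl | rfl
    · rw [na]; exact Real.abs_le_sqrt (by nlinarith)
    · rw [nb]; exact Real.abs_le_sqrt (by nlinarith)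
  have e1 : D₀ * W = -((a ^ 2 + b ^ 2 : ℝ) : ℂ) * U₁ := by
    rw [hW]
    have : D₀ * U₀ = -(D₁ * U₁) := eq_neg_of_add_eq_zero_left hdiv
    calc D₀ * (D₀ * U₁ - D₁ * U₀) = D₀ ^ 2 * U₁ - D₁ * (D₀ * U₀) := by ring
      _ = (D₀ ^ 2 + D₁ ^ 2) * U₁ := by rw [this]; ring
      _ = _ := by
        rw [h₀, h₁, mul_pow, mul_pow, Complex.I_sq]; push_cast; ring
  have e0 : D₁ * W = ((a ^ 2 + b ^ 2 : ℝ) : ℂ) * U₀ := by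
    rw [hW]
    have : D₁ * U₁ = -(D₀ * U₀) := eq_neg_of_add_eq_zero_right hdiv
    calc D₁ * (D₀ * U₁ - D₁ * U₀) = D₀ * (D₁ * U₁) - D₁ ^ 2 * U₀ := by ring
      _ = -((D₀ ^ 2 + D₁ ^ 2) * U₀) := by rw [this]; ring
      _ = _ := by
        rw [h₀, h₁, mul_pow, mul_pow, Complex.I_sq]; push_cast; ring
  set S := a ^ 2 + b ^ 2 with hS
  have hS0 : 0 ≤ S := by positivity
  have hSU : S * ‖U‖ ≤ √S * ‖W‖ := by
    have k1 : S * ‖U₁‖ ≤ √S * ‖W‖ := by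
      have := congrArg norm e1
      rw [norm_mul, norm_mul, norm_neg, Complex.norm_real, Real.norm_of_nonneg hS0, na] at this
      rw [← this]
      gcongr
      exact Real.abs_le_sqrt (by nlinarith)
    have k0 : S * ‖U₀‖ ≤ √S * ‖W‖ := by
      have := congrArg norm e0
      rw [norm_mul, norm_mul, Complex.norm_real, Real.norm_of_nonneg hS0, nb] at this
      rw [← this]
      gcongr
      exact Real.abs_le_sqrt (by nlinarith)
    rcases hU with rfl | rfl
    · exact k0
    · exact k1
  rw [norm_mul]
  rcases hS0.eq_or_lt with h | h
  · rw [← h, Real.sqrt_zero] at hD'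
    have : ‖D‖ = 0 := le_antisymm hD' (norm_nonneg _)
    rw [this, zero_mul]; exact norm_nonneg _
  · refine le_of_mul_le_mul_left ?_ h
    calc S * (‖D‖ * ‖U‖) = ‖D‖ * (S * ‖U‖) := by ring
      _ ≤ √S * (√S * ‖W‖) := by gcongr
      _ = S * ‖W‖ := by rw [← mul_assoc, Real.mul_self_sqrt hS0]

lemma norm_pd_le_vort {u : Fin 2 → Plane → ℝ} (hu : ∀ j, IsSob (u j))
    (hdiv : ∀ x, pd 0 (u 0) x + pd 1 (u 1) x = 0) (j i : Fin 2) :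
    ‖toL2 (pd j (u i))‖ ≤ ‖toL2 (vort u)‖ := by
  have hv := IsSob.vort hu
  have hp := (hu i).pd j
  rw [← Lp.norm_fourier_eq (toL2 (pd j (u i))), ← Lp.norm_fourier_eq (toL2 (vort u))]
  refine Lp.norm_le_norm_of_ae_le ?_
  rw [← planeFourier_eq hp.memLp, ← planeFourier_eq hv.memLp]
  filter_upwards [planeFourier_div hu hdiv, (hu i).planeFourier_pd j, (hu 1).planeFourier_pd 0,
    (hu 0).planeFourier_pd 1, planeFourier_sub ((hu 1).pd 0).memLp ((hu 0).pd 1).memLp]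
    with ξ h1 h2 h3 h4 h5
  rw [h2]
  have e : ∀ k, derivSymbol k ξ = Complex.I * ((2 * Real.pi * ξ k : ℝ) : ℂ) := fun k => by
    rw [derivSymbol]; push_cast; ring
  refine norm_symbol_mul_le (e 0) (e 1) h1 (h5.trans (by rw [h3, h4])) ?_ ?_
  · fin_cases j <;> simp
  · fin_cases i <;> simp

lemma gradNorm_le_vort {u : Fin 2 → Plane → ℝ} (hu : ∀ j, IsSob (u j))
    (hdiv : ∀ x, pd 0 (u 0) x + pd 1 (u 1) x = 0) : gradNorm u ≤ 4 * ‖toL2 (vort u)‖ := by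
  have h := norm_pd_le_vort hu hdiv
  rw [gradNorm]
  linarith [h 0 0, h 1 0, h 0 1, h 1 1]

/-! ### The energy identity for the transport -/

/-- The integral equals `-½ ∫ (div u) g²`. Only first derivatives of `g` enter, since the modified
vorticity is known merely to be `C¹`. -/
lemma integral_mul_advect_self {u : Fin 2 → Plane → ℝ} (hu : ∀ j, IsSob (u j))
    (hdiv : ∀ x, pd 0 (u 0) x + pd 1 (u 1) x = 0) {g : Plane → ℝ} (hd : Differentiable ℝ g)
    (hg : MemLp g 2) (hg' : ∀ j, MemLp (pd j g) 2) : ∫ x, g x * advect u g x = 0 := by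
  have key : ∀ j, Integrable (fun x => (u j x * g x) * pd j g x) ∧
      Integrable (fun x => (pd j (u j) x * g x) * g x) ∧
      2 * ∫ x, (u j x * g x) * pd j g x = - ∫ x, (pd j (u j) x * g x) * g x := by
    intro j
    obtain ⟨B, hB⟩ := (hu j).bounded
    obtain ⟨B', hB'⟩ := ((hu j).pd j).bounded
    have m1 : MemLp (fun x => u j x * g x) 2 := memLp_bdd_mul hg (hu j).continuous hB
    have m2 : MemLp (fun x => pd j (u j) x * g x) 2 := memLp_bdd_mul hg ((hu j).pd j).continuous hB'
    have m3 : MemLp (fun x => u j x * pd j g x) 2 := memLp_bdd_mul (hg' j) (hu j).continuous hB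
    have e : pd j (fun x => u j x * g x) = fun x => pd j (u j) x * g x + u j x * pd j g x :=
      funext fun x => pd_mul (hu j).differentiable hd j x
    have i1 := integrable_mul_of_memLp m1 (hg' j)
    have i2 := integrable_mul_of_memLp m2 hg
    have ibp := integral_mul_pd j ((hu j).differentiable.fun_mul hd) hd m1
      (by rw [e]; exact m2.add m3) hg (hg' j)
    rw [e] at ibp
    have h : ∫ x, (pd j (u j) x * g x + u j x * pd j g x) * g x
        = (∫ x, (pd j (u j) x * g x) * g x) + ∫ x, (u j x * g x) * pd j g x := by
      rw [← integral_add i2 i1]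
      refine integral_congr_ae (.of_forall fun x => ?_)
      ring
    rw [h] at ibp
    exact ⟨i1, i2, by linarith⟩
  obtain ⟨a0, b0, c0⟩ := key 0
  obtain ⟨a1, b1, c1⟩ := key 1
  have h1 : ∫ x, g x * advect u g x
      = (∫ x, (u 0 x * g x) * pd 0 g x) + ∫ x, (u 1 x * g x) * pd 1 g x := by
    rw [← integral_add a0 a1]
    refine integral_congr_ae (.of_forall fun x => ?_)
    simp only [advect]; ring
  have h2 : (∫ x, (pd 0 (u 0) x * g x) * g x) + ∫ x, (pd 1 (u 1) x * g x) * g x = 0 := by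
    rw [← integral_add b0 b1]
    simp only [← add_mul, hdiv, zero_mul, integral_zero]
  rw [h1]; linarith

/-! ### The energy estimate at a fixed time -/

/-- The modified vorticity `ω - Kθ`, with the truncated operator `K`. -/
def goodVort (α : ℝ) (u : Fin 2 → Plane → ℝ) (θ : Plane → ℝ) (x : Plane) : ℝ :=
  vort u x - highFun α θ x

/-- The right-hand side of the vorticity equation. -/
def vortRHS (α : ℝ) (u : Fin 2 → Plane → ℝ) (θ : Plane → ℝ) (x : Plane) : ℝ :=
  (pd 0 θ x - fracLambda (2 * α) (vort u) x) - advect u (vort u) x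

/-- The squared dissipation norm `∫ |2πξ|^{2α} |f̂|²`. -/
def dissipation (α : ℝ) (f : Plane → ℝ) : ℝ :=
  ∫ ξ, freq ξ ^ (2 * α) * ‖planeFourier f ξ‖ ^ 2

section Fixed

variable {u : Fin 2 → Plane → ℝ} {θ : Plane → ℝ}

lemma goodVort_differentiable (hα : α ∈ Ioo (1 / 2 : ℝ) 1) (hu : ∀ j, IsSob (u j))
    (hθ : IsSob θ) : Differentiable ℝ (goodVort α u θ) :=
  (IsSob.vort hu).differentiable.sub ((highFun_sob hα hθ).1.differentiable (by norm_num))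

lemma memLp_goodVort (hα : α ∈ Ioo (1 / 2 : ℝ) 1) (hu : ∀ j, IsSob (u j)) (hθ : IsSob θ) :
    MemLp (goodVort α u θ) 2 := (IsSob.vort hu).memLp.sub (highFun_sob hα hθ).2.1

lemma toL2_goodVort (hα : α ∈ Ioo (1 / 2 : ℝ) 1) (hu : ∀ j, IsSob (u j)) (hθ : IsSob θ) :
    toL2 (goodVort α u θ) = toL2 (vort u) - highOp hα (toL2 θ) := by
  rw [← toL2_highFun hα hθ]
  exact toL2_sub (IsSob.vort hu).memLp (highFun_sob hα hθ).2.1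

lemma pd_goodVort (hα : α ∈ Ioo (1 / 2 : ℝ) 1) (hu : ∀ j, IsSob (u j)) (hθ : IsSob θ)
    (j : Fin 2) : pd j (goodVort α u θ) = fun x => pd j (vort u) x - highFun α (pd j θ) x := by
  funext x
  have h : HasFDerivAt (goodVort α u θ) _ x :=
    ((IsSob.vort hu).differentiable x).hasFDerivAt.sub
      ((highFun_sob hα hθ).1.differentiable (by norm_num) x).hasFDerivAt
  rw [← (highFun_sob hα hθ).2.2.2 j, pd, h.fderiv]
  rfl

lemma planeFourier_goodVort (hα : α ∈ Ioo (1 / 2 : ℝ) 1) (hu : ∀ j, IsSob (u j))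
    (hθ : IsSob θ) : planeFourier (goodVort α u θ) =ᵐ[volume]
      fun ξ => planeFourier (vort u) ξ - highSymbol α ξ * planeFourier θ ξ := by
  filter_upwards [planeFourier_sub (IsSob.vort hu).memLp (highFun_sob hα hθ).2.1,
    (highFun_sob hα hθ).2.2.1] with ξ h1 h2
  exact h1.trans (by rw [h2])

lemma memLp_rpow_mul_planeFourier_goodVort (hα : α ∈ Ioo (1 / 2 : ℝ) 1) (hu : ∀ j, IsSob (u j))
    (hθ : IsSob θ) {a : ℝ} (ha0 : 0 ≤ a) (ha : a ≤ 2) :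
    MemLp (fun ξ => ((freq ξ ^ a : ℝ) : ℂ) * planeFourier (goodVort α u θ) ξ) 2 := by
  have hm : AEStronglyMeasurable (fun ξ => ((freq ξ ^ a : ℝ) : ℂ)) volume :=
    (Complex.continuous_ofReal.comp
      (continuous_freq.rpow_const fun _ => Or.inr ha0)).aestronglyMeasurable
  have hb : ∀ ξ, ‖((freq ξ ^ a : ℝ) : ℂ)‖ ≤ bracket ξ := fun ξ => by
    rw [Complex.norm_real, Real.norm_of_nonneg (Real.rpow_nonneg (freq_nonneg ξ) _)]
    exact freq_rpow_le_bracket ha0 ha ξ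
  have h1 : MemLp (fun ξ => ((freq ξ ^ a : ℝ) : ℂ) * planeFourier (vort u) ξ) 2 :=
    (IsSob.vort hu).memLp_mul hm (C := 1) (n := 1) (by simpa using hb)
  have h2 : MemLp (fun ξ => (((freq ξ ^ a : ℝ) : ℂ) * highSymbol α ξ) * planeFourier θ ξ) 2 := by
    refine hθ.memLp_mul (hm.mul aestronglyMeasurable_highSymbol)
      (C := (Real.Gamma α)⁻¹ * α⁻¹ + 1) (n := 1) fun ξ => ?_
    rw [norm_mul, pow_one, mul_comm]
    exact mul_le_mul (norm_highSymbol_le hα ξ) (hb ξ) (norm_nonneg _)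
      ((norm_nonneg _).trans (norm_highSymbol_le hα ξ))
  refine (memLp_congr_ae ?_).1 (h1.sub h2)
  filter_upwards [planeFourier_goodVort hα hu hθ] with ξ h
  rw [h, Pi.sub_apply]; ring

lemma memLp_vortRHS (hα : α ∈ Ioo (1 / 2 : ℝ) 1) (hu : ∀ j, IsSob (u j)) (hθ : IsSob θ) :
    MemLp (vortRHS α u θ) 2 :=
  ((hθ.pd 0).memLp.sub (fracLambda_sob (by linarith [hα.1]) (by linarith [hα.2])
    (IsSob.vort hu)).2.1).sub (memLp_advect hu fun j => ((IsSob.vort hu).pd j).memLp)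

lemma integral_norm_planeFourier_mul_le {f g : Plane → ℝ} (hf : MemLp f 2) (hg : MemLp g 2) :
    ∫ ξ, ‖planeFourier f ξ‖ * ‖planeFourier g ξ‖ ≤ ‖toL2 f‖ * ‖toL2 g‖ := by
  rw [← Lp.norm_fourier_eq (toL2 f), ← Lp.norm_fourier_eq (toL2 g), planeFourier_eq hf,
    planeFourier_eq hg]
  exact integral_norm_mul_norm_le _ _

/-- The linear part of the energy estimate: the dissipation absorbs the buoyancy. -/
lemma integral_goodVort_linear_le (hα : α ∈ Ioo (1 / 2 : ℝ) 1) (hu : ∀ j, IsSob (u j))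
    (hθ : IsSob θ) :
    ∫ x, goodVort α u θ x * (pd 0 θ x - fracLambda (2 * α) (vort u) x)
      ≤ - dissipation α (goodVort α u θ)
        + (1 + (Real.Gamma α)⁻¹) * (‖toL2 (goodVort α u θ)‖ * ‖toL2 θ‖) := by
  have ha0 : 0 ≤ 2 * α := by linarith [hα.1]
  have ha2 : 2 * α ≤ 2 := by linarith [hα.2]
  have mG := memLp_goodVort hα hu hθ
  have hΛ := fracLambda_sob ha0 ha2 (IsSob.vort hu)
  have mR : MemLp (fun x => pd 0 θ x - fracLambda (2 * α) (vort u) x) 2 :=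
    (hθ.pd 0).memLp.sub hΛ.2.1
  have mw := memLp_rpow_mul_planeFourier_goodVort hα hu hθ ha0 ha2
  set Gh := planeFourier (goodVort α u θ) with hGh
  have mGh : MemLp Gh 2 := memLp_planeFourier mG
  set E : Plane → ℂ := fun ξ => (derivSymbol 0 ξ - ((freq ξ ^ (2 * α) : ℝ) : ℂ) * highSymbol α ξ)
    with hE
  have hEm : AEStronglyMeasurable E volume :=
    (continuous_derivSymbol 0).aestronglyMeasurable.sub
      ((Complex.continuous_ofReal.comp
        (continuous_freq.rpow_const fun _ => Or.inr ha0)).aestronglyMeasurable.mul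
        aestronglyMeasurable_highSymbol)
  have hEb : ∀ ξ, ‖E ξ‖ ≤ 1 + (Real.Gamma α)⁻¹ := norm_derivSymbol_sub_highSymbol_le hα
  have mEθ : MemLp (fun ξ => E ξ * planeFourier θ ξ) 2 :=
    memLp_mul_of_bound hEm hEb (memLp_planeFourier hθ.memLp)
  have i1 : Integrable fun ξ => conj (Gh ξ) * (((freq ξ ^ (2 * α) : ℝ) : ℂ) * Gh ξ) :=
    mGh.star.integrable_mul mw
  have i2 : Integrable fun ξ => conj (Gh ξ) * (E ξ * planeFourier θ ξ) :=
    mGh.star.integrable_mul mEθ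
  -- Substituting `ω = G + Kθ` gives `∂₁θ - Λ^{2α}ω = -Λ^{2α}G + (∂₁ - Λ^{2α}K)θ`: dissipation plus
  -- the bounded symbol `E` acting on `θ`.
  have e1 : ((∫ x, goodVort α u θ x * (pd 0 θ x - fracLambda (2 * α) (vort u) x) : ℝ) : ℂ)
      = -(∫ ξ, conj (Gh ξ) * (((freq ξ ^ (2 * α) : ℝ) : ℂ) * Gh ξ))
        + ∫ ξ, conj (Gh ξ) * (E ξ * planeFourier θ ξ) := by
    rw [inner_toL2_eq_fourier mG mR, neg_add_eq_sub, ← integral_sub i2 i1]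
    refine integral_congr_ae ?_
    filter_upwards [planeFourier_goodVort hα hu hθ, planeFourier_sub (hθ.pd 0).memLp hΛ.2.1,
      hΛ.2.2.1, hθ.planeFourier_pd 0] with ξ h1 h2 h3 h4
    have h5 : planeFourier (vort u) ξ = Gh ξ + highSymbol α ξ * planeFourier θ ξ := by
      rw [hGh, h1]; ring
    rw [h2, h3, h4, h5, hE]
    ring
  have e2 : ∫ ξ, conj (Gh ξ) * (((freq ξ ^ (2 * α) : ℝ) : ℂ) * Gh ξ)
      = (dissipation α (goodVort α u θ) : ℂ) := by
    rw [dissipation, ← integral_complex_ofReal]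
    refine integral_congr_ae (.of_forall fun ξ => ?_)
    have := Complex.conj_mul' (Gh ξ)
    push_cast
    rw [← this]; ring
  have e3 : ‖∫ ξ, conj (Gh ξ) * (E ξ * planeFourier θ ξ)‖
      ≤ (1 + (Real.Gamma α)⁻¹) * (‖toL2 (goodVort α u θ)‖ * ‖toL2 θ‖) := by
    have hi : Integrable fun ξ => ‖Gh ξ‖ * ‖planeFourier θ ξ‖ :=
      mGh.norm.integrable_mul (memLp_planeFourier hθ.memLp).norm
    refine (norm_integral_le_of_norm_le (hi.const_mul (1 + (Real.Gamma α)⁻¹))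
      (.of_forall fun ξ => ?_)).trans ?_
    · rw [norm_mul, norm_mul, RCLike.norm_conj]
      calc ‖Gh ξ‖ * (‖E ξ‖ * ‖planeFourier θ ξ‖)
          ≤ ‖Gh ξ‖ * ((1 + (Real.Gamma α)⁻¹) * ‖planeFourier θ ξ‖) := by gcongr; exact hEb ξ
        _ = _ := by ring
    · rw [integral_const_mul]
      have := (norm_nonneg _).trans (hEb 0)
      gcongr
      exact integral_norm_planeFourier_mul_le mG hθ.memLp
  have h := congrArg Complex.re e1
  rw [Complex.ofReal_re, e2, Complex.add_re, Complex.neg_re, Complex.ofReal_re] at h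
  rw [h]
  gcongr
  exact (Complex.re_le_norm _).trans e3

/-- The energy estimate for the modified vorticity at a fixed time. -/
lemma inner_goodVort_le (hα : α ∈ Ioo (1 / 2 : ℝ) 1) (hu : ∀ j, IsSob (u j)) (hθ : IsSob θ)
    (hdiv : ∀ x, pd 0 (u 0) x + pd 1 (u 1) x = 0) {M : ℝ} (hM : ∀ x, |θ x| ≤ M) :
    (inner ℂ (toL2 (goodVort α u θ))
        (toL2 (vortRHS α u θ) + highOp hα (toL2 (advect u θ))) : ℂ).re
      ≤ - dissipation α (goodVort α u θ)
        + (1 + (Real.Gamma α)⁻¹) * (‖toL2 (goodVort α u θ)‖ * ‖toL2 θ‖)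
        + commutatorConst α * M * ‖toL2 (goodVort α u θ)‖ * gradNorm u := by
  have mG := memLp_goodVort hα hu hθ
  have hdG := goodVort_differentiable hα hu hθ
  have hΛ := fracLambda_sob (by linarith [hα.1] : 0 ≤ 2 * α) (by linarith [hα.2])
    (IsSob.vort hu)
  have mR : MemLp (fun x => pd 0 θ x - fracLambda (2 * α) (vort u) x) 2 :=
    (hθ.pd 0).memLp.sub hΛ.2.1
  have mK : ∀ j, MemLp (highFun α (pd j θ)) 2 := fun j => (highFun_sob hα (hθ.pd j)).2.1
  have mG' : ∀ j, MemLp (pd j (goodVort α u θ)) 2 := fun j => by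
    rw [pd_goodVort hα hu hθ]
    exact ((IsSob.vort hu).pd j).memLp.sub (mK j)
  have hmul : ∀ j, MemLp (fun x => u j x * goodVort α u θ x) 2 := fun j => by
    obtain ⟨B, hB⟩ := (hu j).bounded
    exact memLp_bdd_mul mG (hu j).continuous hB
  have mA : MemLp (advect u θ) 2 := memLp_advect hu fun j => (hθ.pd j).memLp
  have mAv : MemLp (advect u (vort u)) 2 := memLp_advect hu fun j => ((IsSob.vort hu).pd j).memLp
  -- Since `u·∇G` is orthogonal to `G`, only `u·∇Kθ = u·K∇θ` survives from `u·∇ω`. Together with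
  -- `K(u·∇θ)` it forms the commutator.
  have hadv : ∫ x, goodVort α u θ x * advect u (vort u) x
      = (∫ x, (u 0 x * goodVort α u θ x) * highFun α (pd 0 θ) x)
        + ∫ x, (u 1 x * goodVort α u θ x) * highFun α (pd 1 θ) x := by
    have h0 := integral_mul_advect_self hu hdiv hdG mG mG'
    rw [← sub_zero (∫ x, goodVort α u θ x * advect u (vort u) x), ← h0,
      ← integral_sub (integrable_mul_of_memLp mG mAv)
        (integrable_mul_of_memLp mG (memLp_advect hu mG')),
      ← integral_add (integrable_mul_of_memLp (hmul 0) (mK 0))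
        (integrable_mul_of_memLp (hmul 1) (mK 1))]
    refine integral_congr_ae (.of_forall fun x => ?_)
    simp only [advect, pd_goodVort hα hu hθ]
    ring
  have hpair : ∀ j, ((∫ x, (u j x * goodVort α u θ x) * highFun α (pd j θ) x : ℝ) : ℂ)
      = highPairing α (fun x => u j x * goodVort α u θ x) (pd j θ) := fun j => by
    rw [inner_toL2_eq_fourier (hmul j) (mK j), highPairing]
    refine integral_congr_ae ?_
    filter_upwards [(highFun_sob hα (hθ.pd j)).2.2.1] with ξ h
    rw [h]
  have hR : ∫ x, goodVort α u θ x * vortRHS α u θ x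
      = (∫ x, goodVort α u θ x * (pd 0 θ x - fracLambda (2 * α) (vort u) x))
        - ∫ x, goodVort α u θ x * advect u (vort u) x := by
    rw [← integral_sub (integrable_mul_of_memLp mG mR) (integrable_mul_of_memLp mG mAv)]
    refine integral_congr_ae (.of_forall fun x => ?_)
    simp only [vortRHS]; ring
  have hlin := integral_goodVort_linear_le hα hu hθ
  have hcomm := norm_high_commutator_le hα hu hθ hdiv hM mG
  rw [← hpair 0, ← hpair 1] at hcomm
  have hre := (Complex.re_le_norm _).trans hcomm
  rw [inner_add_right, inner_toL2 mG (memLp_vortRHS hα hu hθ), inner_highOp hα mG mA,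
    Complex.add_re, Complex.ofReal_re, hR, hadv]
  simp only [Complex.sub_re, Complex.add_re, Complex.ofReal_re] at hre
  linarith

end Fixed

/-! ### Families of functions with uniform Sobolev bounds -/

/-- The functions `f t`, `t ∈ S`, are smooth and bounded in every Sobolev space, uniformly in `t`. -/
structure UnifSob (S : Set ℝ) (f : ℝ → Plane → ℝ) : Prop where
  isSob : ∀ t ∈ S, IsSob (f t)
  bounded : ∀ k : ℕ, ∃ C : ℝ≥0, ∀ t ∈ S, eLpNorm (iteratedFDeriv ℝ k (f t)) 2 volume ≤ C

lemma IsSob.of_bounds {f : Plane → ℝ} (hf : ContDiff ℝ ∞ f) {C : ℕ → ℝ≥0}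
    (h : ∀ k, eLpNorm (iteratedFDeriv ℝ k f) 2 volume ≤ C k) : IsSob f where
  contDiff := hf
  memLp_iteratedFDeriv k :=
    ⟨(hf.continuous_iteratedFDeriv (by exact_mod_cast le_top)).aestronglyMeasurable,
      (h k).trans_lt ENNReal.coe_lt_top⟩

lemma UnifSob.of_bounds {S : Set ℝ} {f : ℝ → Plane → ℝ} (hf : ∀ t ∈ S, ContDiff ℝ ∞ (f t))
    (h : ∀ k : ℕ, ∃ C : ℝ≥0, ∀ t ∈ S, eLpNorm (iteratedFDeriv ℝ k (f t)) 2 volume ≤ C) :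
    UnifSob S f where
  isSob t ht := by
    choose C hC using h
    exact IsSob.of_bounds (hf t ht) fun k => hC k t ht
  bounded := h

namespace UnifSob

variable {S : Set ℝ} {f g : ℝ → Plane → ℝ}

lemma pd (hf : UnifSob S f) (j : Fin 2) : UnifSob S (fun t => pd j (f t)) where
  isSob t ht := (hf.isSob t ht).pd j
  bounded k := by
    obtain ⟨C, hC⟩ := hf.bounded (k + 1)
    exact ⟨C, fun t ht => (eLpNorm_mono fun x =>
      norm_iteratedFDeriv_pd_le (hf.isSob t ht).contDiff j k x).trans (hC t ht)⟩

lemma sub (hf : UnifSob S f) (hg : UnifSob S g) : UnifSob S (fun t x => f t x - g t x) where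
  isSob t ht := (hf.isSob t ht).sub (hg.isSob t ht)
  bounded k := by
    obtain ⟨C, hC⟩ := hf.bounded k
    obtain ⟨D, hD⟩ := hg.bounded k
    refine ⟨C + D, fun t ht => ?_⟩
    have e : iteratedFDeriv ℝ k (fun x => f t x - g t x)
        = iteratedFDeriv ℝ k (f t) - iteratedFDeriv ℝ k (g t) := by
      funext x
      exact iteratedFDeriv_sub_apply
        ((hf.isSob t ht).contDiff.contDiffAt.of_le (by exact_mod_cast le_top))
        ((hg.isSob t ht).contDiff.contDiffAt.of_le (by exact_mod_cast le_top))
    rw [e, ENNReal.coe_add]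
    exact (eLpNorm_sub_le ((hf.isSob t ht).memLp_iteratedFDeriv k).aestronglyMeasurable
      ((hg.isSob t ht).memLp_iteratedFDeriv k).aestronglyMeasurable (by norm_num)).trans
      (add_le_add (hC t ht) (hD t ht))

lemma norm_toL2_le (hf : UnifSob S f) : ∃ C : ℝ, 0 ≤ C ∧ ∀ t ∈ S, ‖toL2 (f t)‖ ≤ C := by
  obtain ⟨C, hC⟩ := hf.bounded 0
  refine ⟨C, C.2, fun t ht => ?_⟩
  rw [norm_toL2 (hf.isSob t ht).memLp]
  refine ENNReal.toReal_le_of_le_ofReal C.2 ((le_of_eq ?_).trans ((hC t ht).trans (by simp)))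
  exact eLpNorm_congr_norm_ae (.of_forall fun x => by simp)

lemma besselOp (hf : UnifSob S f) : UnifSob S (fun t => besselOp (f t)) :=
  (hf.sub ((hf.pd 0).pd 0)).sub ((hf.pd 1).pd 1)

lemma abs_le (hf : UnifSob S f) : ∃ B : ℝ, 0 ≤ B ∧ ∀ t ∈ S, ∀ x, |f t x| ≤ B := by
  obtain ⟨C, hC, h⟩ := exists_sobolev_embedding
  obtain ⟨D, hD, h'⟩ := hf.besselOp.norm_toL2_le
  refine ⟨C * D, by positivity, fun t ht x => (h _ (hf.isSob t ht) x).trans ?_⟩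
  gcongr
  exact h' t ht

end UnifSob

lemma norm_toL2_mul_le {f g : Plane → ℝ} (hf : MemLp f 2) (hg : Continuous g) {B : ℝ}
    (hB : ∀ x, |g x| ≤ B) : ‖toL2 fun x => g x * f x‖ ≤ B * ‖toL2 f‖ := by
  have h := memLp_bdd_mul hf hg hB
  refine Lp.norm_le_mul_norm_of_ae_le_mul ?_
  filter_upwards [toL2_coeFn hf, toL2_coeFn h] with x h1 h2
  rw [h1, h2, Complex.norm_real, Complex.norm_real, norm_mul]
  gcongr
  exact hB x

lemma UnifSob.norm_toL2_advect_le {S : Set ℝ} {u : ℝ → Fin 2 → Plane → ℝ} {f : ℝ → Plane → ℝ}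
    (hu : ∀ j, UnifSob S fun t => u t j) (hf : UnifSob S f) :
    ∃ C : ℝ, 0 ≤ C ∧ ∀ t ∈ S, ‖toL2 (advect (u t) (f t))‖ ≤ C := by
  obtain ⟨B₀, hB₀, h₀⟩ := (hu 0).abs_le
  obtain ⟨B₁, hB₁, h₁⟩ := (hu 1).abs_le
  obtain ⟨C₀, hC₀, k₀⟩ := (hf.pd 0).norm_toL2_le
  obtain ⟨C₁, hC₁, k₁⟩ := (hf.pd 1).norm_toL2_le
  refine ⟨B₀ * C₀ + B₁ * C₁, by positivity, fun t ht => ?_⟩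
  have m0 := ((hf.pd 0).isSob t ht).memLp
  have m1 := ((hf.pd 1).isSob t ht).memLp
  have c0 := ((hu 0).isSob t ht).continuous
  have c1 := ((hu 1).isSob t ht).continuous
  have e : toL2 (advect (u t) (f t)) = _ :=
    toL2_add (memLp_bdd_mul m0 c0 (h₀ t ht)) (memLp_bdd_mul m1 c1 (h₁ t ht))
  rw [e]
  refine (norm_add_le _ _).trans (add_le_add ?_ ?_)
  · refine (norm_toL2_mul_le m0 c0 (h₀ t ht)).trans ?_
    gcongr
    exact k₀ t ht
  · refine (norm_toL2_mul_le m1 c1 (h₁ t ht)).trans ?_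
    gcongr
    exact k₁ t ht

lemma norm_toL2_fracLambda_le {a : ℝ} (ha0 : 0 ≤ a) (ha : a ≤ 2) {f : Plane → ℝ} (hf : IsSob f) :
    ‖toL2 (fracLambda a f)‖ ≤ ‖toL2 (besselOp f)‖ := by
  have h := fracLambda_sob ha0 ha hf
  rw [← Lp.norm_fourier_eq (toL2 (fracLambda a f)), ← Lp.norm_fourier_eq (toL2 (besselOp f))]
  refine Lp.norm_le_norm_of_ae_le ?_
  rw [← planeFourier_eq h.2.1, ← planeFourier_eq hf.besselOp.memLp]
  filter_upwards [h.2.2.1, hf.planeFourier_besselOp] with ξ h1 h2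
  rw [h1, h2, norm_mul, norm_mul, Complex.norm_real,
    Real.norm_of_nonneg (Real.rpow_nonneg (freq_nonneg ξ) _), Complex.norm_real,
    Real.norm_of_nonneg (bracket_pos ξ).le]
  gcongr
  exact freq_rpow_le_bracket ha0 ha ξ

/-! ### Solutions in components -/

/-- A smooth solution, written in terms of the components of the velocity. -/
structure IsComponentSolution (α : ℝ) (T : EReal) (u : ℝ → Fin 2 → Plane → ℝ)
    (p θ : ℝ → Plane → ℝ) : Prop where
  smooth_u : ∀ j, ContDiffOn ℝ ∞ (fun z : ℝ × Plane => u z.1 j z.2) (timeInterval T ×ˢ univ)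
  smooth_p : ∀ t ∈ timeInterval T, ContDiff ℝ ∞ (p t)
  smooth_θ : ContDiffOn ℝ ∞ (fun z : ℝ × Plane => θ z.1 z.2) (timeInterval T ×ˢ univ)
  sobolev_u : ∀ τ ∈ timeInterval T, ∀ j, UnifSob (Icc 0 τ) fun t => u t j
  sobolev_θ : ∀ τ ∈ timeInterval T, UnifSob (Icc 0 τ) θ
  momentum : ∀ t ∈ timeInterval T, ∀ (j : Fin 2) (x : Plane),
    HasDerivWithinAt (fun s => u s j x)
      (-advect (u t) (u t j) x - fracLambda (2 * α) (u t j) x + pd j (p t) x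
        + θ t x * (if j = 1 then 1 else 0)) (timeInterval T) t
  div_eq_zero : ∀ t ∈ timeInterval T, ∀ x, pd 0 (u t 0) x + pd 1 (u t 1) x = 0
  transport : ∀ t ∈ timeInterval T, ∀ x,
    HasDerivWithinAt (fun s => θ s x) (-advect (u t) (θ t) x) (timeInterval T) t

lemma contDiff_slice {F : Type*} [NormedAddCommGroup F] [NormedSpace ℝ F] {w : ℝ → Plane → F}
    {T : EReal} (hw : ContDiffOn ℝ ∞ (fun z : ℝ × Plane => w z.1 z.2) (timeInterval T ×ˢ univ))
    {t : ℝ} (ht : t ∈ timeInterval T) : ContDiff ℝ ∞ (w t) := by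
  rw [← contDiffOn_univ]
  exact hw.comp (f := fun x : Plane => (t, x)) (by fun_prop) fun x _ => ⟨ht, trivial⟩

lemma norm_iteratedFDeriv_component_le {v : Plane → Plane} (hv : ContDiff ℝ ∞ v) (j : Fin 2)
    (k : ℕ) (x : Plane) :
    ‖iteratedFDeriv ℝ k (fun y => v y j) x‖ ≤ ‖iteratedFDeriv ℝ k v x‖ := by
  have h := ContinuousLinearMap.norm_iteratedFDeriv_comp_left
    (EuclideanSpace.proj j : Plane →L[ℝ] ℝ) (f := v) (x := x) (n := k) (N := ∞)
    hv.contDiffAt (by exact_mod_cast le_top)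
  refine h.trans (mul_le_of_le_one_left (norm_nonneg _) ?_)
  exact ContinuousLinearMap.opNorm_le_bound _ zero_le_one fun y => by
    simpa using PiLp.norm_apply_le y j

lemma pd_component {v : Plane → Plane} {x : Plane} (hv : DifferentiableAt ℝ v x) (i j : Fin 2) :
    pd i (fun y => v y j) x = fderiv ℝ v x (basisVec i) j := by
  have h : HasFDerivAt (fun y => v y j) ((EuclideanSpace.proj j : Plane →L[ℝ] ℝ) ∘L fderiv ℝ v x) x :=
    (EuclideanSpace.proj j : Plane →L[ℝ] ℝ).hasFDerivAt.comp x hv.hasFDerivAt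
  rw [pd, h.fderiv]
  rfl

lemma eq_sum_basisVec (y : Plane) : y = y 0 • basisVec 0 + y 1 • basisVec 1 := by
  ext i
  fin_cases i <;> simp [basisVec]

lemma vorticity_eq_vort {v : Plane → Plane} (hv : Differentiable ℝ v) :
    vorticity v = vort fun j x => v x j := by
  funext x
  rw [vorticity, vort, pd_component (hv x), pd_component (hv x)]

lemma gradient_apply (f : Plane → ℝ) (x : Plane) (j : Fin 2) : gradient f x j = pd j f x := by
  rw [← inner_basisVec, gradient, InnerProductSpace.toDual_symm_apply]
  rfl

lemma fderiv_apply_eq_advect (v : Plane → Plane) (f : Plane → ℝ) (x : Plane) :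
    fderiv ℝ f x (v x) = advect (fun j y => v y j) f x := by
  conv_lhs => rw [eq_sum_basisVec (v x)]
  simp [advect, pd]

lemma IsSmoothSolution.isComponentSolution {α : ℝ} {T : EReal} {u₀ : Plane → Plane}
    {θ₀ : Plane → ℝ} {u : ℝ → Plane → Plane} {p θ : ℝ → Plane → ℝ}
    (h : IsSmoothSolution α T u₀ θ₀ u p θ) :
    IsComponentSolution α T (fun t j x => u t x j) p θ where
  smooth_u j := (EuclideanSpace.proj j : Plane →L[ℝ] ℝ).contDiff.comp_contDiffOn h.smooth_u
  smooth_p t ht := contDiff_slice h.smooth_p ht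
  smooth_θ := h.smooth_θ
  sobolev_u τ hτ j := by
    have hs : ∀ t ∈ Icc 0 τ, ContDiff ℝ ∞ (u t) := fun t ht =>
      contDiff_slice h.smooth_u (Icc_subset_timeInterval hτ ht)
    refine .of_bounds (fun t ht =>
      (EuclideanSpace.proj j : Plane →L[ℝ] ℝ).contDiff.comp (hs t ht)) fun k => ?_
    obtain ⟨C, hC⟩ := h.sobolev_u k τ hτ
    exact ⟨C, fun t ht => (eLpNorm_mono fun x =>
      norm_iteratedFDeriv_component_le (hs t ht) j k x).trans (hC t ht)⟩
  sobolev_θ τ hτ := .of_bounds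
    (fun t ht => contDiff_slice h.smooth_θ (Icc_subset_timeInterval hτ ht))
    fun k => h.sobolev_θ k τ hτ
  momentum t ht j x := by
    have hd : Differentiable ℝ (u t) := (contDiff_slice h.smooth_u ht).differentiable (by simp)
    have h1 := (EuclideanSpace.proj j : Plane →L[ℝ] ℝ).hasFDerivAt.comp_hasDerivWithinAt t
      (h.momentum t ht x)
    refine h1.congr_deriv ?_
    have e1 : (fderiv ℝ (u t) x (u t x)) j = advect (fun j y => u t y j) (fun y => u t y j) x := by
      conv_lhs => rw [eq_sum_basisVec (u t x)]
      simp [advect, pd_component (hd x)]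
    have e2 : (basisVec 1 : Plane) j = if j = 1 then 1 else 0 := by
      simp [basisVec, PiLp.single_apply]
    simp only [PiLp.proj_apply, PiLp.add_apply, PiLp.sub_apply, PiLp.neg_apply, PiLp.smul_apply,
      smul_eq_mul, e1, e2, gradient_apply]
    rfl
  div_eq_zero t ht x := by
    have hd : Differentiable ℝ (u t) := (contDiff_slice h.smooth_u ht).differentiable (by simp)
    rw [pd_component (hd x), pd_component (hd x)]
    have := h.incompressible t ht x
    rwa [divergence, Fin.sum_univ_two] at this
  transport t ht x := by
    rw [← fderiv_apply_eq_advect]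
    exact h.transport t ht x

/-! ### The vorticity equation -/

lemma pd_comm {f : Plane → ℝ} (hf : ContDiff ℝ ∞ f) (i j : Fin 2) (x : Plane) :
    pd i (pd j f) x = pd j (pd i f) x := by
  have hd : DifferentiableAt ℝ (fderiv ℝ f) x :=
    (hf.fderiv_right (m := ∞) (by simp)).differentiable (by simp) x
  have e : ∀ i j : Fin 2, pd i (pd j f) x = fderiv ℝ (fderiv ℝ f) x (basisVec i) (basisVec j) := by
    intro i j
    have h : HasFDerivAt (pd j f) _ x := hd.hasFDerivAt.clm_apply (hasFDerivAt_const (basisVec j) x)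
    rw [pd, h.fderiv]
    simp
  rw [e, e]
  exact (hf.contDiffAt.isSymmSndFDerivAt (by
    rw [minSmoothness_of_isRCLikeNormedField]; exact WithTop.coe_le_coe.2 le_top)).eq _ _

lemma pd_add {f g : Plane → ℝ} (hf : Differentiable ℝ f) (hg : Differentiable ℝ g) (j : Fin 2)
    (x : Plane) : pd j (fun y => f y + g y) x = pd j f x + pd j g x := by
  have h : HasFDerivAt (fun y => f y + g y) _ x := (hf x).hasFDerivAt.add (hg x).hasFDerivAt
  rw [pd, h.fderiv]
  rfl

lemma pd_sub {f g : Plane → ℝ} (hf : Differentiable ℝ f) (hg : Differentiable ℝ g) (j : Fin 2)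
    (x : Plane) : pd j (fun y => f y - g y) x = pd j f x - pd j g x := by
  have h : HasFDerivAt (fun y => f y - g y) _ x := (hf x).hasFDerivAt.sub (hg x).hasFDerivAt
  rw [pd, h.fderiv]
  rfl

lemma fourierMultiplier_sub {m : Plane → ℂ} {f g : Plane → ℝ} (hf : MemLp f 2) (hg : MemLp g 2)
    (hif : Integrable fun ξ => m ξ * planeFourier f ξ)
    (hig : Integrable fun ξ => m ξ * planeFourier g ξ) (x : Plane) :
    fourierMultiplier m (fun y => f y - g y) x
      = fourierMultiplier m f x - fourierMultiplier m g x := by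
  have h1 : ∀ {w : Plane → ℂ}, Integrable w → Integrable fun ξ : Plane =>
      Complex.exp ((2 * Real.pi * inner ℝ ξ x : ℝ) * Complex.I) • w ξ := fun {w} hw => by
    refine hw.bdd_smul
      (φ := fun ξ => Complex.exp ((2 * Real.pi * inner ℝ ξ x : ℝ) * Complex.I)) 1 (Continuous.aestronglyMeasurable (by fun_prop))
      (.of_forall fun ξ => ?_)
    rw [Complex.norm_exp_ofReal_mul_I]
  rw [fourierMultiplier, fourierMultiplier, fourierMultiplier, ← Complex.sub_re,
    Real.fourierInv_eq', Real.fourierInv_eq', Real.fourierInv_eq', ← integral_sub (h1 hif) (h1 hig)]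
  congr 1
  refine integral_congr_ae ?_
  filter_upwards [planeFourier_sub hf hg] with ξ h
  rw [h, mul_sub, smul_sub]

lemma pd_fracLambda_vort {a : ℝ} (ha0 : 0 ≤ a) (ha : a ≤ 2) {u : Fin 2 → Plane → ℝ}
    (hu : ∀ j, IsSob (u j)) (x : Plane) :
    pd 0 (fracLambda a (u 1)) x - pd 1 (fracLambda a (u 0)) x = fracLambda a (vort u) x := by
  have hi : ∀ {f : Plane → ℝ}, IsSob f → Integrable fun ξ =>
      (((2 * Real.pi * ‖ξ‖) ^ a : ℝ) : ℂ) * planeFourier f ξ := fun {f} hf => by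
    refine hf.integrable_mul (m := fun ξ => ((freq ξ ^ a : ℝ) : ℂ)) (C := 1) (n := 1) ?_ fun ξ => ?_
    · exact (Complex.continuous_ofReal.comp
        (continuous_freq.rpow_const fun _ => Or.inr ha0)).aestronglyMeasurable
    · rw [Complex.norm_real, Real.norm_of_nonneg (Real.rpow_nonneg (freq_nonneg ξ) _), pow_one,
        one_mul]
      exact freq_rpow_le_bracket ha0 ha ξ
  rw [(fracLambda_sob ha0 ha (hu 1)).2.2.2 0, (fracLambda_sob ha0 ha (hu 0)).2.2.2 1]
  exact (fourierMultiplier_sub ((hu 1).pd 0).memLp ((hu 0).pd 1).memLp (hi ((hu 1).pd 0))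
    (hi ((hu 0).pd 1)) x).symm

lemma contDiff_advect {u : Fin 2 → Plane → ℝ} {f : Plane → ℝ}
    (hu : ∀ j, ContDiff ℝ ∞ (u j)) (hf : ContDiff ℝ ∞ f) : ContDiff ℝ ∞ (advect u f) :=
  ((hu 0).mul (contDiff_pd hf 0)).add ((hu 1).mul (contDiff_pd hf 1))

lemma pd_advect {u : Fin 2 → Plane → ℝ} {f : Plane → ℝ}
    (hu : ∀ j, ContDiff ℝ ∞ (u j)) (hf : ContDiff ℝ ∞ f) (j : Fin 2) (x : Plane) :
    pd j (advect u f) x = pd j (u 0) x * pd 0 f x + pd j (u 1) x * pd 1 f x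
      + (u 0 x * pd 0 (pd j f) x + u 1 x * pd 1 (pd j f) x) := by
  have d : ∀ {g : Plane → ℝ}, ContDiff ℝ ∞ g → Differentiable ℝ g := fun h =>
    h.differentiable (by simp)
  have d0 := d (contDiff_pd hf 0)
  have d1 := d (contDiff_pd hf 1)
  have e := pd_add ((d (hu 0)).mul d0) ((d (hu 1)).mul d1) j x
  have e0 := pd_mul (d (hu 0)) d0 j x
  have e1 := pd_mul (d (hu 1)) d1 j x
  refine e.trans ?_
  rw [show pd j (u 0 * pd 0 f) x = _ from e0, show pd j (u 1 * pd 1 f) x = _ from e1,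
    pd_comm hf j 0, pd_comm hf j 1]
  ring

/-- In two dimensions the quadratic terms in `∇u` combine to `ω div u`, so there is no vortex
stretching. -/
lemma curl_advect {u : Fin 2 → Plane → ℝ} (hu : ∀ j, ContDiff ℝ ∞ (u j))
    (hdiv : ∀ x, pd 0 (u 0) x + pd 1 (u 1) x = 0) (x : Plane) :
    pd 0 (advect u (u 1)) x - pd 1 (advect u (u 0)) x = advect u (vort u) x := by
  have d : ∀ i j, Differentiable ℝ (pd i (u j)) := fun i j =>
    (contDiff_pd (hu j) i).differentiable (by simp)
  have e : ∀ j, pd j (vort u) x = pd j (pd 0 (u 1)) x - pd j (pd 1 (u 0)) x := fun j =>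
    pd_sub (d 0 1) (d 1 0) j x
  rw [pd_advect hu (hu 1), pd_advect hu (hu 0), advect, e, e]
  linear_combination (pd 0 (u 1) x - pd 1 (u 0) x) * hdiv x

/-- The right-hand side of the momentum equation. -/
def momentumRHS (α : ℝ) (u : Fin 2 → Plane → ℝ) (p θ : Plane → ℝ) (j : Fin 2) (x : Plane) : ℝ :=
  -advect u (u j) x - fracLambda (2 * α) (u j) x + pd j p x + θ x * (if j = 1 then 1 else 0)

lemma contDiff_momentumRHS {α : ℝ} (hα : α ∈ Ioo (1 / 2 : ℝ) 1) {u : Fin 2 → Plane → ℝ}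
    {p θ : Plane → ℝ} (hu : ∀ j, IsSob (u j)) (hp : ContDiff ℝ ∞ p) (hθ : ContDiff ℝ ∞ θ)
    (j : Fin 2) : ContDiff ℝ 1 (momentumRHS α u p θ j) :=
  ((((contDiff_advect (fun j => (hu j).contDiff) (hu j).contDiff).neg.of_le
    (by exact_mod_cast le_top)).sub
      (fracLambda_sob (by linarith [hα.1]) (by linarith [hα.2]) (hu j)).1).add
        ((contDiff_pd hp j).of_le (by exact_mod_cast le_top))).add
          ((hθ.of_le (by exact_mod_cast le_top)).mul contDiff_const)

/-- The pressure drops out by symmetry of second derivatives, and the vertical buoyancy contributes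
`∂₁θ`. -/
lemma curl_momentumRHS {α : ℝ} (hα : α ∈ Ioo (1 / 2 : ℝ) 1) {u : Fin 2 → Plane → ℝ}
    {p θ : Plane → ℝ} (hu : ∀ j, IsSob (u j)) (hp : ContDiff ℝ ∞ p) (hθ : ContDiff ℝ ∞ θ)
    (hdiv : ∀ x, pd 0 (u 0) x + pd 1 (u 1) x = 0) (x : Plane) :
    pd 0 (momentumRHS α u p θ 1) x - pd 1 (momentumRHS α u p θ 0) x = vortRHS α u θ x := by
  have ha0 : 0 ≤ 2 * α := by linarith [hα.1]
  have ha : 2 * α ≤ 2 := by linarith [hα.2]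
  have e : ∀ i j, pd i (momentumRHS α u p θ j) x = -pd i (advect u (u j)) x
      - pd i (fracLambda (2 * α) (u j)) x + pd i (pd j p) x
      + pd i θ x * (if j = 1 then 1 else 0) := by
    intro i j
    have h1 := ((contDiff_advect (fun j => (hu j).contDiff) (hu j).contDiff).differentiable
      (by simp) x).hasFDerivAt
    have h2 := ((fracLambda_sob ha0 ha (hu j)).1.differentiable (by norm_num) x).hasFDerivAt
    have h3 := ((contDiff_pd hp j).differentiable (by simp) x).hasFDerivAt
    have h4 := (hθ.differentiable (by simp) x).hasFDerivAt
    have h : HasFDerivAt (momentumRHS α u p θ j) _ x :=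
      ((h1.neg.sub h2).add h3).add (h4.mul_const (if j = 1 then (1 : ℝ) else 0))
    rw [pd, h.fderiv]
    simp only [pd, mul_ite, mul_one, mul_zero]
    split_ifs <;> simp
  rw [e, e, vortRHS, ← curl_advect (fun j => (hu j).contDiff) hdiv x,
    ← pd_fracLambda_vort ha0 ha hu, pd_comm hp 0 1]
  simp
  ring

lemma integral_test_mul_pd {χ f : Plane → ℝ} (hχ : ContDiff ℝ ∞ χ) (hc : HasCompactSupport χ)
    (hf : ContDiff ℝ 1 f) (j : Fin 2) : ∫ x, χ x * pd j f x = - ∫ x, pd j χ x * f x := by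
  have hcf : Continuous (pd j f) := (hf.continuous_fderiv (by norm_num)).clm_apply continuous_const
  exact integral_mul_fderiv_eq_neg_fderiv_mul_of_integrable
    (((contDiff_pd hχ j).continuous.mul hf.continuous).integrable_of_hasCompactSupport
      (hc.fderiv_apply ℝ (basisVec j)).mul_right)
    ((hχ.continuous.mul hcf).integrable_of_hasCompactSupport hc.mul_right)
    ((hχ.continuous.mul hf.continuous).integrable_of_hasCompactSupport hc.mul_right)
    (fun x _ => hχ.differentiable (by simp) x) (fun x _ => hf.differentiable (by norm_num) x)

lemma integral_test_mul_curl {χ f g : Plane → ℝ} (hχ : ContDiff ℝ ∞ χ) (hc : HasCompactSupport χ)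
    (hf : ContDiff ℝ 1 f) (hg : ContDiff ℝ 1 g) :
    ∫ x, χ x * (pd 0 f x - pd 1 g x) = (∫ x, pd 1 χ x * g x) - ∫ x, pd 0 χ x * f x := by
  have hi : ∀ {f : Plane → ℝ}, ContDiff ℝ 1 f → ∀ j, Integrable fun x => χ x * pd j f x :=
    fun {f} hf j => (hχ.continuous.mul ((hf.continuous_fderiv (by norm_num)).clm_apply
      continuous_const)).integrable_of_hasCompactSupport hc.mul_right
  simp only [mul_sub]
  rw [integral_sub (hi hf 0) (hi hg 1), integral_test_mul_pd hχ hc hf,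
    integral_test_mul_pd hχ hc hg]
  ring

/-! ### Time regularity of solutions -/

section Solution

variable {α : ℝ} {T : EReal} {u : ℝ → Fin 2 → Plane → ℝ} {p θ : ℝ → Plane → ℝ} {τ : ℝ}

namespace IsComponentSolution

lemma isSob_u (h : IsComponentSolution α T u p θ) {t : ℝ} (ht : t ∈ timeInterval T) (j : Fin 2) :
    IsSob (u t j) := (h.sobolev_u t ht j).isSob t ⟨ht.1, le_rfl⟩

lemma isSob_θ (h : IsComponentSolution α T u p θ) {t : ℝ} (ht : t ∈ timeInterval T) :
    IsSob (θ t) := (h.sobolev_θ t ht).isSob t ⟨ht.1, le_rfl⟩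

lemma unifSob_vort (h : IsComponentSolution α T u p θ) (hτ : τ ∈ timeInterval T) :
    UnifSob (Icc 0 τ) fun t => vort (u t) :=
  ((h.sobolev_u τ hτ 1).pd 0).sub ((h.sobolev_u τ hτ 0).pd 1)

lemma hasWeakDeriv_θ (h : IsComponentSolution α T u p θ) (hτ : τ ∈ timeInterval T)
    (hτ0 : 0 < τ) : ∃ C, 0 ≤ C ∧ HasWeakDeriv (fun t => toL2 (θ t))
      (fun t => toL2 fun x => -advect (u t) (θ t) x) τ C := by
  obtain ⟨C, hC, hb⟩ := UnifSob.norm_toL2_advect_le (h.sobolev_u τ hτ) (h.sobolev_θ τ hτ)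
  have hsub := Icc_subset_timeInterval hτ
  have hm : ∀ t ∈ Icc 0 τ, MemLp (advect (u t) (θ t)) 2 := fun t ht =>
    memLp_advect (h.isSob_u (hsub ht)) fun j => ((h.isSob_θ (hsub ht)).pd j).memLp
  refine ⟨C, hC, hasWeakDeriv_toL2 hτ0 hC (fun t ht => (h.isSob_θ (hsub ht)).memLp)
    (fun t ht => (hm t (Ioo_subset_Icc_self ht)).neg) (fun t ht => ?_) (fun χ hχ hc => ?_)
    fun χ hχ hc t ht => ?_⟩
  · rw [toL2_neg (hm t (Ioo_subset_Icc_self ht)), norm_neg]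
    exact hb t (Ioo_subset_Icc_self ht)
  · exact (continuousOn_integral_test h.smooth_θ hχ.continuous hc).mono hsub
  · exact hasDerivAt_integral_test h.smooth_θ h.transport hχ.continuous hc ht.1
      (hsub (Ioo_subset_Icc_self ht)).2

lemma norm_toL2_vortRHS_le (hα : α ∈ Ioo (1 / 2 : ℝ) 1) (h : IsComponentSolution α T u p θ)
    (hτ : τ ∈ timeInterval T) :
    ∃ C, 0 ≤ C ∧ ∀ t ∈ Icc 0 τ, ‖toL2 (vortRHS α (u t) (θ t))‖ ≤ C := by
  have ha0 : 0 ≤ 2 * α := by linarith [hα.1]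
  have ha : 2 * α ≤ 2 := by linarith [hα.2]
  have hv := h.unifSob_vort hτ
  obtain ⟨C₁, hC₁, h₁⟩ := UnifSob.norm_toL2_advect_le (h.sobolev_u τ hτ) hv
  obtain ⟨C₂, hC₂, h₂⟩ := ((h.sobolev_θ τ hτ).pd 0).norm_toL2_le
  obtain ⟨C₃, hC₃, h₃⟩ := hv.besselOp.norm_toL2_le
  refine ⟨C₂ + C₃ + C₁, by positivity, fun t ht => ?_⟩
  have hu := h.isSob_u (Icc_subset_timeInterval hτ ht)
  have hθ := h.isSob_θ (Icc_subset_timeInterval hτ ht)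
  have hΛ := (fracLambda_sob ha0 ha (IsSob.vort hu)).2.1
  have hA : MemLp (advect (u t) (vort (u t))) 2 :=
    memLp_advect hu fun j => ((IsSob.vort hu).pd j).memLp
  have e : toL2 (vortRHS α (u t) (θ t)) = toL2 (pd 0 (θ t))
      - toL2 (fracLambda (2 * α) (vort (u t))) - toL2 (advect (u t) (vort (u t))) := by
    rw [← toL2_sub (hθ.pd 0).memLp hΛ]
    exact toL2_sub ((hθ.pd 0).memLp.sub hΛ) hA
  rw [e]
  refine (norm_sub_le _ _).trans (add_le_add ((norm_sub_le _ _).trans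
    (add_le_add (h₂ t ht) ?_)) (h₁ t ht))
  exact (norm_toL2_fracLambda_le ha0 ha (IsSob.vort hu)).trans (h₃ t ht)

/-- The curl is first moved onto the test function, so the momentum equation is differentiated in
time without interchanging `∂ₜ` with space derivatives of `u`. The curl is then moved back onto the
right-hand side; compact support makes the integrations by parts valid without any decay of `p`. -/
lemma hasWeakDeriv_vort (hα : α ∈ Ioo (1 / 2 : ℝ) 1) (h : IsComponentSolution α T u p θ)
    (hτ : τ ∈ timeInterval T) (hτ0 : 0 < τ) :
    ∃ C, 0 ≤ C ∧ HasWeakDeriv (fun t => toL2 (vort (u t)))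
      (fun t => toL2 (vortRHS α (u t) (θ t))) τ C := by
  obtain ⟨C, hC, hb⟩ := h.norm_toL2_vortRHS_le hα hτ
  have hsub := Icc_subset_timeInterval hτ
  have hcu : ∀ t ∈ timeInterval T, ∀ j, ContDiff ℝ 1 (u t j) := fun t ht j =>
    (h.isSob_u ht j).contDiff.of_le (by exact_mod_cast le_top)
  have e : ∀ χ : Plane → ℝ, ContDiff ℝ ∞ χ → HasCompactSupport χ → ∀ t ∈ timeInterval T,
      ∫ x, χ x * vort (u t) x = (∫ x, pd 1 χ x * u t 0 x) - ∫ x, pd 0 χ x * u t 1 x :=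
    fun χ hχ hc t ht => integral_test_mul_curl hχ hc (hcu t ht 1) (hcu t ht 0)
  have hcs : ∀ {χ : Plane → ℝ}, HasCompactSupport χ → ∀ j, HasCompactSupport (pd j χ) :=
    fun hc j => hc.fderiv_apply ℝ (basisVec j)
  refine ⟨C, hC, hasWeakDeriv_toL2 hτ0 hC (fun t ht => (IsSob.vort (h.isSob_u (hsub ht))).memLp)
    (fun t ht => ?_) (fun t ht => hb t (Ioo_subset_Icc_self ht)) (fun χ hχ hc => ?_)
    fun χ hχ hc t ht => ?_⟩
  · have ht' := hsub (Ioo_subset_Icc_self ht)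
    exact memLp_vortRHS hα (h.isSob_u ht') (h.isSob_θ ht')
  · refine ContinuousOn.congr ?_ fun t ht => e χ hχ hc t (hsub ht)
    exact ((continuousOn_integral_test (h.smooth_u 0) (contDiff_pd hχ 1).continuous
      (hcs hc 1)).sub (continuousOn_integral_test (h.smooth_u 1) (contDiff_pd hχ 0).continuous
      (hcs hc 0))).mono hsub
  · have ht' := hsub (Ioo_subset_Icc_self ht)
    have hu := h.isSob_u ht'
    have hθ := (h.isSob_θ ht').contDiff
    have hp := h.smooth_p t ht'
    have hd : ∀ i j, HasDerivAt (fun t => ∫ x, pd i χ x * u t j x)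
        (∫ x, pd i χ x * momentumRHS α (u t) (p t) (θ t) j x) t := fun i j =>
      hasDerivAt_integral_test (w := fun t => u t j) (h.smooth_u j)
        (fun t ht x => h.momentum t ht j x) (contDiff_pd hχ i).continuous (hcs hc i) ht.1 ht'.2
    have hN := contDiff_momentumRHS hα hu hp hθ
    have e' : ∫ x, χ x * vortRHS α (u t) (θ t) x
        = (∫ x, pd 1 χ x * momentumRHS α (u t) (p t) (θ t) 0 x)
          - ∫ x, pd 0 χ x * momentumRHS α (u t) (p t) (θ t) 1 x := by
      rw [← integral_test_mul_curl hχ hc (hN 1) (hN 0)]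
      exact integral_congr_ae (.of_forall fun x => by
        simp only [curl_momentumRHS hα hu hp hθ (h.div_eq_zero t ht') x])
    rw [e']
    refine ((hd 1 0).sub (hd 0 1)).congr_of_eventuallyEq ?_
    filter_upwards [timeInterval_mem_nhds ht.1 ht'.2] with s hs
    exact e χ hχ hc s hs

/-- Boundedness of `K` on `L²` lets it act on the weak derivative of `θ` by passing to the adjoint
on test vectors. -/
lemma hasWeakDeriv_goodVort (hα : α ∈ Ioo (1 / 2 : ℝ) 1) (h : IsComponentSolution α T u p θ)
    (hτ : τ ∈ timeInterval T) (hτ0 : 0 < τ) :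
    ∃ C, 0 ≤ C ∧ HasWeakDeriv (fun t => toL2 (vort (u t)) - highOp hα (toL2 (θ t)))
      (fun t => toL2 (vortRHS α (u t) (θ t))
        - highOp hα (toL2 fun x => -advect (u t) (θ t) x)) τ C := by
  obtain ⟨C, hC, h1⟩ := h.hasWeakDeriv_vort hα hτ hτ0
  obtain ⟨D, hD, h2⟩ := h.hasWeakDeriv_θ hτ hτ0
  exact ⟨_, by positivity, h1.sub (h2.map (highOp hα))⟩

end IsComponentSolution

end Solution

/-! ### Conservation laws for the transported scalar -/

lemma antitoneOn_Icc_of_hasDerivAt {f f' : ℝ → ℝ} {τ : ℝ} (hc : ContinuousOn f (Icc 0 τ))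
    (hd : ∀ t ∈ Ioo 0 τ, HasDerivAt f (f' t) t) (hn : ∀ t ∈ Ioo 0 τ, f' t ≤ 0) :
    AntitoneOn f (Icc 0 τ) := by
  refine antitoneOn_of_deriv_nonpos (convex_Icc 0 τ) hc ?_ ?_ <;> rw [interior_Icc]
  · exact fun t ht => (hd t ht).differentiableAt.differentiableWithinAt
  · exact fun t ht => by rw [(hd t ht).deriv]; exact hn t ht

/-- The distance, with sign, of `s` to the interval `[-M, M]`. -/
def softThreshold (M s : ℝ) : ℝ := max (s - M) 0 + min (s + M) 0

lemma continuous_softThreshold (M : ℝ) : Continuous (softThreshold M) := by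
  unfold softThreshold; fun_prop

lemma softThreshold_eq_zero {M s : ℝ} (hM : 0 ≤ M) : softThreshold M s = 0 ↔ |s| ≤ M := by
  unfold softThreshold
  rw [abs_le]
  rcases max_cases (s - M) 0 with h | h <;> rcases min_cases (s + M) 0 with h' | h' <;>
    rw [h.1, h'.1] <;> constructor <;> intro h1 <;> (try constructor) <;> linarith [h1, h.2, h'.2]

lemma abs_softThreshold_sub_le {M : ℝ} (hM : 0 ≤ M) (a b : ℝ) :
    |softThreshold M b - softThreshold M a| ≤ |b - a| := by
  unfold softThreshold
  rcases max_cases (a - M) 0 with h | h <;> rcases min_cases (a + M) 0 with h' | h' <;>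
    rcases max_cases (b - M) 0 with k | k <;> rcases min_cases (b + M) 0 with k' | k' <;>
    rw [h.1, h'.1, k.1, k'.1, abs_le] <;> constructor <;>
    rcases abs_cases (b - a) with l | l <;> linarith [h.2, h'.2, k.2, k'.2, l.1, l.2]

lemma abs_softThreshold_le {M : ℝ} (hM : 0 ≤ M) (s : ℝ) : |softThreshold M s| ≤ |s| := by
  have h := abs_softThreshold_sub_le hM 0 s
  rwa [(softThreshold_eq_zero (s := 0) hM).2 (by simpa using hM), sub_zero, sub_zero] at h

/-- The derivative `2 * softThreshold M` of the square is `2`-Lipschitz, so the Taylor remainder is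
at most `(b - a)²`. This is the quadratic remainder required by `hasDerivAt_of_quadratic`. -/
lemma abs_softThreshold_sq_sub_le {M : ℝ} (hM : 0 ≤ M) (a b : ℝ) :
    |softThreshold M b ^ 2 - softThreshold M a ^ 2 - 2 * (softThreshold M a * (b - a))|
      ≤ (b - a) ^ 2 := by
  unfold softThreshold
  rcases max_cases (a - M) 0 with h | h <;> rcases min_cases (a + M) 0 with h' | h' <;>
    rcases max_cases (b - M) 0 with k | k <;> rcases min_cases (b + M) 0 with k' | k' <;>
    rw [h.1, h'.1, k.1, k'.1, abs_le] <;> obtain ⟨-, h⟩ := h <;> obtain ⟨-, h'⟩ := h' <;>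
    obtain ⟨-, k⟩ := k <;> obtain ⟨-, k'⟩ := k' <;> constructor <;>
    nlinarith

lemma hasDerivAt_softThreshold_sq {M : ℝ} (hM : 0 ≤ M) (a : ℝ) :
    HasDerivAt (fun s => softThreshold M s ^ 2) (2 * softThreshold M a) a := by
  rw [hasDerivAt_iff_isLittleO]
  have : (fun s => (s - a) ^ 2) =o[𝓝 a] fun s => s - a :=
    (Asymptotics.isLittleO_pow_id (𝕜 := ℝ) (n := 2) (by norm_num)).comp_tendsto
      (tendsto_sub_nhds_zero_iff.2 (Filter.tendsto_id (α := ℝ) (x := 𝓝 a)))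
  refine (Asymptotics.IsBigO.of_bound 1 (.of_forall fun s => ?_)).trans_isLittleO this
  rw [Real.norm_eq_abs, Real.norm_eq_abs, abs_of_nonneg (sq_nonneg (s - a)), one_mul, smul_eq_mul]
  convert abs_softThreshold_sq_sub_le hM a s using 2
  ring

lemma memLp_softThreshold {M : ℝ} (hM : 0 ≤ M) {f : Plane → ℝ} (hf : MemLp f 2) :
    MemLp (fun x => softThreshold M (f x)) 2 :=
  hf.of_le ((continuous_softThreshold M).comp_aestronglyMeasurable hf.aestronglyMeasurable)
    (.of_forall fun x => abs_softThreshold_le hM (f x))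

/-- The product `2 S(f) ∇f` is the gradient of the `C¹` function `S(f)²`, so the integral is `-½ ∫
(div u) S(f)² = 0`. -/
lemma integral_softThreshold_mul_advect {M : ℝ} (hM : 0 ≤ M) {u : Fin 2 → Plane → ℝ}
    (hu : ∀ j, IsSob (u j)) (hdiv : ∀ x, pd 0 (u 0) x + pd 1 (u 1) x = 0) {f : Plane → ℝ}
    (hf : IsSob f) : ∫ x, softThreshold M (f x) * advect u f x = 0 := by
  obtain ⟨B, hB⟩ := hf.bounded
  set P : Plane → ℝ := fun x => softThreshold M (f x) with hP
  have cP : Continuous P := (continuous_softThreshold M).comp hf.continuous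
  have hPB : ∀ x, |P x| ≤ B := fun x => (abs_softThreshold_le hM _).trans (hB x)
  have mP : MemLp P 2 := memLp_softThreshold hM hf.memLp
  set g : Plane → ℝ := fun x => P x ^ 2 with hg
  have hdg : ∀ x, HasFDerivAt g ((2 * P x) • fderiv ℝ f x) x := fun x =>
    (hasDerivAt_softThreshold_sq hM (f x)).comp_hasFDerivAt x (hf.differentiable x).hasFDerivAt
  have hpd : ∀ j x, pd j g x = 2 * P x * pd j f x := fun j x => by
    rw [pd, (hdg x).fderiv]; rfl
  have mg : MemLp g 2 := (memLp_bdd_mul mP cP hPB).congr_norm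
    (cP.pow 2).aestronglyMeasurable (.of_forall fun x => by simp only [hg, sq])
  have mg' : ∀ j, MemLp (pd j g) 2 := fun j => by
    have := (memLp_bdd_mul (hf.pd j).memLp cP hPB).const_mul 2
    refine this.congr_norm ?_ (.of_forall fun x => by rw [hpd, mul_assoc])
    rw [show pd j g = fun x => 2 * P x * pd j f x from funext (hpd j)]
    exact ((continuous_const.mul cP).mul (hf.pd j).continuous).aestronglyMeasurable
  have key : ∀ j, ∫ x, u j x * pd j g x = - ∫ x, pd j (u j) x * g x := fun j =>
    integral_mul_pd j (hu j).differentiable (fun x => (hdg x).differentiableAt) (hu j).memLp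
      ((hu j).pd j).memLp mg (mg' j)
  have i1 : ∀ j, Integrable fun x => u j x * pd j g x := fun j =>
    integrable_mul_of_memLp (hu j).memLp (mg' j)
  have i2 : ∀ j, Integrable fun x => pd j (u j) x * g x := fun j =>
    integrable_mul_of_memLp ((hu j).pd j).memLp mg
  have e : 2 * ∫ x, P x * advect u f x = ∫ x, (u 0 x * pd 0 g x + u 1 x * pd 1 g x) := by
    rw [← integral_const_mul]
    refine integral_congr_ae (.of_forall fun x => ?_)
    simp only [advect, hpd]; ring
  have e' : ∫ x, (pd 0 (u 0) x * g x + pd 1 (u 1) x * g x) = 0 := by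
    simp only [← add_mul, hdiv, zero_mul, integral_zero]
  rw [integral_add (i1 0) (i1 1), key, key] at e
  rw [integral_add (i2 0) (i2 1)] at e'
  linarith

section Solution

variable {α : ℝ} {T : EReal} {u : ℝ → Fin 2 → Plane → ℝ} {p θ : ℝ → Plane → ℝ} {τ : ℝ}

lemma IsComponentSolution.norm_toL2_θ_le (h : IsComponentSolution α T u p θ)
    (hτ : τ ∈ timeInterval T) : ‖toL2 (θ τ)‖ ≤ ‖toL2 (θ 0)‖ := by
  rcases hτ.1.eq_or_lt with h0 | h0
  · rw [← h0]
  obtain ⟨C, -, hw⟩ := h.hasWeakDeriv_θ hτ h0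
  have hanti : AntitoneOn (fun t => ‖toL2 (θ t)‖ ^ 2) (Icc 0 τ) := by
    refine antitoneOn_Icc_of_hasDerivAt (hw.continuousOn.norm.pow 2)
      (fun t ht => hw.hasDerivAt_norm_sq ht) fun t ht => le_of_eq ?_
    have ht' := Icc_subset_timeInterval hτ (Ioo_subset_Icc_self ht)
    have hu := h.isSob_u ht'
    have hθ := h.isSob_θ ht'
    have mA : MemLp (advect (u t) (θ t)) 2 := memLp_advect hu fun j => (hθ.pd j).memLp
    rw [toL2_neg mA, inner_neg_right, inner_toL2 hθ.memLp mA,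
      integral_mul_advect_self hu (h.div_eq_zero t ht') hθ.differentiable hθ.memLp
        fun j => (hθ.pd j).memLp]
    simp
  exact (sq_le_sq₀ (norm_nonneg _) (norm_nonneg _)).1
    (hanti ⟨le_rfl, h0.le⟩ ⟨h0.le, le_rfl⟩ h0.le)

/-- The maximum principle for the transport equation. -/
lemma IsComponentSolution.abs_θ_le (h : IsComponentSolution α T u p θ)
    (hτ : τ ∈ timeInterval T) {M : ℝ} (hM : 0 ≤ M) (h₀ : ∀ᵐ x, |θ 0 x| ≤ M) (x : Plane) :
    |θ τ x| ≤ M := by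
  have hsub := Icc_subset_timeInterval hτ
  have hθ : ∀ t ∈ Icc 0 τ, IsSob (θ t) := fun t ht => h.isSob_θ (hsub ht)
  -- The functional `‖Q t‖²` measures the excess of `|θ|` over `M`. It vanishes at time `0` and has
  -- derivative zero along the transport. Continuity up to the endpoints comes from that of `θ` in
  -- `L²`, as `softThreshold M` is `1`-Lipschitz.
  set Q : ℝ → L2C := fun t => toL2 fun x => softThreshold M (θ t x) with hQ
  have mQ : ∀ t ∈ Icc 0 τ, MemLp (fun x => softThreshold M (θ t x)) 2 := fun t ht =>
    memLp_softThreshold hM (hθ t ht).memLp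
  have hQ0 : Q 0 = 0 := by
    refine (Lp.eq_zero_iff_ae_eq_zero).2 ?_
    filter_upwards [toL2_coeFn (mQ 0 ⟨le_rfl, hτ.1⟩), h₀] with x h1 h2
    rw [h1, (softThreshold_eq_zero hM).2 h2]; simp
  have hQτ : Q τ = 0 := by
    rcases hτ.1.eq_or_lt with h0 | h0
    · rw [← h0]; exact hQ0
    obtain ⟨C, -, hw⟩ := h.hasWeakDeriv_θ hτ h0
    have hlip : ∀ s ∈ Icc 0 τ, ∀ t ∈ Icc 0 τ, dist (Q s) (Q t) ≤ dist (toL2 (θ s)) (toL2 (θ t)) := by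
      intro s hs t ht
      rw [dist_eq_norm, dist_eq_norm, hQ, ← toL2_sub (mQ s hs) (mQ t ht),
        ← toL2_sub (hθ s hs).memLp (hθ t ht).memLp]
      refine Lp.norm_le_norm_of_ae_le ?_
      filter_upwards [toL2_coeFn ((mQ s hs).sub (mQ t ht)),
        toL2_coeFn ((hθ s hs).memLp.sub (hθ t ht).memLp)] with x h1 h2
      have h1' : toL2 (fun x => softThreshold M (θ s x) - softThreshold M (θ t x)) x = _ := h1
      have h2' : toL2 (fun x => θ s x - θ t x) x = _ := h2
      rw [h1', h2', Complex.norm_real, Complex.norm_real]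
      exact abs_softThreshold_sub_le hM _ _
    have hcont : ContinuousOn Q (Icc 0 τ) := by
      intro t ht
      refine tendsto_iff_dist_tendsto_zero.2 ?_
      refine squeeze_zero' (.of_forall fun _ => dist_nonneg)
        (eventually_nhdsWithin_of_forall fun s hs => hlip s hs t ht)
        (tendsto_iff_dist_tendsto_zero.1 (hw.continuousOn t ht))
    have hanti : AntitoneOn (fun t => ‖Q t‖ ^ 2) (Icc 0 τ) := by
      refine antitoneOn_Icc_of_hasDerivAt (f' := fun t => 2 * (inner ℂ (Q t)
        (toL2 fun x => -advect (u t) (θ t) x) : ℂ).re) (hcont.norm.pow 2)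
        (fun t ht => hw.hasDerivAt_of_quadratic ht (Q t) fun s hs => ?_) fun t ht => le_of_eq ?_
      · replace hs := Ioo_subset_Icc_self hs
        replace ht := Ioo_subset_Icc_self ht
        have md : MemLp (fun x => θ s x - θ t x) 2 := (hθ s hs).memLp.sub (hθ t ht).memLp
        have hi : Integrable fun x => softThreshold M (θ s x) ^ 2 - softThreshold M (θ t x) ^ 2 :=
          (mQ s hs).integrable_sq.sub (mQ t ht).integrable_sq
        rw [← toL2_sub (hθ s hs).memLp (hθ t ht).memLp, norm_sq_toL2 (mQ s hs),
          norm_sq_toL2 (mQ t ht), norm_sq_toL2 md, inner_toL2 (mQ t ht) md, Complex.ofReal_re,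
          ← integral_const_mul, ← integral_sub (mQ s hs).integrable_sq (mQ t ht).integrable_sq,
          ← integral_sub hi ((integrable_mul_of_memLp (mQ t ht) md).const_mul 2)]
        refine abs_integral_le_integral_abs.trans
          (integral_mono_of_nonneg (.of_forall fun x => abs_nonneg _) md.integrable_sq
            (.of_forall fun x => ?_))
        exact abs_softThreshold_sq_sub_le hM (θ t x) (θ s x)
      · have ht' := Ioo_subset_Icc_self ht
        have hu := h.isSob_u (hsub ht')
        have mA : MemLp (advect (u t) (θ t)) 2 :=
          memLp_advect hu fun j => ((hθ t ht').pd j).memLp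
        rw [toL2_neg mA, inner_neg_right, inner_toL2 (mQ t ht') mA,
          integral_softThreshold_mul_advect hM hu (h.div_eq_zero t (hsub ht')) (hθ t ht')]
        simp
    have hle : ‖Q τ‖ ^ 2 ≤ ‖Q 0‖ ^ 2 := hanti ⟨le_rfl, h0.le⟩ ⟨h0.le, le_rfl⟩ h0.le
    rw [hQ0, norm_zero, zero_pow two_ne_zero] at hle
    exact norm_eq_zero.1 (pow_eq_zero_iff two_ne_zero |>.1 (le_antisymm hle (sq_nonneg _)))
  have hτ' : τ ∈ Icc 0 τ := ⟨hτ.1, le_rfl⟩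
  have hae : (fun x => softThreshold M (θ τ x)) =ᵐ[volume] fun _ => (0 : ℝ) := by
    filter_upwards [toL2_coeFn (mQ τ hτ'), (Lp.eq_zero_iff_ae_eq_zero).1 hQτ] with x h1 h2
    have : ((softThreshold M (θ τ x) : ℝ) : ℂ) = 0 := h1.symm.trans h2
    exact_mod_cast this
  -- Continuity of `θ τ` upgrades the almost everywhere bound to every point.
  have := (Continuous.ae_eq_iff_eq volume ((continuous_softThreshold M).comp
    (hθ τ hτ').continuous) continuous_const).1 hae
  exact (softThreshold_eq_zero hM).1 (congrFun this x)

end Solution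

/-! ### Continuity of the dissipation -/

lemma dissipation_nonneg (α : ℝ) (f : Plane → ℝ) : 0 ≤ dissipation α f :=
  integral_nonneg fun ξ => mul_nonneg (Real.rpow_nonneg (freq_nonneg ξ) _) (sq_nonneg _)

lemma integrable_dissipation {α : ℝ} {f : Plane → ℝ} (hf : MemLp f 2) {F : L2C}
    (hF : ⇑F =ᵐ[volume] fun ξ => ((freq ξ ^ (2 * α) : ℝ) : ℂ) * planeFourier f ξ) :
    Integrable fun ξ => freq ξ ^ (2 * α) * ‖planeFourier f ξ‖ ^ 2 := by
  refine ((Lp.memLp F).norm.integrable_mul (memLp_planeFourier hf).norm).congr ?_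
  filter_upwards [hF] with ξ h
  rw [Pi.mul_apply, h, norm_mul, Complex.norm_real,
    Real.norm_of_nonneg (Real.rpow_nonneg (freq_nonneg ξ) _)]
  ring

/-- Factor `|f̂|² - |ĝ|²` as a difference times a sum and put the whole weight `freq ^ (2α)` on the
sum: Lipschitz dependence in `L²` with constant given by `‖Λ^{2α}f‖₂ + ‖Λ^{2α}g‖₂`. -/
lemma abs_dissipation_sub_le {α : ℝ} {f g : Plane → ℝ} (hf : MemLp f 2) (hg : MemLp g 2)
    {F G : L2C} (hF : ⇑F =ᵐ[volume] fun ξ => ((freq ξ ^ (2 * α) : ℝ) : ℂ) * planeFourier f ξ)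
    (hG : ⇑G =ᵐ[volume] fun ξ => ((freq ξ ^ (2 * α) : ℝ) : ℂ) * planeFourier g ξ) :
    |dissipation α f - dissipation α g| ≤ (‖F‖ + ‖G‖) * ‖toL2 f - toL2 g‖ := by
  set H : L2C := 𝓕 (toL2 f) - 𝓕 (toL2 g) with hH
  have eH : ⇑H =ᵐ[volume] fun ξ => planeFourier f ξ - planeFourier g ξ := by
    rw [planeFourier_eq hf, planeFourier_eq hg]
    exact Lp.coeFn_sub _ _
  have nH : ‖H‖ = ‖toL2 f - toL2 g‖ := by
    have e : H = 𝓕 (toL2 f - toL2 g) :=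
      ((Lp.fourierTransformₗᵢ Plane ℂ).map_sub (toL2 f) (toL2 g)).symm
    rw [e, Lp.norm_fourier_eq]
  have i1 : Integrable fun ξ => ‖F ξ‖ * ‖H ξ‖ := (Lp.memLp F).norm.integrable_mul (Lp.memLp H).norm
  have i2 : Integrable fun ξ => ‖G ξ‖ * ‖H ξ‖ := (Lp.memLp G).norm.integrable_mul (Lp.memLp H).norm
  rw [dissipation, dissipation,
    ← integral_sub (integrable_dissipation hf hF) (integrable_dissipation hg hG), ← nH, add_mul]
  refine le_trans ?_ (add_le_add (integral_norm_mul_norm_le F H) (integral_norm_mul_norm_le G H))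
  rw [← integral_add i1 i2]
  refine abs_integral_le_integral_abs.trans
    (integral_mono_of_nonneg (.of_forall fun ξ => abs_nonneg _) (i1.add i2) ?_)
  filter_upwards [hF, hG, eH] with ξ h1 h2 h3
  have hr := Real.rpow_nonneg (freq_nonneg ξ) (2 * α)
  rw [h1, h2, h3, norm_mul, norm_mul, Complex.norm_real, Real.norm_of_nonneg hr, ← mul_sub,
    abs_mul, abs_of_nonneg hr, mul_assoc, mul_assoc, ← mul_add, ← add_mul]
  gcongr
  rw [sq_sub_sq, abs_mul, abs_of_nonneg (by positivity)]
  gcongr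
  exact abs_norm_sub_norm_le _ _

lemma exists_dissipation_symbol {α : ℝ} (hα : α ∈ Ioo (1 / 2 : ℝ) 1) {u : Fin 2 → Plane → ℝ}
    {θ : Plane → ℝ} (hu : ∀ j, IsSob (u j)) (hθ : IsSob θ) :
    ∃ F : L2C, (⇑F =ᵐ[volume]
        fun ξ => ((freq ξ ^ (2 * α) : ℝ) : ℂ) * planeFourier (goodVort α u θ) ξ) ∧
      ‖F‖ ≤ ‖toL2 (besselOp (vort u))‖
        + ((Real.Gamma α)⁻¹ * α⁻¹ + 1) * ‖toL2 (besselOp θ)‖ := by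
  have ha0 : 0 ≤ 2 * α := by linarith [hα.1]
  have ha : 2 * α ≤ 2 := by linarith [hα.2]
  have hΓ : 0 < Real.Gamma α := Real.Gamma_pos_of_pos (by linarith [hα.1])
  have hα0 : 0 < α := by linarith [hα.1]
  have h1 := fracLambda_sob ha0 ha (IsSob.vort hu)
  have h2 := fracLambda_sob ha0 ha hθ
  refine ⟨𝓕 (toL2 (fracLambda (2 * α) (vort u)))
    - 𝓕 (highOp hα (toL2 (fracLambda (2 * α) θ))), ?_, ?_⟩
  · have e1 := h1.2.2.1
    have e2 := h2.2.2.1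
    rw [planeFourier_eq h1.2.1] at e1
    rw [planeFourier_eq h2.2.1] at e2
    filter_upwards [Lp.coeFn_sub (𝓕 (toL2 (fracLambda (2 * α) (vort u))) : L2C)
      (𝓕 (highOp hα (toL2 (fracLambda (2 * α) θ)))), e1, e2,
      fourier_highOp hα (toL2 (fracLambda (2 * α) θ)), planeFourier_goodVort hα hu hθ]
      with ξ k k1 k2 k3 k4
    rw [k, Pi.sub_apply, k1, k3, k2, k4]
    ring
  · refine (norm_sub_le _ _).trans (add_le_add ?_ ?_)
    · rw [Lp.norm_fourier_eq]
      exact norm_toL2_fracLambda_le ha0 ha (IsSob.vort hu)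
    · rw [Lp.norm_fourier_eq]
      refine (norm_highOp_apply_le hα _).trans ?_
      gcongr
      exact norm_toL2_fracLambda_le ha0 ha hθ

/-- Uniform Sobolev bounds make the previous Lipschitz constants uniform in time, and `G` is
Lipschitz in `L²`. Continuity is needed to integrate the dissipation in Grönwall's inequality. -/
lemma IsComponentSolution.continuousOn_dissipation {α : ℝ} {T : EReal}
    {u : ℝ → Fin 2 → Plane → ℝ} {p θ : ℝ → Plane → ℝ} {τ : ℝ} (hα : α ∈ Ioo (1 / 2 : ℝ) 1)
    (h : IsComponentSolution α T u p θ) (hτ : τ ∈ timeInterval T) :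
    ContinuousOn (fun t => dissipation α (goodVort α (u t) (θ t))) (Icc 0 τ) := by
  rcases hτ.1.eq_or_lt with rfl | hτ0
  · rw [Icc_self]; exact continuousOn_singleton _ _
  have hα0 : 0 < α := by linarith [hα.1]
  have hΓ : 0 < Real.Gamma α := Real.Gamma_pos_of_pos hα0
  have hsub := Icc_subset_timeInterval hτ
  obtain ⟨C, hC, hw⟩ := h.hasWeakDeriv_goodVort hα hτ hτ0
  obtain ⟨B₁, hB₁, h₁⟩ := (h.unifSob_vort hτ).besselOp.norm_toL2_le
  obtain ⟨B₂, hB₂, h₂⟩ := (h.sobolev_θ τ hτ).besselOp.norm_toL2_le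
  set B := B₁ + ((Real.Gamma α)⁻¹ * α⁻¹ + 1) * B₂ with hB
  have hB0 : 0 ≤ B := by positivity
  have key : ∀ s ∈ Icc 0 τ, ∀ t ∈ Icc 0 τ,
      dist (dissipation α (goodVort α (u s) (θ s))) (dissipation α (goodVort α (u t) (θ t)))
        ≤ ((B + B) * C) * dist s t := by
    intro s hs t ht
    have hus := h.isSob_u (hsub hs)
    have hut := h.isSob_u (hsub ht)
    have hθs := h.isSob_θ (hsub hs)
    have hθt := h.isSob_θ (hsub ht)
    obtain ⟨F, hF, nF⟩ := exists_dissipation_symbol hα hus hθs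
    obtain ⟨G, hG, nG⟩ := exists_dissipation_symbol hα hut hθt
    have nF' : ‖F‖ ≤ B := nF.trans (by rw [hB]; gcongr; exacts [h₁ s hs, h₂ s hs])
    have nG' : ‖G‖ ≤ B := nG.trans (by rw [hB]; gcongr; exacts [h₁ t ht, h₂ t ht])
    rw [Real.dist_eq, Real.dist_eq, mul_assoc]
    refine (abs_dissipation_sub_le (memLp_goodVort hα hus hθs) (memLp_goodVort hα hut hθt)
      hF hG).trans ?_
    rw [toL2_goodVort hα hus hθs, toL2_goodVort hα hut hθt]
    gcongr
    exact hw.lipschitz t ht s hs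
  have : LipschitzOnWith (Real.toNNReal ((B + B) * C))
      (fun t => dissipation α (goodVort α (u t) (θ t))) (Icc 0 τ) := by
    refine LipschitzOnWith.of_dist_le_mul fun s hs t ht => (key s hs t ht).trans ?_
    gcongr
    exact Real.le_coe_toNNReal _
  exact this.continuousOn

/-! ### Grönwall's inequality with dissipation -/

/-- The function `exp(-Kt) z t + ∫₀ᵗ exp(-Ks) D s ds` is nonincreasing, and `exp(-Kτ) ≤ exp(-Ks)`
for `s ≤ τ` lets the weight be pulled out of the integral. -/
lemma gronwall_dissipation {z z' D : ℝ → ℝ} {τ K : ℝ} (hτ : 0 ≤ τ) (hK : 0 ≤ K)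
    (hz : ContinuousOn z (Icc 0 τ)) (hD : ContinuousOn D (Icc 0 τ))
    (hD0 : ∀ t ∈ Icc 0 τ, 0 ≤ D t) (hz' : ∀ t ∈ Ioo 0 τ, HasDerivAt z (z' t) t)
    (hle : ∀ t ∈ Ioo 0 τ, z' t ≤ -D t + K * z t) :
    z τ + ∫ t in 0..τ, D t ≤ Real.exp (K * τ) * z 0 := by
  -- Constant extension of `D` beyond the interval makes the integrand continuous on the line, so
  -- its primitive is differentiable everywhere.
  set E : ℝ → ℝ := IccExtend hτ ((Icc 0 τ).domRestrict D) with hE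
  have cE : Continuous E := (continuousOn_iff_continuous_domRestrict.1 hD).Icc_extend'
  have eE : ∀ t ∈ Icc 0 τ, E t = D t := fun t ht => by
    rw [hE, IccExtend_of_mem hτ _ ht]; rfl
  have cI : Continuous fun s => Real.exp (-(K * s)) * E s := by fun_prop
  have hanti : AntitoneOn (fun t => Real.exp (-(K * t)) * z t
      + ∫ s in 0..t, Real.exp (-(K * s)) * E s) (Icc 0 τ) := by
    refine antitoneOn_Icc_of_hasDerivAt (f' := fun t => (Real.exp (-(K * t)) * (-(K * 1)) * z t
      + Real.exp (-(K * t)) * z' t) + Real.exp (-(K * t)) * E t) ?_ (fun t ht => ?_) fun t ht => ?_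
    · refine ContinuousOn.add (ContinuousOn.mul (by fun_prop) hz) (Continuous.continuousOn ?_)
      exact intervalIntegral.continuous_primitive (fun a b => cI.intervalIntegrable a b) 0
    · refine HasDerivAt.add (HasDerivAt.mul ?_ (hz' t ht)) (cI.integral_hasStrictDerivAt 0 t).hasDerivAt
      exact (((hasDerivAt_id t).const_mul K).neg).exp
    · have h1 := hle t ht
      rw [eE t (Ioo_subset_Icc_self ht)]
      have : Real.exp (-(K * t)) * (-(K * 1)) * z t + Real.exp (-(K * t)) * z' t
          + Real.exp (-(K * t)) * D t = Real.exp (-(K * t)) * (z' t - (-D t + K * z t)) := by ring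
      rw [this]
      exact mul_nonpos_of_nonneg_of_nonpos (Real.exp_pos _).le (by linarith)
  have h1 := hanti ⟨le_rfl, hτ⟩ ⟨hτ, le_rfl⟩ hτ
  simp only [mul_zero, neg_zero, Real.exp_zero, one_mul, intervalIntegral.integral_same,
    add_zero] at h1
  have h2 : Real.exp (-(K * τ)) * ∫ t in 0..τ, D t ≤ ∫ s in 0..τ, Real.exp (-(K * s)) * E s := by
    rw [← intervalIntegral.integral_const_mul]
    refine intervalIntegral.integral_mono_on hτ ?_ (cI.intervalIntegrable _ _) fun s hs => ?_
    · exact (hD.intervalIntegrable_of_Icc hτ).const_mul _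
    · rw [eE s hs]
      gcongr
      · exact hD0 s hs
      · exact hs.2
  have h3 : Real.exp (-(K * τ)) * (z τ + ∫ t in 0..τ, D t) ≤ z 0 := by
    rw [mul_add]; linarith
  have h4 := mul_le_mul_of_nonneg_left h3 (Real.exp_pos (K * τ)).le
  rwa [← mul_assoc, ← Real.exp_add, add_neg_cancel, Real.exp_zero, one_mul] at h4

/-! ### The energy estimate -/

/-- The norm of the truncated multiplier. -/
def highConst (α : ℝ) : ℝ := (Real.Gamma α)⁻¹ * α⁻¹ + 1

/-- The norm of the remainder of the truncation, relative to `|2πξ|^{-α}`. -/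
def lowConst (α : ℝ) : ℝ := 1 + (Real.Gamma α)⁻¹

/-- The rate in the energy estimate. -/
def energyRate (α M : ℝ) : ℝ :=
  lowConst α + 8 * commutatorConst α * M + 4 * commutatorConst α * highConst α * M

lemma highConst_pos {α : ℝ} (hα : α ∈ Ioo (1 / 2 : ℝ) 1) : 0 < highConst α := by
  have hα0 : 0 < α := by linarith [hα.1]
  have hΓ : 0 < Real.Gamma α := Real.Gamma_pos_of_pos hα0
  unfold highConst; positivity

lemma one_le_lowConst {α : ℝ} (hα : α ∈ Ioo (1 / 2 : ℝ) 1) : 1 ≤ lowConst α := by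
  have hΓ : 0 < Real.Gamma α := Real.Gamma_pos_of_pos (by linarith [hα.1])
  have : 0 < (Real.Gamma α)⁻¹ := by positivity
  unfold lowConst; linarith

lemma one_le_energyRate {α M : ℝ} (hα : α ∈ Ioo (1 / 2 : ℝ) 1) (hM : 0 ≤ M) :
    1 ≤ energyRate α M := by
  have h1 := one_le_lowConst hα
  have h2 := highConst_pos hα
  have h3 := commutatorConst_pos hα
  have : 0 ≤ 8 * commutatorConst α * M + 4 * commutatorConst α * highConst α * M := by positivity
  unfold energyRate; linarith

lemma norm_vort_le {α : ℝ} (hα : α ∈ Ioo (1 / 2 : ℝ) 1) {u : Fin 2 → Plane → ℝ}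
    {θ : Plane → ℝ} (hu : ∀ j, IsSob (u j)) (hθ : IsSob θ) :
    ‖toL2 (vort u)‖ ≤ ‖toL2 (goodVort α u θ)‖ + highConst α * ‖toL2 θ‖ := by
  have e : toL2 (vort u) = toL2 (goodVort α u θ) + highOp hα (toL2 θ) := by
    rw [toL2_goodVort hα hu hθ, sub_add_cancel]
  rw [e]
  exact (norm_add_le _ _).trans (by gcongr; exact norm_highOp_apply_le hα _)

lemma norm_goodVort_le {α : ℝ} (hα : α ∈ Ioo (1 / 2 : ℝ) 1) {u : Fin 2 → Plane → ℝ}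
    {θ : Plane → ℝ} (hu : ∀ j, IsSob (u j)) (hθ : IsSob θ) :
    ‖toL2 (goodVort α u θ)‖ ≤ ‖toL2 (vort u)‖ + highConst α * ‖toL2 θ‖ := by
  rw [toL2_goodVort hα hu hθ]
  exact (norm_sub_le _ _).trans (by gcongr; exact norm_highOp_apply_le hα _)

/-- The inequality closes: `‖∇u‖₂` is bounded by `‖G‖₂` and `M`, and `M` bounds both norms of `θ`.
The products `2‖G‖₂M` become `‖G‖₂² + M²`, which gives the three summands of `energyRate`. -/
lemma inner_goodVort_le_energyRate {α : ℝ} (hα : α ∈ Ioo (1 / 2 : ℝ) 1) {u : Fin 2 → Plane → ℝ}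
    {θ : Plane → ℝ} (hu : ∀ j, IsSob (u j)) (hθ : IsSob θ)
    (hdiv : ∀ x, pd 0 (u 0) x + pd 1 (u 1) x = 0) {M : ℝ} (hM0 : 0 ≤ M) (hM : ∀ x, |θ x| ≤ M)
    (hM2 : ‖toL2 θ‖ ≤ M) :
    2 * (inner ℂ (toL2 (goodVort α u θ))
        (toL2 (vortRHS α u θ) + highOp hα (toL2 (advect u θ))) : ℂ).re
      ≤ -(2 * dissipation α (goodVort α u θ))
        + energyRate α M * (‖toL2 (goodVort α u θ)‖ ^ 2 + M ^ 2) := by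
  have h := inner_goodVort_le hα hu hθ hdiv hM
  have hg := gradNorm_le_vort hu hdiv
  have hv := norm_vort_le hα hu hθ
  have h1 := one_le_lowConst hα
  have h2 := highConst_pos hα
  have h3 := commutatorConst_pos hα
  rw [← lowConst] at h
  set y := ‖toL2 (goodVort α u θ)‖
  have hy : 0 ≤ y := norm_nonneg _
  have a1 : lowConst α * (y * ‖toL2 θ‖) ≤ lowConst α * (y * M) := by gcongr
  have a2 : commutatorConst α * M * y * gradNorm u
      ≤ commutatorConst α * M * y * (4 * (y + highConst α * M)) := by
    gcongr
    refine hg.trans ?_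
    gcongr
    exact hv.trans (by gcongr)
  have a3 : 2 * (y * M) ≤ y ^ 2 + M ^ 2 := by nlinarith [sq_nonneg (y - M)]
  have a4 : lowConst α * (2 * (y * M)) ≤ lowConst α * (y ^ 2 + M ^ 2) := by gcongr
  have a5 : 4 * commutatorConst α * highConst α * M * (2 * (y * M))
      ≤ 4 * commutatorConst α * highConst α * M * (y ^ 2 + M ^ 2) := by gcongr
  have a6 : 0 ≤ 8 * commutatorConst α * M * M ^ 2 := by positivity
  unfold energyRate
  nlinarith

/-- Grönwall is applied to `‖G‖₂² + M²`: adding the constant absorbs the inhomogeneous term into the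
linear one. -/
lemma IsComponentSolution.energy_le {α : ℝ} {T : EReal}
    {u : ℝ → Fin 2 → Plane → ℝ} {p θ : ℝ → Plane → ℝ} {τ M : ℝ} (hα : α ∈ Ioo (1 / 2 : ℝ) 1)
    (h : IsComponentSolution α T u p θ) (hτ : τ ∈ timeInterval T) (hM : 0 ≤ M)
    (h₀ : ∀ᵐ x, |θ 0 x| ≤ M) (h₂ : ‖toL2 (θ 0)‖ ≤ M) :
    ‖toL2 (goodVort α (u τ) (θ τ))‖ ^ 2
        + ∫ t in 0..τ, 2 * dissipation α (goodVort α (u t) (θ t))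
      ≤ Real.exp (energyRate α M * τ) * (‖toL2 (goodVort α (u 0) (θ 0))‖ ^ 2 + M ^ 2) := by
  rcases hτ.1.eq_or_lt with rfl | hτ0
  · simp [sq_nonneg]
  have hsub := Icc_subset_timeInterval hτ
  obtain ⟨C, -, hw⟩ := h.hasWeakDeriv_goodVort hα hτ hτ0
  have eG : ∀ t ∈ Icc 0 τ, toL2 (goodVort α (u t) (θ t))
      = toL2 (vort (u t)) - highOp hα (toL2 (θ t)) := fun t ht =>
    toL2_goodVort hα (h.isSob_u (hsub ht)) (h.isSob_θ (hsub ht))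
  have key := gronwall_dissipation (K := energyRate α M)
    (z := fun t => ‖toL2 (vort (u t)) - highOp hα (toL2 (θ t))‖ ^ 2 + M ^ 2)
    (D := fun t => 2 * dissipation α (goodVort α (u t) (θ t))) hτ0.le
    (zero_le_one.trans (one_le_energyRate hα hM)) ((hw.continuousOn.norm.pow 2).add_const _)
    ((h.continuousOn_dissipation hα hτ).const_mul 2)
    (fun t _ => mul_nonneg zero_le_two (dissipation_nonneg _ _))
    (fun t ht => (hw.hasDerivAt_norm_sq ht).add_const (M ^ 2)) fun t ht => ?_
  · rw [← eG 0 ⟨le_rfl, hτ0.le⟩, ← eG τ ⟨hτ0.le, le_rfl⟩] at key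
    nlinarith [sq_nonneg M]
  · have ht' := hsub (Ioo_subset_Icc_self ht)
    have hu := h.isSob_u ht'
    have hθ := h.isSob_θ ht'
    have mA : MemLp (advect (u t) (θ t)) 2 := memLp_advect hu fun j => (hθ.pd j).memLp
    rw [← eG t (Ioo_subset_Icc_self ht), toL2_neg mA, map_neg, sub_neg_eq_add]
    exact inner_goodVort_le_energyRate hα hu hθ (h.div_eq_zero t ht') hM
      (h.abs_θ_le ht' hM h₀) ((h.norm_toL2_θ_le ht').trans h₂)

/-! ### The homogeneous Sobolev norm -/

/-- The symbol `2πi ξ₁ |2πξ|^{-2α}` of the operator `Λ^{-2α} ∂₁`. -/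
def rieszSymbol (α : ℝ) (ξ : Plane) : ℂ := derivSymbol 0 ξ * ((freq ξ ^ (-(2 * α)) : ℝ) : ℂ)

lemma rieszOp_eq (α : ℝ) (f : Plane → ℝ) : rieszOp α f = fourierMultiplier (rieszSymbol α) f := by
  unfold rieszOp
  congr 1
  funext ξ
  rw [rieszSymbol, derivSymbol, freq]
  push_cast
  ring

lemma rieszSymbol_neg (α : ℝ) (ξ : Plane) : rieszSymbol α (-ξ) = conj (rieszSymbol α ξ) := by
  simp [rieszSymbol, conj_derivSymbol, derivSymbol_neg, freq]

lemma measurable_rieszSymbol (α : ℝ) : Measurable (rieszSymbol α) := by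
  have h1 := (continuous_derivSymbol 0).measurable
  have h2 := continuous_freq.measurable
  unfold rieszSymbol
  fun_prop

lemma norm_rieszSymbol_le (α : ℝ) {ξ : Plane} (hξ : 0 < freq ξ) :
    ‖rieszSymbol α ξ‖ ≤ freq ξ ^ (1 - 2 * α) := by
  rw [rieszSymbol, norm_mul, Complex.norm_real,
    Real.norm_of_nonneg (Real.rpow_nonneg hξ.le _), sub_eq_add_neg, Real.rpow_add hξ, Real.rpow_one]
  gcongr
  exact norm_derivSymbol_le_freq 0 ξ

/-- Near the origin the square is of size `|ξ|^{2-4α}`, integrable in the plane because `α < 1`.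
Away from it the symbol is bounded by `1` as `α > 1/2`, and `bracket⁻¹` is square integrable. -/
lemma memLp_rieszSymbol {α : ℝ} (hα : α ∈ Ioo (1 / 2 : ℝ) 1) :
    MemLp (fun ξ => rieszSymbol α ξ * ((bracket ξ ^ 1 : ℝ) : ℂ)⁻¹) 2
      (volume : Measure Plane) := by
  have hms : AEStronglyMeasurable (fun ξ => rieszSymbol α ξ * ((bracket ξ ^ 1 : ℝ) : ℂ)⁻¹)
      (volume : Measure Plane) := by
    have := measurable_rieszSymbol α
    have := continuous_bracket.measurable
    exact Measurable.aestronglyMeasurable (by fun_prop)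
  rw [memLp_two_iff_integrable_sq_norm hms]
  have hb : ∀ ξ, ‖(((bracket ξ ^ 1 : ℝ) : ℂ))⁻¹‖ ≤ 1 := fun ξ => by
    rw [norm_inv, Complex.norm_real, pow_one, Real.norm_of_nonneg (bracket_pos ξ).le]
    exact inv_le_one_of_one_le₀ (one_le_bracket ξ)
  rw [← integrableOn_univ, ← union_compl_self (Metric.ball (0 : Plane) 1)]
  refine IntegrableOn.union ?_ ?_
  · refine integrableOn_ball_of_norm_le_rpow (C := (2 * Real.pi) ^ (2 - 4 * α)) (α := 4 * α - 2)
      (by simp) (by simp; linarith [hα.2]) (.of_forall fun ξ => ?_) (hms.norm.pow 2)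
    rcases eq_or_ne ξ 0 with rfl | hξ
    · have : rieszSymbol α 0 = 0 := by simp [rieszSymbol, derivSymbol]
      simp only [this, zero_mul, norm_zero, zero_pow two_ne_zero]
      exact mul_nonneg (by positivity) (Real.rpow_nonneg le_rfl _)
    have hf : 0 < freq ξ := by unfold freq; positivity
    rw [norm_pow, norm_norm, norm_mul]
    calc (‖rieszSymbol α ξ‖ * ‖(((bracket ξ ^ 1 : ℝ) : ℂ))⁻¹‖) ^ 2
        ≤ (freq ξ ^ (1 - 2 * α) * 1) ^ 2 := by
          gcongr
          · exact norm_rieszSymbol_le α hf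
          · exact hb ξ
      _ = (2 * Real.pi) ^ (2 - 4 * α) * ‖ξ‖ ^ (-(4 * α - 2)) := by
          rw [mul_one, ← Real.rpow_natCast, ← Real.rpow_mul hf.le, freq,
            Real.mul_rpow (by positivity) (norm_nonneg _)]
          congr 2 <;> push_cast <;> ring
  · have h := (memLp_two_iff_integrable_sq_norm memLp_inv_bracket.aestronglyMeasurable).1
      memLp_inv_bracket
    refine Integrable.mono' h.integrableOn (hms.norm.pow 2).restrict ?_
    filter_upwards [ae_restrict_mem Metric.isOpen_ball.measurableSet.compl] with ξ hξ
    have h1 : 1 ≤ ‖ξ‖ := by simpa using hξ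
    have hf : 1 ≤ freq ξ := by
      unfold freq
      nlinarith [Real.pi_gt_three]
    rw [norm_pow, norm_norm, norm_mul, pow_one]
    gcongr
    refine mul_le_of_le_one_left (norm_nonneg _) ?_
    exact (norm_rieszSymbol_le α (by linarith)).trans
      (Real.rpow_le_one_of_one_le_of_nonpos hf (by linarith [hα.1]))

lemma IsFourierTransform.sub {f g : Plane → ℝ} {F G : Plane → ℂ} (hf : IsFourierTransform f F)
    (hg : IsFourierTransform g G) :
    IsFourierTransform (fun x => f x - g x) (fun ξ => F ξ - G ξ) where
  locallyIntegrable := hf.locallyIntegrable.sub hg.locallyIntegrable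
  integrable_left φ := by
    refine ((hf.integrable_left φ).sub (hg.integrable_left φ)).congr (.of_forall fun x => ?_)
    simp [sub_mul]
  integrable_right φ := by
    refine ((hf.integrable_right φ).sub (hg.integrable_right φ)).congr (.of_forall fun x => ?_)
    simp [sub_mul]
  integral_eq φ := by
    simp only [Complex.ofReal_sub, sub_mul]
    rw [integral_sub (hf.integrable_left φ) (hg.integrable_left φ),
      integral_sub (hf.integrable_right φ) (hg.integrable_right φ), hf.integral_eq, hg.integral_eq]

lemma isFourierTransform_planeFourier {f : Plane → ℝ} (hf : MemLp f 2) :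
    IsFourierTransform f (planeFourier f) where
  locallyIntegrable := (memLp_planeFourier hf).locallyIntegrable (by norm_num)
  integrable_left φ := hf.ofReal.integrable_mul ((𝓕 φ).memLp 2)
  integrable_right φ := (memLp_planeFourier hf).integrable_mul (φ.memLp 2)
  integral_eq φ := planeFourier_pairing hf φ

/-- Only integrability of `m f̂` is assumed, so the result is bounded but need not lie in `L²`. This
is the case of `R_{2α}θ`, whose symbol is singular at low frequencies, and the reason for working
with tempered distributions. -/
lemma isFourierTransform_fourierMultiplier {m : Plane → ℂ} {f : Plane → ℝ} (hf : MemLp f 2)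
    (hm : ∀ ξ, m (-ξ) = conj (m ξ)) (hi : Integrable fun ξ => m ξ * planeFourier f ξ) :
    IsFourierTransform (fourierMultiplier m f) (fun ξ => m ξ * planeFourier f ξ) where
  locallyIntegrable := hi.locallyIntegrable
  integrable_left φ := by
    simp only [ofReal_fourierMultiplier hf hm]
    exact (𝓕 φ).integrable.bdd_mul (continuous_fourierInv hi).aestronglyMeasurable
      (.of_forall fun x => norm_fourierInv_le _ x)
  integrable_right φ := hi.mul_bdd (c := SchwartzMap.seminorm ℂ 0 0 φ)
    φ.continuous.aestronglyMeasurable (.of_forall fun x => SchwartzMap.norm_le_seminorm ℂ φ x)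
  integral_eq φ := by
    simp only [ofReal_fourierMultiplier hf hm]
    rw [integral_fourierInv_mul hi (𝓕 φ), FourierTransform.fourierInv_fourier_eq]

/-- Here `K` is exchanged for `R_{2α}`: `ω - R_{2α}θ = G - (R_{2α} - K)θ`, and `Λ^α(R_{2α} - K)` is
bounded on `L²` by `lowConst`. The factors `2` come from squaring a sum. -/
lemma homSobolevNorm_sq_le {α : ℝ} (hα : α ∈ Ioo (1 / 2 : ℝ) 1) {u : Fin 2 → Plane → ℝ}
    {θ : Plane → ℝ} (hu : ∀ j, IsSob (u j)) (hθ : IsSob θ) :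
    homSobolevNorm α (fun x => vort u x - rieszOp α θ x) ^ 2
      ≤ ENNReal.ofReal (2 * dissipation α (goodVort α u θ)
        + 2 * (lowConst α * ‖toL2 θ‖) ^ 2) := by
  have hα0 : 0 < α := by linarith [hα.1]
  have hFT : IsFourierTransform (fun x => vort u x - rieszOp α θ x)
      (fun ξ => planeFourier (vort u) ξ - rieszSymbol α ξ * planeFourier θ ξ) := by
    rw [rieszOp_eq]
    exact (isFourierTransform_planeFourier (IsSob.vort hu).memLp).sub
      (isFourierTransform_fourierMultiplier hθ.memLp (rieszSymbol_neg α)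
        (hθ.integrable_mul_of_memLp 1 (memLp_rieszSymbol hα)))
  have h1 := memLp_rpow_mul_planeFourier_goodVort hα hu hθ hα0.le (by linarith [hα.2] : α ≤ 2)
  set m : Plane → ℂ := fun ξ => ((freq ξ ^ α : ℝ) : ℂ) * (rieszSymbol α ξ - highSymbol α ξ) with hm
  have hmb : ∀ ξ, ‖m ξ‖ ≤ lowConst α := norm_rpow_mul_symbol_sub_le hα
  have hmm : AEStronglyMeasurable m (volume : Measure Plane) :=
    (Complex.continuous_ofReal.comp
      (continuous_freq.rpow_const fun _ => Or.inr hα0.le)).aestronglyMeasurable.mul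
      ((measurable_rieszSymbol α).aestronglyMeasurable.sub aestronglyMeasurable_highSymbol)
  have h2 : MemLp (fun ξ => m ξ * planeFourier θ ξ) 2 :=
    hθ.memLp_mul hmm (C := lowConst α) (n := 0) (by simpa using hmb)
  have n1 : ‖h1.toLp‖ ^ 2 = dissipation α (goodVort α u θ) := by
    rw [norm_sq_L2C, dissipation]
    refine integral_congr_ae ?_
    filter_upwards [h1.coeFn_toLp] with ξ k
    rw [k, norm_mul, Complex.norm_real, Real.norm_of_nonneg (Real.rpow_nonneg (freq_nonneg ξ) _),
      mul_pow, ← Real.rpow_natCast, ← Real.rpow_mul (freq_nonneg ξ)]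
    congr 2
    push_cast; ring
  have n2 : ‖h2.toLp‖ ≤ lowConst α * ‖toL2 θ‖ := by
    rw [← Lp.norm_fourier_eq (toL2 θ)]
    refine Lp.norm_le_mul_norm_of_ae_le_mul ?_
    rw [← planeFourier_eq hθ.memLp]
    filter_upwards [h2.coeFn_toLp] with ξ k
    rw [k, norm_mul]
    gcongr
    exact hmb ξ
  have e : eLpNorm (fun ξ => (2 * Real.pi * ‖ξ‖) ^ α •
      (planeFourier (vort u) ξ - rieszSymbol α ξ * planeFourier θ ξ)) 2 volume
      = ENNReal.ofReal ‖h1.toLp - h2.toLp‖ := by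
    rw [← MemLp.toLp_sub, Lp.norm_toLp, ENNReal.ofReal_toReal (h1.sub h2).2.ne]
    refine eLpNorm_congr_ae ?_
    filter_upwards [planeFourier_goodVort hα hu hθ] with ξ k
    rw [Pi.sub_apply, k, Complex.real_smul]
    simp only [hm, freq]
    ring
  calc homSobolevNorm α (fun x => vort u x - rieszOp α θ x) ^ 2
      ≤ ENNReal.ofReal ‖h1.toLp - h2.toLp‖ ^ 2 := by
        gcongr
        rw [← e]
        -- An upper bound for the infimum needs only one admissible transform; its uniqueness plays
        -- no role.
        exact iInf₂_le _ hFT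
    _ = ENNReal.ofReal (‖h1.toLp - h2.toLp‖ ^ 2) := (ENNReal.ofReal_pow (norm_nonneg _) 2).symm
    _ ≤ _ := by
        refine ENNReal.ofReal_le_ofReal ?_
        rw [← n1]
        have a1 := norm_sub_le h1.toLp h2.toLp
        have a2 : ‖h2.toLp‖ ^ 2 ≤ (lowConst α * ‖toL2 θ‖) ^ 2 := by gcongr
        have a3 : ‖h1.toLp - h2.toLp‖ ^ 2 ≤ (‖h1.toLp‖ + ‖h2.toLp‖) ^ 2 := by gcongr
        nlinarith [sq_nonneg (‖h1.toLp‖ - ‖h2.toLp‖)]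

/-! ### The a priori estimate -/

lemma norm_toL2_vort_le {v : Plane → Plane} (hv : Differentiable ℝ v)
    (hs : IsSob (vort fun j x => v x j)) {M : ℝ≥0} (hM : eLpNorm (fderiv ℝ v) 2 volume ≤ M) :
    ‖toL2 (vort fun j x => v x j)‖ ≤ 2 * M := by
  rw [norm_toL2 hs.memLp, ← vorticity_eq_vort hv]
  refine ENNReal.toReal_le_of_le_ofReal (by positivity) ?_
  have h : ∀ x, ‖vorticity v x‖ ≤ 2 * ‖fderiv ℝ v x‖ := fun x => by
    have hb : ∀ i j, ‖fderiv ℝ v x (basisVec i) j‖ ≤ ‖fderiv ℝ v x‖ := fun i j => by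
      refine (PiLp.norm_apply_le _ j).trans ?_
      simpa [norm_basisVec] using (fderiv ℝ v x).le_opNorm (basisVec i)
    rw [vorticity]
    linarith [norm_sub_le (fderiv ℝ v x (basisVec 0) 1) (fderiv ℝ v x (basisVec 1) 0),
      hb 0 1, hb 1 0]
  refine (eLpNorm_le_mul_eLpNorm_of_ae_le_mul (.of_forall h) 2).trans ?_
  rw [ENNReal.ofReal_mul zero_le_two, ENNReal.ofReal_coe_nnreal]
  gcongr

/-- The constant in the a priori estimate. -/
def energyConst (α M : ℝ) : ℝ :=
  2 * ((2 * M + highConst α * M) ^ 2 + M ^ 2) + 2 * (highConst α * M) ^ 2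
    + 2 * (lowConst α * M) ^ 2 + 1

lemma energyConst_pos (α M : ℝ) : 0 < energyConst α M := by
  unfold energyConst; positivity

/-- In `energyConst`, the first summand is twice the initial energy, with `‖G(0)‖₂ ≤ 2M +
highConst·M`. The second comes from recovering `ω = G + Kθ`, and the third from the low-frequency
error integrated in time, with `t ≤ exp(energyRate·t)` since the rate is at least `1`. The final `1`
keeps the constant positive when `M = 0`. -/
lemma IsComponentSolution.vort_estimate {α : ℝ} {T : EReal}
    {u : ℝ → Fin 2 → Plane → ℝ} {p θ : ℝ → Plane → ℝ} {t M : ℝ} (hα : α ∈ Ioo (1 / 2 : ℝ) 1)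
    (h : IsComponentSolution α T u p θ) (ht : t ∈ timeInterval T) (hM : 0 ≤ M)
    (hv : ‖toL2 (vort (u 0))‖ ≤ 2 * M) (h₀ : ∀ᵐ x, |θ 0 x| ≤ M) (h₂ : ‖toL2 (θ 0)‖ ≤ M) :
    eLpNorm (vort (u t)) 2 volume ^ 2
        + ∫⁻ s in Icc 0 t, homSobolevNorm α (fun x => vort (u s) x - rieszOp α (θ s) x) ^ 2
      ≤ ENNReal.ofReal (energyConst α M * Real.exp (energyRate α M * t)) := by
  have hsub := Icc_subset_timeInterval ht
  have h0t : (0 : ℝ) ∈ Icc 0 t := ⟨le_rfl, ht.1⟩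
  have hk := highConst_pos hα
  have hl := one_le_lowConst hα
  have hK := one_le_energyRate hα hM
  set A := 2 * (lowConst α * M) ^ 2 with hA
  set D : ℝ → ℝ := fun s => 2 * dissipation α (goodVort α (u s) (θ s)) with hD
  have cD : ContinuousOn D (Icc 0 t) := (h.continuousOn_dissipation hα ht).const_mul 2
  have hinteg : IntervalIntegrable D volume 0 t := cD.intervalIntegrable_of_Icc ht.1
  have hθ : ∀ s ∈ Icc 0 t, ‖toL2 (θ s)‖ ≤ M := fun s hs => (h.norm_toL2_θ_le (hsub hs)).trans h₂
  have e1 : eLpNorm (vort (u t)) 2 volume ^ 2 = ENNReal.ofReal (‖toL2 (vort (u t))‖ ^ 2) := by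
    rw [eLpNorm_eq_ofReal_toL2 (IsSob.vort (h.isSob_u ht)).memLp,
      ENNReal.ofReal_pow (norm_nonneg _)]
  have e2 : ∫⁻ s in Icc 0 t, homSobolevNorm α (fun x => vort (u s) x - rieszOp α (θ s) x) ^ 2
      ≤ ENNReal.ofReal ((∫ s in 0..t, D s) + A * t) := by
    have hcont : ContinuousOn (fun s => D s + A) (Icc 0 t) := cD.add continuousOn_const
    have e3 : (∫ s in 0..t, D s) + A * t = ∫ s in Icc 0 t, (D s + A) := by
      rw [integral_Icc_eq_integral_Ioc, ← intervalIntegral.integral_of_le ht.1,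
        intervalIntegral.integral_add hinteg (by simp)]
      simp [mul_comm]
    rw [e3, ofReal_integral_eq_lintegral_ofReal (hcont.integrableOn_compact isCompact_Icc)
      (.of_forall fun s => add_nonneg (mul_nonneg zero_le_two (dissipation_nonneg _ _))
        (by positivity))]
    refine setLIntegral_mono' measurableSet_Icc fun s hs => ?_
    refine (homSobolevNorm_sq_le hα (h.isSob_u (hsub hs)) (h.isSob_θ (hsub hs))).trans
      (ENNReal.ofReal_le_ofReal ?_)
    simp only [hD, hA]
    gcongr
    exact hθ s hs
  rw [e1]
  refine (add_le_add le_rfl e2).trans ?_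
  have hDint : 0 ≤ ∫ s in 0..t, D s :=
    intervalIntegral.integral_nonneg ht.1 fun s _ =>
      mul_nonneg zero_le_two (dissipation_nonneg _ _)
  have htA : 0 ≤ A * t := mul_nonneg (by positivity) ht.1
  rw [← ENNReal.ofReal_add (sq_nonneg _) (by positivity)]
  refine ENNReal.ofReal_le_ofReal ?_
  have hE := h.energy_le hα ht hM h₀ h₂
  have hg := norm_goodVort_le hα (h.isSob_u (hsub h0t)) (h.isSob_θ (hsub h0t))
  have hw := norm_vort_le hα (h.isSob_u ht) (h.isSob_θ ht)
  set e := Real.exp (energyRate α M * t) with he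
  have he1 : 1 ≤ e := Real.one_le_exp (mul_nonneg (by linarith) ht.1)
  have het : t ≤ e := by
    have := Real.add_one_le_exp (energyRate α M * t)
    nlinarith [ht.1]
  have hg' : ‖toL2 (goodVort α (u 0) (θ 0))‖ ^ 2 ≤ (2 * M + highConst α * M) ^ 2 := by
    gcongr
    exact hg.trans (by gcongr)
  have hw' : ‖toL2 (vort (u t))‖ ^ 2
      ≤ 2 * ‖toL2 (goodVort α (u t) (θ t))‖ ^ 2 + 2 * (highConst α * M) ^ 2 := by
    have : ‖toL2 (vort (u t))‖ ≤ ‖toL2 (goodVort α (u t) (θ t))‖ + highConst α * M :=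
      hw.trans (by gcongr; exact hθ t ⟨ht.1, le_rfl⟩)
    have := pow_le_pow_left₀ (norm_nonneg _) this 2
    nlinarith [sq_nonneg (‖toL2 (goodVort α (u t) (θ t))‖ - highConst α * M)]
  have hE' : e * (‖toL2 (goodVort α (u 0) (θ 0))‖ ^ 2 + M ^ 2)
      ≤ e * ((2 * M + highConst α * M) ^ 2 + M ^ 2) := by gcongr
  have b1 : A * t ≤ A * e := by gcongr
  have b2 : 2 * (highConst α * M) ^ 2 * 1 ≤ 2 * (highConst α * M) ^ 2 * e := by gcongr
  have hgo : energyConst α M * e = 2 * (e * ((2 * M + highConst α * M) ^ 2 + M ^ 2))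
      + 2 * (highConst α * M) ^ 2 * e + A * e + e := by
    rw [energyConst, hA]; ring
  rw [hgo]
  linarith

end Boussinesq

end

/-- The constants are fixed before the solution and depend on `α` and `M` alone. What remains is to
pass to components and to turn the bounds on the data into those of `vort_estimate`; the value `2M`
there comes from `|ω| ≤ 2|∇u|`. -/
theorem mainTheorem8 (α : ℝ) (hα : α ∈ Set.Ioo (1 / 2 : ℝ) 1) (M : ℝ≥0) :
    ∃ C₀ C₁ : ℝ, 0 < C₀ ∧ 0 < C₁ ∧
      ∀ (T : EReal) (u₀ : Boussinesq.Plane → Boussinesq.Plane) (θ₀ : Boussinesq.Plane → ℝ)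
        (u : ℝ → Boussinesq.Plane → Boussinesq.Plane) (p θ : ℝ → Boussinesq.Plane → ℝ),
        Boussinesq.IsSmoothSolution α T u₀ θ₀ u p θ →
        eLpNorm u₀ 2 volume ≤ M → eLpNorm (fderiv ℝ u₀) 2 volume ≤ M →
        eLpNorm θ₀ 2 volume ≤ M → eLpNorm θ₀ ⊤ volume ≤ M →
        ∀ t ∈ Boussinesq.timeInterval T,
          eLpNorm (Boussinesq.vorticity (u t)) 2 volume ^ 2
            + ∫⁻ s in Set.Icc 0 t, Boussinesq.homSobolevNorm α
                (fun x => Boussinesq.vorticity (u s) x - Boussinesq.rieszOp α (θ s) x) ^ 2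
          ≤ ENNReal.ofReal (C₀ * Real.exp (C₁ * t)) := by
  refine ⟨Boussinesq.energyConst α M, Boussinesq.energyRate α M, Boussinesq.energyConst_pos α M,
    one_pos.trans_le (Boussinesq.one_le_energyRate hα M.2), ?_⟩
  intro T u₀ θ₀ u p θ h _ hu₁ hθ₂ hθ₃ t ht
  have hc := h.isComponentSolution
  have h0 : (0 : ℝ) ∈ Boussinesq.timeInterval T := ⟨le_rfl, by simpa using h.lifespan_pos⟩
  have hd : ∀ s ∈ Boussinesq.timeInterval T, Differentiable ℝ (u s) := fun s hs =>
    (Boussinesq.contDiff_slice h.smooth_u hs).differentiable (by simp)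
  have e : ∀ s ∈ Boussinesq.timeInterval T,
      Boussinesq.vorticity (u s) = Boussinesq.vort fun j x => u s x j := fun s hs =>
    Boussinesq.vorticity_eq_vort (hd s hs)
  rw [← h.initial_u] at hu₁
  rw [← h.initial_θ] at hθ₂ hθ₃
  have hest := hc.vort_estimate hα ht M.2
    (Boussinesq.norm_toL2_vort_le (hd 0 h0) (Boussinesq.IsSob.vort (hc.isSob_u h0)) hu₁) ?_ ?_
  · refine le_trans (le_of_eq ?_) hest
    rw [e t ht]
    congr 1
    refine setLIntegral_congr_fun measurableSet_Icc fun s hs => ?_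
    simp only [e s (Boussinesq.Icc_subset_timeInterval ht hs)]
  · rw [eLpNorm_exponent_top] at hθ₃
    filter_upwards [enorm_ae_le_eLpNormEssSup (θ 0) volume] with x hx
    have := hx.trans hθ₃
    rw [← ofReal_norm] at this
    exact (ENNReal.ofReal_le_iff_le_toReal ENNReal.coe_ne_top).1 this
  · rw [Boussinesq.norm_toL2 (hc.isSob_θ h0).memLp]
    exact ENNReal.toReal_le_of_le_ofReal M.2 (hθ₂.trans (by simp))
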